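/- Let $\mathbb D$ be the open unit disc, $\mathcal H(\mathbb D)$ the space of analytic functions on $\mathbb D$, and $dA=\frac{dx\,dy}{\pi}$. A radial weight is a non-negative $\omega\in L^1[0,1)$, extended to $\mathbb D$ by $\omega(z)=\omega(|z|)$, such that $\widehat\omega(r)=\int_r^1\omega(s)\,ds>0$ for all $0\le r<1$; it belongs to $\widehat{\mathcal D}$ if there is a constant $C\ge 1$ with $\widehat\omega(r)\le C\,\widehat\omega\left(\frac{1+r}{2}\right)$ for all $0\le r<1$. Let $B^\omega_a$, $a\in\mathbb D$, be the reproducing kernels of the Bergman space $A^2_\omega=\{f\in\mathcal H(\mathbb D):\int_{\mathbb D}|f|^2\omega\,dA<\infty\}$, that is, $B^\omega_a\in A^2_\omega$ and $f(a)=\int_{\mathbb D}f\,\overline{B^\omega_a}\,\omega\,dA$ for all $f\in A^2_\omega$, and put $$H_\omega(f)(z)=\int_0^1 f(t)\left(\frac1z\int_0^z B^\omega_t(u)\,du\right)\omega(t)\,dt ,\qquad z\in\mathbb D,$$ where the expression in parentheses means $B^\omega_t(0)$ for $z=0$. Let $M_q(r,f)=\left(\frac1{2\pi}\int_0^{2\pi}|f(re^{i\theta})|^q\,d\theta\right)^{1/q}$,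 and for $1<p,q<\infty$ consider the spaces of those $f\in\mathcal H(\mathbb D)$ for which the following norms are finite: $$\|f\|_{H^p}=\sup_{0<r<1}M_p(r,f),\qquad \|f\|_{H^1(p,q,\alpha)}=\left(|f(0)|^p+\int_0^1M_q(r,f')^p(1-r)^{\alpha}\,dr\right)^{1/p},$$ $$\|f\|_{D^p_{p-1}}=\left(|f(0)|^p+p\int_{\mathbb D}|f'(z)|^p(1-|z|^2)^{p-1}\,dA(z)\right)^{1/p},\qquad \|f\|_{HL(p)}=\left(\sum_{n=0}^\infty|\widehat f(n)|^p(n+1)^{p-2}\right)^{1/p},$$ where $\alpha>0$ and $f(z)=\sum_{n\ge0}\widehat f(n)z^n$. We say that $H_\omega:Y\to X$ is bounded if for every $f\in Y$ the integral defining $H_\omega(f)(z)$ converges absolutely for every $z\in\mathbb D$, $H_\omega(f)\in X$, and $\|H_\omega(f)\|_X\le C\|f\|_Y$ with $C$ independent of $f$. Here $L^p[0,1)$ consists of complex-valued functions, with respect to Lebesgue measure, and $H_\omega$ acts on functions on $\mathbb D$ through their restriction to $[0,1)$. **Theorem.** Let $\omega\in\widehat{\mathcal D}$, $1<p<\infty$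 and $p'=\frac{p}{p-1}$. The following statements are equivalent: 1. $H_\omega:L^p[0,1)\to H^p$ is bounded; 2. $H_\omega:L^p[0,1)\to D^p_{p-1}$ is bounded; 3. $H_\omega:L^p[0,1)\to H^1\left(p,q,p\left(1-\frac1q\right)\right)$ is bounded for all $1<q<\infty$; 4. $H_\omega:L^p[0,1)\to H^1\left(p,q,p\left(1-\frac1q\right)\right)$ is bounded for some $1<q<\infty$; 5. $H_\omega:L^p[0,1)\to HL(p)$ is bounded; 6. $\displaystyle\sup_{0<r<1}\left(1+\int_0^r\frac{dt}{\widehat\omega(t)^p}\right)^{1/p}\left(\int_r^1\omega(t)^{p'}\,dt\right)^{1/p'}<\infty.$ In particular, if condition 6 holds, then $H_\omega:H^p\to H^p$ is bounded. -/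

import Mathlib

open MeasureTheory
open scoped ENNReal NNReal ComplexConjugate

noncomputable section

namespace RadialHilbert

/-- The open unit disc. -/
def disc : Set ℂ := Metric.ball 0 1

/-- The normalized area measure `dA = dx dy / π` on the unit disc. -/
def areaMeasure : Measure ℂ :=
  ENNReal.ofReal Real.pi⁻¹ • (volume : Measure ℂ).restrict disc

/-- Lebesgue measure on `[0,1)`. -/
def unitMeasure : Measure ℝ := volume.restrict (Set.Ico 0 1)

/-! ### Radial weights -/

/-- The tail integral `∫_r^1 ω(s) ds`. -/
def tail (ω : ℝ → ℝ) (r : ℝ) : ℝ := ∫ s in Set.Ico r 1, ω s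

/-- A radial weight `z ↦ ω(|z|)`, given by its profile on `[0,1)`: non-negative, integrable, and
with strictly positive tail integrals. Values of `ω` outside `[0,1)` play no role. -/
structure IsRadialWeight (ω : ℝ → ℝ) : Prop where
  nonneg : ∀ t ∈ Set.Ico (0 : ℝ) 1, 0 ≤ ω t
  integrable : Integrable ω unitMeasure
  tail_pos : ∀ r ∈ Set.Ico (0 : ℝ) 1, 0 < tail ω r

/-- The class of radial weights whose tail integral is (upper) doubling. -/
structure IsUpperDoubling (ω : ℝ → ℝ) : Prop extends IsRadialWeight ω where
  doubling : ∃ C : ℝ, 1 ≤ C ∧ ∀ r ∈ Set.Ico (0 : ℝ) 1, tail ω r ≤ C * tail ω ((1 + r) / 2)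

/-! ### Bergman spaces and the reproducing kernels of `A²_ω` -/

/-- `‖f‖_{A^p_ω}^p = ∫_𝔻 |f|^p ω dA`. -/
def bergmanNormPow (ω : ℝ → ℝ) (p : ℝ) (f : ℂ → ℂ) : ℝ≥0∞ :=
  ∫⁻ z, ‖f z‖ₑ ^ p * ENNReal.ofReal (ω ‖z‖) ∂areaMeasure

/-- Membership in the weighted Bergman space `A^p_ω`. -/
def MemBergman (ω : ℝ → ℝ) (p : ℝ) (f : ℂ → ℂ) : Prop :=
  DifferentiableOn ℂ f disc ∧ bergmanNormPow ω p f < ∞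

/-- `B` represents the evaluation at `a` on the Hilbert space `A²_ω`. -/
def IsBergmanKernelAt (ω : ℝ → ℝ) (a : ℂ) (B : ℂ → ℂ) : Prop :=
  MemBergman ω 2 B ∧
    ∀ f : ℂ → ℂ, MemBergman ω 2 f →
      f a = ∫ ζ, f ζ * conj (B ζ) * (ω ‖ζ‖ : ℂ) ∂areaMeasure

/-- The Bergman reproducing kernel `B^ω_a`. For a radial weight and `a ∈ 𝔻` it exists by the Riesz
representation theorem, and the reproducing property determines it on `𝔻`. -/
def bergmanKernel (ω : ℝ → ℝ) (a : ℂ) : ℂ → ℂ :=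
  Classical.epsilon (IsBergmanKernelAt ω a)

/-! ### The Hilbert-type operator -/

/-- `K^ω_a(z) = (1/z) ∫_0^z B^ω_a(u) du`, the integral being taken along the segment `u = s z`,
`0 ≤ s ≤ 1`, so that the factor `1/z` cancels; at `z = 0` this is the limit value `B^ω_a(0)`. -/
def hilbertKernel (ω : ℝ → ℝ) (a z : ℂ) : ℂ :=
  ∫ s : ℝ in (0 : ℝ)..1, bergmanKernel ω a (s * z)

/-- The integrand `t ↦ f(t) K^ω_t(z) ω(t)`. -/
def hilbertIntegrand (ω : ℝ → ℝ) (f : ℝ → ℂ) (z : ℂ) (t : ℝ) : ℂ :=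
  f t * hilbertKernel ω t z * (ω t : ℂ)

/-- `H_ω(f)(z) = ∫_0^1 f(t) K^ω_t(z) ω(t) dt`. -/
def hilbertOp (ω : ℝ → ℝ) (f : ℝ → ℂ) (z : ℂ) : ℂ :=
  ∫ t, hilbertIntegrand ω f z t ∂unitMeasure

/-- `H_ω(f)` is well defined: the defining integral converges absolutely at each point of `𝔻`. -/
def HilbertOpDefined (ω : ℝ → ℝ) (f : ℝ → ℂ) : Prop :=
  ∀ z ∈ disc, Integrable (hilbertIntegrand ω f z) unitMeasure

/-! ### Norms on spaces of analytic functions -/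

/-- The integral mean `M_p(r,f)`. -/
def integralMean (p r : ℝ) (f : ℂ → ℂ) : ℝ≥0∞ :=
  (ENNReal.ofReal (2 * Real.pi)⁻¹ *
    ∫⁻ θ in Set.Ico 0 (2 * Real.pi), ‖f (circleMap 0 r θ)‖ₑ ^ p) ^ (1 / p)

/-- The norm of the Hardy space `H^p`. -/
def hardyNorm (p : ℝ) (f : ℂ → ℂ) : ℝ≥0∞ :=
  ⨆ r ∈ Set.Ioo (0 : ℝ) 1, integralMean p r f

/-- The norm of `H¹(p,q,α)`. -/
def mixedNorm (p q α : ℝ) (f : ℂ → ℂ) : ℝ≥0∞ :=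
  (‖f 0‖ₑ ^ p + ∫⁻ r in Set.Ico (0 : ℝ) 1,
    integralMean q r (deriv f) ^ p * ENNReal.ofReal ((1 - r) ^ α)) ^ (1 / p)

/-- The standard weight `(α+1)(1-r²)^α`. -/
def standardWeight (α r : ℝ) : ℝ := (α + 1) * (1 - r ^ 2) ^ α

/-- The norm of the Dirichlet-type space `D^p_{p-1}`. -/
def dirichletNorm (p : ℝ) (f : ℂ → ℂ) : ℝ≥0∞ :=
  (‖f 0‖ₑ ^ p + bergmanNormPow (standardWeight (p - 1)) p (deriv f)) ^ (1 / p)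

/-- The `n`-th Taylor coefficient of `f` at the origin. -/
def taylorCoeff (f : ℂ → ℂ) (n : ℕ) : ℂ := iteratedDeriv n f 0 / (n.factorial : ℂ)

/-- The norm of the Hardy–Littlewood space `HL(p)`. -/
def hardyLittlewoodNorm (p : ℝ) (f : ℂ → ℂ) : ℝ≥0∞ :=
  (∑' n : ℕ, ‖taylorCoeff f n‖ₑ ^ p * ((n : ℝ≥0∞) + 1) ^ (p - 2)) ^ (1 / p)

/-- The space of analytic functions on `𝔻` with finite `N`-norm. -/
def MemSpace (N : (ℂ → ℂ) → ℝ≥0∞) (f : ℂ → ℂ) : Prop :=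
  DifferentiableOn ℂ f disc ∧ N f < ∞

/-! ### Boundedness -/

/-- `H_ω` is a well-defined bounded operator from `L^p[0,1)` into the space of analytic functions
on `𝔻` with norm `N`. -/
def BoundedFromLp (ω : ℝ → ℝ) (p : ℝ) (N : (ℂ → ℂ) → ℝ≥0∞) : Prop :=
  ∃ C : ℝ≥0, ∀ f : ℝ → ℂ, MemLp f (ENNReal.ofReal p) unitMeasure →
    HilbertOpDefined ω f ∧ MemSpace N (hilbertOp ω f) ∧
      N (hilbertOp ω f) ≤ C * eLpNorm f (ENNReal.ofReal p) unitMeasure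

/-- `H_ω` is a well-defined bounded operator on the Hardy space `H^p`; it acts on `f ∈ H^p`
through the restriction of `f` to `[0,1)`. -/
def BoundedOnHardy (ω : ℝ → ℝ) (p : ℝ) : Prop :=
  ∃ C : ℝ≥0, ∀ f : ℂ → ℂ, MemSpace (hardyNorm p) f →
    HilbertOpDefined ω (fun t => f t) ∧ MemSpace (hardyNorm p) (hilbertOp ω (fun t => f t)) ∧
      hardyNorm p (hilbertOp ω (fun t => f t)) ≤ C * hardyNorm p f

/-- `sup_{0<r<1} (1 + ∫_0^r ω̂(t)^{-p} dt)^{1/p} (∫_r^1 ω(t)^{p'} dt)^{1/p'} < ∞`, where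
`p' = p/(p-1)`. -/
def MuckenhouptCondition (ω : ℝ → ℝ) (p : ℝ) : Prop :=
  (⨆ r ∈ Set.Ioo (0 : ℝ) 1,
    (1 + ∫⁻ t in Set.Ico 0 r, ENNReal.ofReal (1 / tail ω t ^ p)) ^ (1 / p) *
      (∫⁻ t in Set.Ico r 1, ENNReal.ofReal (ω t ^ p.conjExponent)) ^ (1 / p.conjExponent)) < ∞

end RadialHilbert

end

noncomputable section

namespace RadialHilbert

section


/-! ### Discrete inequalities -/

/-! Put r_k = 1 - 2^{-k} (`node k`), h_k = ω̂(r_k)^{-1} ∫_{r_k}^1 |f| ω (`tailAverage`) and E(f) =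
Σ_k 2^{-k} h_k^p (`dyadicEnergy`). The theorem holds because the p-th power of each of the norms of
H_ω(f) is at most a constant times E(f), is at least a constant times E(f) when f ≥ 0, and because
condition 6 is exactly what makes the weighted Hardy inequality E(f) ≤ B ‖f‖_p^p true. The spaces
are never compared with one another; in particular no Littlewood–Paley inequality enters.

Power series. Orthogonality of the monomials gives B_a(z) = Σ (conj(a) z)^n / (2 ω_{2n+1}) with ω_m
= ∫ t^m ω, so H_ω(f) has the Taylor coefficients (∫ f t^n ω) / (2 (n+1) ω_{2n+1}). Doubling makes
ω_{2n+1} comparable with ω̂(r_k) for n+1 ≈ 2^k: the ratio ω̂(r_j)/ω̂(r_k) ≤ C^{k-j} is beaten by the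
bound exp(-2^{k-j}/2) for t^n near r_j (`IsUpperDoubling.exists_pow_le_sum`).

Upper bounds. The derivative of the kernel is a power series in tz with increasing coefficients.
Summation by parts bounds it by a constant times 1/(ω̂(r_i) |1-tz|) when |tz| ≤ r_{i+1}, whence
|H_ω(f)'(re^{iθ})| ≲ Σ_{j≤k} h_j / (2^{-j}+|θ|) for r < r_{k+1}
(`IsUpperDoubling.exists_enorm_deriv_le`). The mixed and Dirichlet norms then reduce to the discrete
Hardy inequality Σ 2^{-k} (h_0+…+h_k)^p ≲ E(f), and so does the Hardy–Littlewood norm, read off the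
coefficients. The Hardy norm is obtained by integrating along radii and using Hilbert's inequality
for 1/(2^{-m}+2^{-j}).

Lower bounds. For u ≥ 0 there is no cancellation: h_k ≲ (n+1)|a_n| for each coefficient a_n of F =
H_ω(u) with 2^k ≤ n+1 < 2^{k+1}. Summation over n gives the Hardy–Littlewood norm. On the radius it
gives h_k ≲ F(s) for s ≥ r_k, and a Fejér–Riesz inequality leads to H^p; it also gives 2^k h_k ≲
F'(s), and the growth of F' in terms of M_q(r,F') leads to the mixed and Dirichlet norms.

Weighted Hardy inequality. E(f) = Σ v_k (∫_{r_k}^1 |f| ω)^p with v_k = 2^{-k} ω̂(r_k)^{-p}, and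
doubling makes v_0+…+v_k comparable with 1 + ∫_0^{r_k} ω̂^{-p}. Sufficiency of condition 6 is a
Schur test (`exists_weighted_hardy_const`). For necessity the test functions are min(ω,n)^{p'-1} on
[r_k,1), the truncation keeping all quantities finite. The claim on H^p follows since, by
Fejér–Riesz, restriction to the radius maps H^p into L^p[0,1). -/

theorem tsum_mul_le_Lp_mul_Lq {p q : ℝ} (hpq : p.HolderConjugate q) (f g : ℕ → ℝ≥0∞) :
    ∑' i, f i * g i ≤ (∑' i, f i ^ p) ^ (1 / p) * (∑' i, g i ^ q) ^ (1 / q) := by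
  have h := ENNReal.lintegral_mul_le_Lp_mul_Lq (Measure.count : Measure ℕ) hpq
    (f := f) (g := g) (Measurable.of_discrete).aemeasurable (Measurable.of_discrete).aemeasurable
  simpa [lintegral_count] using h

/-- A Schur test for matrices with non-negative entries `K₁ k j * K₂ k j`. -/
theorem tsum_schur {p q : ℝ} (hpq : p.HolderConjugate q) (K₁ K₂ : ℕ → ℕ → ℝ≥0∞)
    (A : ℕ → ℝ≥0∞) (B : ℝ≥0∞) (hA : ∀ k, ∑' j, K₁ k j ^ q ≤ A k)
    (hB : ∀ j, ∑' k, A k ^ (p / q) * K₂ k j ^ p ≤ B) (a : ℕ → ℝ≥0∞) :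
    ∑' k, (∑' j, K₁ k j * K₂ k j * a j) ^ p ≤ B * ∑' j, a j ^ p := by
  have hp := hpq.pos
  have hq := hpq.symm.pos
  have h1 : ∀ k, (∑' j, K₁ k j * K₂ k j * a j) ^ p ≤
      ∑' j, A k ^ (p / q) * K₂ k j ^ p * a j ^ p := by
    intro k
    have h := tsum_mul_le_Lp_mul_Lq hpq.symm (K₁ k) (fun j => K₂ k j * a j)
    calc (∑' j, K₁ k j * K₂ k j * a j) ^ p
        ≤ ((∑' j, K₁ k j ^ q) ^ (1 / q) * (∑' j, (K₂ k j * a j) ^ p) ^ (1 / p)) ^ p := by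
          gcongr
          simpa only [mul_assoc] using h
      _ ≤ ((A k) ^ (1 / q) * (∑' j, (K₂ k j * a j) ^ p) ^ (1 / p)) ^ p := by
          gcongr
          exact hA k
      _ = A k ^ (p / q) * ∑' j, (K₂ k j * a j) ^ p := by
          rw [ENNReal.mul_rpow_of_nonneg _ _ hp.le, ← ENNReal.rpow_mul, ← ENNReal.rpow_mul,
            one_div_mul_cancel hp.ne', ENNReal.rpow_one, one_div_mul_eq_div]
      _ = _ := by
          rw [← ENNReal.tsum_mul_left]
          simp_rw [ENNReal.mul_rpow_of_nonneg _ _ hp.le, mul_assoc]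
  calc ∑' k, (∑' j, K₁ k j * K₂ k j * a j) ^ p
      ≤ ∑' k, ∑' j, A k ^ (p / q) * K₂ k j ^ p * a j ^ p := ENNReal.tsum_le_tsum h1
    _ = ∑' j, ∑' k, A k ^ (p / q) * K₂ k j ^ p * a j ^ p := ENNReal.tsum_comm
    _ = ∑' j, (∑' k, A k ^ (p / q) * K₂ k j ^ p) * a j ^ p := by
        simp_rw [ENNReal.tsum_mul_right]
    _ ≤ ∑' j, B * a j ^ p := ENNReal.tsum_le_tsum fun j => by
        gcongr
        exact hB j
    _ = _ := ENNReal.tsum_mul_left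

theorem tsum_ite_le_pow_sub (η : ℝ≥0∞) (k : ℕ) :
    ∑' j, (if j ≤ k then η ^ (k - j) else 0) ≤ (1 - η)⁻¹ := by
  rw [← ENNReal.tsum_geometric]
  rw [tsum_eq_sum (s := Finset.range (k + 1))]
  · rw [← Finset.sum_range_reflect]
    refine le_trans (Finset.sum_le_sum fun j hj => ?_) (ENNReal.sum_le_tsum (Finset.range (k + 1)))
    have : j ≤ k := by simpa [Nat.lt_succ_iff] using hj
    have e2 : k - (k - j) = j := by omega
    simp [e2]
  · intro j hj
    have : ¬ j ≤ k := by simpa [Nat.lt_succ_iff] using hj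
    simp [this]

theorem tsum_ite_le_pow_sub' (η : ℝ≥0∞) (k : ℕ) :
    ∑' j, (if k ≤ j then η ^ (j - k) else 0) ≤ (1 - η)⁻¹ := by
  rw [← ENNReal.tsum_geometric]
  have hinj : Function.Injective (fun i : ℕ => i + k) := fun a b h => by simpa using h
  rw [← hinj.tsum_eq (f := fun j => if k ≤ j then η ^ (j - k) else 0)]
  · simp
  · intro j hj
    simp only [Function.mem_support, ne_eq, ite_eq_right_iff, not_forall] at hj
    exact ⟨j - k, by simp [hj.1]⟩

theorem tsum_pow_abs_sub_le (η : ℝ≥0∞) (k : ℕ) :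
    ∑' j, η ^ ((k - j) + (j - k)) ≤ 2 * (1 - η)⁻¹ := by
  calc ∑' j, η ^ ((k - j) + (j - k))
      ≤ ∑' j, ((if j ≤ k then η ^ (k - j) else 0) + (if k ≤ j then η ^ (j - k) else 0)) := by
        refine ENNReal.tsum_le_tsum fun j => ?_
        rcases le_total j k with h | h
        · have : j - k = 0 := by omega
          simp [h, this]
        · have : k - j = 0 := by omega
          simp [h, this]
    _ ≤ (1 - η)⁻¹ + (1 - η)⁻¹ := by
        rw [ENNReal.tsum_add]
        exact add_le_add (tsum_ite_le_pow_sub η k) (tsum_ite_le_pow_sub' η k)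
    _ = _ := (two_mul _).symm

/-- Matrices with geometric decay off the diagonal act boundedly on `ℓ^p`. -/
theorem tsum_geometric_kernel_le {p q : ℝ} (hpq : p.HolderConjugate q) (η : ℝ≥0∞)
    (a : ℕ → ℝ≥0∞) :
    ∑' k : ℕ, (∑' j : ℕ, η ^ ((k - j) + (j - k)) * a j) ^ p ≤
      (2 * (1 - η)⁻¹) ^ p * ∑' j, a j ^ p := by
  have hp := hpq.pos
  have hq := hpq.symm.pos
  have e1 : ∀ x : ℝ≥0∞, x ^ (1 / q) * x ^ (1 / p) = x := fun x => by
    rw [← ENNReal.rpow_add_of_nonneg _ _ (by positivity) (by positivity), one_div, one_div,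
      add_comm, hpq.inv_add_inv_eq_one, ENNReal.rpow_one]
  have e2 : ∀ (x : ℝ≥0∞) {s : ℝ}, 0 < s → (x ^ (1 / s)) ^ s = x := fun x s hs => by
    rw [← ENNReal.rpow_mul, one_div_mul_cancel hs.ne', ENNReal.rpow_one]
  -- The kernel is split into its powers 1/q and 1/p; its row and column sums share one bound, so a
  -- constant Schur weight suffices.
  have h := tsum_schur hpq (fun k j => (η ^ ((k - j) + (j - k))) ^ (1 / q))
    (fun k j => (η ^ ((k - j) + (j - k))) ^ (1 / p)) (fun _ => 2 * (1 - η)⁻¹)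
    ((2 * (1 - η)⁻¹) ^ p) (fun k => by
      simp_rw [e2 _ hq]
      exact tsum_pow_abs_sub_le η k) (fun j => by
      simp_rw [e2 _ hp]
      rw [ENNReal.tsum_mul_left]
      calc (2 * (1 - η)⁻¹) ^ (p / q) * ∑' k : ℕ, η ^ ((k - j) + (j - k))
          ≤ (2 * (1 - η)⁻¹) ^ (p / q) * (2 * (1 - η)⁻¹) ^ (1 : ℝ) := by
            gcongr
            rw [ENNReal.rpow_one]
            simpa only [add_comm] using tsum_pow_abs_sub_le η j
        _ = _ := by
            rw [← ENNReal.rpow_add_of_nonneg _ _ (by positivity) (by positivity)]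
            congr 1
            have := hpq.inv_add_inv_eq_one
            field_simp at this ⊢
            linarith) a
  simp_rw [e1] at h
  exact h

/-! ### Hilbert's inequality at dyadic points -/

/-- The powers of two `2^{-s}` in `[0,∞]`. -/
def invTwoPow (s : ℝ) : ℝ≥0∞ := (2 : ℝ≥0∞) ^ (-s)

theorem invTwoPow_lt_one {s : ℝ} (hs : 0 < s) : invTwoPow s < 1 := by
  unfold invTwoPow
  exact ENNReal.rpow_lt_one_of_one_lt_of_neg (by norm_num) (by linarith)

theorem invTwoPow_mul {p q : ℝ} (hpq : p.HolderConjugate q) :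
    invTwoPow (1 / p) * invTwoPow (1 / q) = 2⁻¹ := by
  unfold invTwoPow
  rw [← ENNReal.rpow_add _ _ (by norm_num) (by norm_num)]
  have := hpq.inv_add_inv_eq_one
  rw [← ENNReal.rpow_neg_one]
  congr 1
  simp only [one_div]
  linarith

theorem invTwoPow_pow_rpow {p : ℝ} (hp : 0 < p) (k : ℕ) :
    (invTwoPow (1 / p) ^ k) ^ p = 2⁻¹ ^ k := by
  rw [← ENNReal.rpow_natCast, ← ENNReal.rpow_mul, mul_comm, ENNReal.rpow_mul,
    ENNReal.rpow_natCast, invTwoPow, ← ENNReal.rpow_mul, ← ENNReal.rpow_neg_one]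
  congr 2
  field_simp

theorem invTwoPow_ne_top (s : ℝ) : invTwoPow s ≠ ∞ := by
  unfold invTwoPow
  simp

theorem invTwoPow_ne_zero (s : ℝ) : invTwoPow s ≠ 0 := by
  unfold invTwoPow
  simp

theorem two_inv_pow_mul_rpow {p : ℝ} (hp : 0 < p) (k : ℕ) (x : ℝ≥0∞) :
    2⁻¹ ^ k * x ^ p = (invTwoPow (1 / p) ^ k * x) ^ p := by
  rw [ENNReal.mul_rpow_of_nonneg _ _ hp.le, invTwoPow_pow_rpow hp]

/-- The dyadic values of the kernel `1 / (x + y)`. -/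
def dyadicKernel (m j : ℕ) : ℝ≥0∞ := ENNReal.ofReal (1 / ((1 / 2) ^ m + (1 / 2) ^ j))

theorem dyadicKernel_comm (m j : ℕ) : dyadicKernel m j = dyadicKernel j m := by
  unfold dyadicKernel
  rw [add_comm]

theorem ofReal_one_div_half_pow (m : ℕ) : ENNReal.ofReal (1 / (1 / 2) ^ m) = 2 ^ m := by
  rw [one_div_pow, one_div_one_div, ENNReal.ofReal_pow (by norm_num)]
  norm_num

theorem ofReal_half_pow (m : ℕ) : ENNReal.ofReal ((1 / 2) ^ m) = 2⁻¹ ^ m := by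
  rw [ENNReal.ofReal_pow (by norm_num), one_div, ENNReal.ofReal_inv_of_pos (by norm_num)]
  norm_num

theorem dyadicKernel_le_left (m j : ℕ) : dyadicKernel m j ≤ 2 ^ m := by
  unfold dyadicKernel
  rw [← ofReal_one_div_half_pow]
  apply ENNReal.ofReal_le_ofReal
  apply one_div_le_one_div_of_le (by positivity)
  have : (0 : ℝ) ≤ (1 / 2) ^ j := by positivity
  linarith

/-- For j ≤ m the kernel is at most 2^j, and 1/p + 1/q = 1 leaves 2^{-(m-j)/p}; for m ≤ j the same
argument leaves 2^{-(j-m)/q}. The exponent is |m-j|, since one of the two truncated differences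
vanishes. -/
theorem dyadicKernel_bound {p q : ℝ} (hpq : p.HolderConjugate q) (m j : ℕ) :
    invTwoPow (1 / p) ^ m * dyadicKernel m j * invTwoPow (1 / q) ^ j ≤
      (max (invTwoPow (1 / p)) (invTwoPow (1 / q))) ^ ((m - j) + (j - m)) := by
  have key : ∀ i : ℕ, (invTwoPow (1 / p) * invTwoPow (1 / q)) ^ i * 2 ^ i = 1 := fun i => by
    rw [invTwoPow_mul hpq, ← mul_pow, ENNReal.inv_mul_cancel (by norm_num) (by norm_num), one_pow]
  rcases le_total j m with h | h
  · obtain ⟨i, rfl⟩ := Nat.exists_eq_add_of_le h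
    have e : (j + i - j) + (j - (j + i)) = i := by omega
    rw [e]
    calc _ ≤ invTwoPow (1 / p) ^ (j + i) * 2 ^ j * invTwoPow (1 / q) ^ j := by
            gcongr
            rw [dyadicKernel_comm]
            exact dyadicKernel_le_left _ _
      _ = invTwoPow (1 / p) ^ i * ((invTwoPow (1 / p) * invTwoPow (1 / q)) ^ j * 2 ^ j) := by ring
      _ = invTwoPow (1 / p) ^ i := by rw [key, mul_one]
      _ ≤ _ := by
        gcongr
        exact le_max_left _ _
  · obtain ⟨i, rfl⟩ := Nat.exists_eq_add_of_le h
    have e : (m - (m + i)) + (m + i - m) = i := by omega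
    rw [e]
    calc _ ≤ invTwoPow (1 / p) ^ m * 2 ^ m * invTwoPow (1 / q) ^ (m + i) := by
            gcongr
            exact dyadicKernel_le_left _ _
      _ = invTwoPow (1 / q) ^ i * ((invTwoPow (1 / p) * invTwoPow (1 / q)) ^ m * 2 ^ m) := by ring
      _ = invTwoPow (1 / q) ^ i := by rw [key, mul_one]
      _ ≤ _ := by
        gcongr
        exact le_max_right _ _

/-- The constant in the discrete Hilbert inequality. -/
def hilbertConst (p q : ℝ) : ℝ≥0∞ :=
  (2 * (1 - max (invTwoPow (1 / p)) (invTwoPow (1 / q)))⁻¹) ^ p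

theorem hilbertConst_ne_top {p q : ℝ} (hpq : p.HolderConjugate q) : hilbertConst p q ≠ ∞ := by
  unfold hilbertConst
  have hp := hpq.pos
  have hq := hpq.symm.pos
  have : max (invTwoPow (1 / p)) (invTwoPow (1 / q)) < 1 :=
    max_lt (invTwoPow_lt_one (by positivity)) (invTwoPow_lt_one (by positivity))
  apply ENNReal.rpow_ne_top_of_nonneg hp.le
  apply ENNReal.mul_ne_top (by norm_num)
  rw [ENNReal.inv_ne_top]
  exact ne_of_gt (tsub_pos_of_lt this)

/-- The discrete Hilbert inequality at dyadic points. -/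
theorem tsum_dyadicKernel_le {p q : ℝ} (hpq : p.HolderConjugate q) (x : ℕ → ℝ≥0∞) :
    ∑' m : ℕ, 2⁻¹ ^ m * (∑' j : ℕ, dyadicKernel m j * (invTwoPow (1 / q) ^ j * x j)) ^ p ≤
      hilbertConst p q * ∑' j, x j ^ p := by
  refine le_trans (ENNReal.tsum_le_tsum fun m => ?_) (tsum_geometric_kernel_le hpq _ x)
  rw [two_inv_pow_mul_rpow hpq.pos, ← ENNReal.tsum_mul_left]
  have hp := hpq.pos
  gcongr ?_ ^ p
  refine ENNReal.tsum_le_tsum fun j => ?_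
  calc _ = (invTwoPow (1 / p) ^ m * dyadicKernel m j * invTwoPow (1 / q) ^ j) * x j := by ring
    _ ≤ _ := by
      gcongr
      exact dyadicKernel_bound hpq m j

/-- A discrete Hardy inequality. -/
theorem tsum_sum_range_le {p q : ℝ} (hpq : p.HolderConjugate q) (h : ℕ → ℝ≥0∞) :
    ∑' k : ℕ, 2⁻¹ ^ k * (∑ j ∈ Finset.range (k + 1), h j) ^ p ≤
      hilbertConst p q * ∑' k, 2⁻¹ ^ k * h k ^ p := by
  have hp := hpq.pos
  simp_rw [two_inv_pow_mul_rpow hp]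
  refine le_trans (ENNReal.tsum_le_tsum fun m => ?_)
    (tsum_geometric_kernel_le hpq _ fun j => invTwoPow (1 / p) ^ j * h j)
  gcongr ?_ ^ p
  rw [Finset.mul_sum]
  refine le_trans (Finset.sum_le_sum fun j hj => ?_) (ENNReal.sum_le_tsum (Finset.range (m + 1)))
  have hj : j ≤ m := by simpa [Nat.lt_succ_iff] using hj
  obtain ⟨i, rfl⟩ := Nat.exists_eq_add_of_le hj
  have e : (j + i - j) + (j - (j + i)) = i := by omega
  -- 2^{-(j+i)/p} = 2^{-i/p} 2^{-j/p}: distance i from the diagonal is paid by geometric decay.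
  rw [e, pow_add, mul_comm (_ ^ j), mul_assoc]
  gcongr
  exact le_max_left _ _

end

section


/-! ### Dyadic decompositions of `[0,1)` and of the circle -/

/-- The dyadic points `1 - 2^{-k}` of `[0,1)`. -/
def node (k : ℕ) : ℝ := 1 - (1 / 2) ^ k

theorem node_zero : node 0 = 0 := by simp [node]

theorem node_lt_one (k : ℕ) : node k < 1 := by
  have : (0 : ℝ) < (1 / 2) ^ k := by positivity
  unfold node; linarith

theorem node_mono : Monotone node := fun a b h => by
  have : ((1 : ℝ) / 2) ^ b ≤ (1 / 2) ^ a := pow_le_pow_of_le_one (by norm_num) (by norm_num) h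
  unfold node; linarith

theorem node_nonneg (k : ℕ) : 0 ≤ node k := node_zero ▸ node_mono (Nat.zero_le k)

theorem one_sub_node (k : ℕ) : 1 - node k = (1 / 2) ^ k := by unfold node; ring

theorem node_succ_sub (k : ℕ) : node (k + 1) - node k = (1 / 2) ^ (k + 1) := by
  unfold node; ring

theorem exists_lt_node {t : ℝ} (ht : t < 1) : ∃ k, t < node k := by
  obtain ⟨k, hk⟩ := exists_pow_lt_of_lt_one (sub_pos.2 ht) (by norm_num : (1 / 2 : ℝ) < 1)
  exact ⟨k, by unfold node; linarith⟩

/-- Locating `t` among the first `k` dyadic points. -/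
theorem exists_node_le {t : ℝ} (ht : 0 ≤ t) (k : ℕ) :
    ∃ i ≤ k, node i ≤ t ∧ (i = k ∨ t < node (i + 1)) := by
  induction k with
  | zero => exact ⟨0, le_rfl, by simpa [node_zero] using ht, Or.inl rfl⟩
  | succ k ih =>
    obtain ⟨i, hik, hit, h⟩ := ih
    rcases h with rfl | h
    · by_cases h' : t < node (i + 1)
      · exact ⟨i, by omega, hit, Or.inr h'⟩
      · exact ⟨i + 1, le_rfl, not_lt.1 h', Or.inl rfl⟩
    · exact ⟨i, by omega, hit, Or.inr h⟩

theorem iUnion_Ico_node : ⋃ k, Set.Ico (node k) (node (k + 1)) = Set.Ico 0 1 := by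
  ext t
  simp only [Set.mem_iUnion, Set.mem_Ico]
  constructor
  · rintro ⟨k, h1, h2⟩
    exact ⟨(node_nonneg k).trans h1, h2.trans (node_lt_one _)⟩
  · rintro ⟨h0, h1⟩
    obtain ⟨k, hk⟩ := exists_lt_node h1
    obtain ⟨i, -, hi, h⟩ := exists_node_le h0 k
    rcases h with rfl | h
    · exact absurd hi (not_le.2 hk)
    · exact ⟨i, hi, h⟩

theorem lintegral_Ico_eq_tsum (φ : ℝ → ℝ≥0∞) :
    ∫⁻ t in Set.Ico 0 1, φ t = ∑' k, ∫⁻ t in Set.Ico (node k) (node (k + 1)), φ t := by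
  rw [← iUnion_Ico_node]
  exact lintegral_iUnion (fun _ => measurableSet_Ico) node_mono.pairwise_disjoint_on_Ico_succ φ

theorem volume_Ico_node (k : ℕ) :
    volume (Set.Ico (node k) (node (k + 1))) = 2⁻¹ ^ (k + 1) := by
  rw [Real.volume_Ico, node_succ_sub, ofReal_half_pow]

/-! ### Dyadic shells on the circle -/

/-- The distance of the angle `θ ∈ [0,2π]` to `0` on the circle. -/
def angle (θ : ℝ) : ℝ := min θ (2 * Real.pi - θ)

theorem continuous_angle : Continuous angle := by unfold angle; fun_prop

theorem angle_nonneg {θ : ℝ} (hθ : θ ∈ Set.Ico 0 (2 * Real.pi)) : 0 ≤ angle θ :=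
  le_min hθ.1 (by linarith [hθ.2])

/-- The dyadic shells around the angle `0`. -/
def shell (m : ℕ) : Set ℝ :=
  Set.Ioo 0 (2 * Real.pi) ∩
    angle ⁻¹' Set.Ioc (Real.pi * (1 / 2) ^ (m + 1)) (Real.pi * (1 / 2) ^ m)

theorem measurableSet_shell (m : ℕ) : MeasurableSet (shell m) :=
  measurableSet_Ioo.inter (continuous_angle.measurable measurableSet_Ioc)

theorem shell_subset (m : ℕ) : shell m ⊆ Set.Ico 0 (2 * Real.pi) :=
  fun _ h => ⟨h.1.1.le, h.1.2⟩

theorem half_pow_le_angle {m : ℕ} {θ : ℝ} (h : θ ∈ shell m) : (1 / 2) ^ m ≤ angle θ := by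
  refine le_trans ?_ h.2.1.le
  have := Real.pi_gt_three
  have h2 : (0 : ℝ) < (1 / 2) ^ m := by positivity
  rw [pow_succ]
  nlinarith

theorem iUnion_shell : ⋃ m, shell m = Set.Ioo 0 (2 * Real.pi) := by
  ext θ
  simp only [Set.mem_iUnion]
  refine ⟨fun ⟨m, h⟩ => h.1, fun h => ?_⟩
  have hpos : 0 < angle θ := lt_min h.1 (by linarith [h.2])
  have hle : angle θ ≤ Real.pi := by
    unfold angle
    rcases le_total θ Real.pi with h' | h'
    · exact (min_le_left _ _).trans h'
    · exact (min_le_right _ _).trans (by linarith)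
  have hπ := Real.pi_pos
  have ht : 1 - angle θ / Real.pi ∈ Set.Ico (0 : ℝ) 1 := by
    constructor
    · have : angle θ / Real.pi ≤ 1 := (div_le_one hπ).2 hle
      linarith
    · have : 0 < angle θ / Real.pi := by positivity
      linarith
  rw [← iUnion_Ico_node] at ht
  obtain ⟨m, hm1, hm2⟩ := Set.mem_iUnion.1 ht
  refine ⟨m, h, ?_, ?_⟩
  · unfold node at hm2
    have : (1 / 2) ^ (m + 1) < angle θ / Real.pi := by linarith
    rwa [lt_div_iff₀ hπ, mul_comm] at this
  · unfold node at hm1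
    have : angle θ / Real.pi ≤ (1 / 2) ^ m := by linarith
    rwa [div_le_iff₀ hπ, mul_comm] at this

theorem pairwise_disjoint_shell : Pairwise (Function.onFun Disjoint shell) := by
  have : Antitone fun m : ℕ => Real.pi * (1 / 2 : ℝ) ^ m := fun a b h => by
    have := Real.pi_pos
    have h2 : ((1 : ℝ) / 2) ^ b ≤ (1 / 2) ^ a := pow_le_pow_of_le_one (by norm_num) (by norm_num) h
    dsimp only
    gcongr
  intro a b hab
  have h := this.pairwise_disjoint_on_Ioc_succ hab
  exact ((Disjoint.preimage angle h).mono Set.inter_subset_right Set.inter_subset_right)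

theorem volume_shell_le (m : ℕ) : volume (shell m) ≤ ENNReal.ofReal (2 * Real.pi) * 2⁻¹ ^ m := by
  have hπ := Real.pi_pos
  calc volume (shell m) ≤ volume (Set.Icc 0 (Real.pi * (1 / 2) ^ m) ∪
        Set.Icc (2 * Real.pi - Real.pi * (1 / 2) ^ m) (2 * Real.pi)) := by
        refine measure_mono fun θ h => ?_
        have h2 := h.2.2
        unfold angle at h2
        rcases min_le_iff.1 h2 with h3 | h3
        · exact Or.inl ⟨h.1.1.le, h3⟩
        · exact Or.inr ⟨by linarith, h.1.2.le⟩
    _ ≤ _ := measure_union_le _ _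
    _ = ENNReal.ofReal (2 * Real.pi) * 2⁻¹ ^ m := by
        rw [Real.volume_Icc, Real.volume_Icc, ← ENNReal.ofReal_add (by ring_nf; positivity)
          (by ring_nf; positivity), ← ofReal_half_pow, ← ENNReal.ofReal_mul (by positivity)]
        congr 1; ring

theorem lintegral_circle_eq_tsum (φ : ℝ → ℝ≥0∞) :
    ∫⁻ θ in Set.Ico 0 (2 * Real.pi), φ θ = ∑' m, ∫⁻ θ in shell m, φ θ := by
  rw [setLIntegral_congr (Ioo_ae_eq_Ico (μ := volume)).symm, ← iUnion_shell]
  exact lintegral_iUnion measurableSet_shell pairwise_disjoint_shell φ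

/-- Here |e^{iθ} - 1| = 2 sin(θ/2), and sin x ≥ 2x/π ≥ x/2 on [0, π/2]; the second half of the
circle is reflected to the first. -/
theorem angle_le_norm_exp_sub_one {θ : ℝ} (hθ : θ ∈ Set.Ico 0 (2 * Real.pi)) :
    angle θ ≤ 2 * ‖Complex.exp (θ * Complex.I) - 1‖ := by
  have hπ := Real.pi_pos
  have hπ4 := Real.pi_le_four
  have key : ∀ x : ℝ, 0 ≤ x → x ≤ Real.pi / 2 → x ≤ 2 * Real.sin x := fun x h0 h1 => by
    have h := Real.mul_le_sin h0 h1
    have : (1 / 2 : ℝ) ≤ 2 / Real.pi := by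
      rw [div_le_div_iff₀ (by norm_num) hπ]; linarith
    nlinarith
  rw [mul_comm (θ : ℂ), Complex.norm_exp_I_mul_ofReal_sub_one, Real.norm_eq_abs,
    abs_of_nonneg (mul_nonneg (by norm_num) (Real.sin_nonneg_of_nonneg_of_le_pi
      (by linarith [hθ.1]) (by linarith [hθ.2])))]
  unfold angle
  rcases le_total θ Real.pi with h | h
  · have := key (θ / 2) (by linarith [hθ.1]) (by linarith)
    exact (min_le_left _ _).trans (by linarith)
  · have := key (Real.pi - θ / 2) (by linarith [hθ.2]) (by linarith)
    rw [Real.sin_pi_sub] at this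
    exact (min_le_right _ _).trans (by linarith)

/-- The angle is at most 2(N + (1-s)) ≤ 4N, and one more N pays for 1-s. Both |1 - se^{iθ}| and
|e^{iθ} - s| can serve as N. -/
theorem one_sub_add_angle_le {s θ : ℝ} (hθ : θ ∈ Set.Ico 0 (2 * Real.pi)) {N : ℝ}
    (h1 : 1 - s ≤ N) (h2 : ‖Complex.exp (θ * Complex.I) - 1‖ ≤ N + (1 - s)) :
    (1 - s) + angle θ ≤ 5 * N := by
  have := angle_le_norm_exp_sub_one hθ
  linarith

theorem one_sub_add_angle_le_norm_one_sub {s θ : ℝ} (hs0 : 0 ≤ s) (hs1 : s ≤ 1)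
    (hθ : θ ∈ Set.Ico 0 (2 * Real.pi)) :
    (1 - s) + angle θ ≤ 5 * ‖1 - s * Complex.exp (θ * Complex.I)‖ := by
  have hn : ‖(s : ℂ) * Complex.exp (θ * Complex.I)‖ = s := by
    rw [norm_mul, Complex.norm_exp_ofReal_mul_I, mul_one, Complex.norm_real, Real.norm_eq_abs,
      abs_of_nonneg hs0]
  refine one_sub_add_angle_le hθ ?_ ?_
  · have := norm_sub_norm_le (1 : ℂ) (s * Complex.exp (θ * Complex.I))
    rwa [norm_one, hn] at this
  · have e : Complex.exp (θ * Complex.I) - 1 = -(1 - s * Complex.exp (θ * Complex.I)) +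
        ((1 - s : ℝ) : ℂ) * Complex.exp (θ * Complex.I) := by push_cast; ring
    rw [e]
    refine (norm_add_le _ _).trans ?_
    rw [norm_neg, norm_mul, Complex.norm_exp_ofReal_mul_I, mul_one, Complex.norm_real,
      Real.norm_eq_abs, abs_of_nonneg (by linarith : 0 ≤ 1 - s)]

theorem one_sub_add_angle_le_norm_sub {s θ : ℝ} (hs0 : 0 ≤ s) (hs1 : s ≤ 1)
    (hθ : θ ∈ Set.Ico 0 (2 * Real.pi)) :
    (1 - s) + angle θ ≤ 5 * ‖Complex.exp (θ * Complex.I) - s‖ := by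
  have hn : ‖(s : ℂ)‖ = s := by
    rw [Complex.norm_real, Real.norm_eq_abs, abs_of_nonneg hs0]
  refine one_sub_add_angle_le hθ ?_ ?_
  · have := norm_sub_norm_le (Complex.exp (θ * Complex.I)) s
    rwa [Complex.norm_exp_ofReal_mul_I, hn] at this
  · have e : Complex.exp (θ * Complex.I) - 1 = (Complex.exp (θ * Complex.I) - s) -
        ((1 - s : ℝ) : ℂ) := by push_cast; ring
    rw [e]
    refine (norm_sub_le _ _).trans ?_
    rw [Complex.norm_real, Real.norm_eq_abs, abs_of_nonneg (by linarith : 0 ≤ 1 - s)]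

theorem ofReal_kernel_le_dyadicKernel {m j : ℕ} {θ : ℝ} (h : θ ∈ shell m) :
    ENNReal.ofReal (1 / ((1 / 2) ^ j + angle θ)) ≤ dyadicKernel m j := by
  unfold dyadicKernel
  apply ENNReal.ofReal_le_ofReal
  apply one_div_le_one_div_of_le (by positivity)
  linarith [half_pow_le_angle h]

/-- Integration over the circle of superpositions of the kernels `1 / (2^{-j} + |θ|)`. -/
theorem lintegral_circle_tsum_kernel_le {p q : ℝ} (hpq : p.HolderConjugate q) (x : ℕ → ℝ≥0∞) :
    ∫⁻ θ in Set.Ico 0 (2 * Real.pi), (∑' j : ℕ,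
        ENNReal.ofReal (1 / ((1 / 2) ^ j + angle θ)) * (invTwoPow (1 / q) ^ j * x j)) ^ p ≤
      ENNReal.ofReal (2 * Real.pi) * hilbertConst p q * ∑' j, x j ^ p := by
  have hp := hpq.pos
  rw [lintegral_circle_eq_tsum, mul_assoc]
  refine le_trans ?_ (mul_le_mul_right (tsum_dyadicKernel_le hpq x) _)
  rw [← ENNReal.tsum_mul_left]
  refine ENNReal.tsum_le_tsum fun m => ?_
  -- On the m-th shell the integrand is dominated by a constant, and the measure 2π 2^{-m} supplies
  -- the weight of the discrete inequality.
  calc _ ≤ ∫⁻ θ in shell m,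
        (∑' j : ℕ, dyadicKernel m j * (invTwoPow (1 / q) ^ j * x j)) ^ p := by
        refine setLIntegral_mono' (measurableSet_shell m) fun θ hθ => ?_
        gcongr with j
        exact ofReal_kernel_le_dyadicKernel hθ
    _ = (∑' j : ℕ, dyadicKernel m j * (invTwoPow (1 / q) ^ j * x j)) ^ p * volume (shell m) := by
        rw [setLIntegral_const]
    _ ≤ _ := by
        rw [mul_comm, ← mul_assoc]
        gcongr
        exact volume_shell_le m

end

section


/-! ### Integral means of analytic functions -/

theorem circleMap_mem_disc {ρ : ℝ} (h0 : 0 ≤ ρ) (h1 : ρ < 1) (θ : ℝ) : circleMap 0 ρ θ ∈ disc := by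
  simp [disc, abs_of_nonneg h0, h1]

theorem ofReal_mem_disc {t : ℝ} (ht : t ∈ Set.Ico (0 : ℝ) 1) : (t : ℂ) ∈ disc := by
  simp [disc, abs_of_nonneg ht.1, ht.2]

theorem continuous_comp_circleMap {f : ℂ → ℂ} (hf : ContinuousOn f disc) {ρ : ℝ}
    (h0 : 0 ≤ ρ) (h1 : ρ < 1) : Continuous fun θ => f (circleMap 0 ρ θ) :=
  hf.comp_continuous (continuous_circleMap 0 ρ) (circleMap_mem_disc h0 h1)

theorem measurable_enorm_comp_circleMap {f : ℂ → ℂ} (hf : ContinuousOn f disc) {ρ : ℝ}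
    (h0 : 0 ≤ ρ) (h1 : ρ < 1) : Measurable fun θ => ‖f (circleMap 0 ρ θ)‖ₑ :=
  (continuous_comp_circleMap hf h0 h1).enorm.measurable

/-- Pointwise bound from the Cauchy integral formula. -/
theorem enorm_le_lintegral_circle {f : ℂ → ℂ} (hf : DifferentiableOn ℂ f disc) {ρ s : ℝ}
    (hρ0 : 0 < ρ) (hρ1 : ρ < 1) (hs0 : 0 ≤ s) (hs1 : s < 1) :
    ‖f ((ρ * s : ℝ) : ℂ)‖ₑ ≤ ∫⁻ θ in Set.Ico 0 (2 * Real.pi),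
      ‖f (circleMap 0 ρ θ)‖ₑ * ENNReal.ofReal (1 / ((1 - s) + angle θ)) := by
  have hπ := Real.pi_gt_three
  have hsub : Metric.closedBall (0 : ℂ) ρ ⊆ disc := Metric.closedBall_subset_ball hρ1
  have hw : ((ρ * s : ℝ) : ℂ) ∈ Metric.ball (0 : ℂ) ρ := by
    rw [mem_ball_zero_iff, Complex.norm_real, Real.norm_eq_abs, abs_of_nonneg (by positivity)]
    nlinarith
  have hd : DiffContOnCl ℂ f (Metric.ball 0 ρ) :=
    DifferentiableOn.diffContOnCl (hf.mono (by rwa [closure_ball _ hρ0.ne']))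
  have hC := hd.circleIntegral_sub_inv_smul hw
  have h1 : ‖(2 * Real.pi * Complex.I : ℂ) • f ((ρ * s : ℝ) : ℂ)‖ₑ ≤
      ∫⁻ θ in Set.Ico 0 (2 * Real.pi), 5 *
        (‖f (circleMap 0 ρ θ)‖ₑ * ENNReal.ofReal (1 / ((1 - s) + angle θ))) := by
    rw [← hC, circleIntegral, intervalIntegral.integral_of_le (by positivity)]
    refine (enorm_integral_le_lintegral_enorm _).trans ?_
    rw [setLIntegral_congr (Ico_ae_eq_Ioc (μ := volume)).symm]
    refine setLIntegral_mono' measurableSet_Ico fun θ hθ => ?_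
    have hangle := one_sub_add_angle_le_norm_sub hs0 hs1.le hθ
    have hapos := angle_nonneg hθ
    have hpos : 0 < ‖Complex.exp (θ * Complex.I) - s‖ := by linarith
    rw [deriv_circleMap, ← ofReal_norm, ← ofReal_norm, ← ENNReal.ofReal_mul (norm_nonneg _)]
    have e5 : (5 : ℝ≥0∞) = ENNReal.ofReal 5 := by norm_num
    rw [e5, ← ENNReal.ofReal_mul (by norm_num)]
    apply ENNReal.ofReal_le_ofReal
    have hz : circleMap 0 ρ θ - ((ρ * s : ℝ) : ℂ) = ρ * (Complex.exp (θ * Complex.I) - s) := by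
      simp [circleMap]; ring
    rw [norm_smul, norm_smul, norm_mul, Complex.norm_I, mul_one, norm_inv, hz, norm_mul,
      Complex.norm_real, norm_circleMap_zero, Real.norm_eq_abs, abs_of_pos hρ0]
    have : ρ * ((ρ * ‖Complex.exp (θ * Complex.I) - s‖)⁻¹ * ‖f (circleMap 0 ρ θ)‖) =
        ‖f (circleMap 0 ρ θ)‖ * (1 / ‖Complex.exp (θ * Complex.I) - s‖) := by
      field_simp
    rw [this, mul_left_comm]
    gcongr
    rw [mul_one_div, div_le_div_iff₀ hpos (by linarith)]
    linarith
  rw [lintegral_const_mul' _ _ (by norm_num), enorm_smul] at h1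
  have e2 : ‖(2 * Real.pi * Complex.I : ℂ)‖ₑ = ENNReal.ofReal (2 * Real.pi) := by
    rw [← ofReal_norm]
    simp [abs_of_pos Real.pi_pos]
  rw [e2] at h1
  -- The constant 5 of the kernel bound is absorbed by the 2π of Cauchy's formula, so that the
  -- estimate holds with constant 1.
  have h5 : (5 : ℝ≥0∞) * ‖f ((ρ * s : ℝ) : ℂ)‖ₑ ≤
      ENNReal.ofReal (2 * Real.pi) * ‖f ((ρ * s : ℝ) : ℂ)‖ₑ := by
    gcongr
    have e5 : (5 : ℝ≥0∞) = ENNReal.ofReal 5 := by norm_num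
    rw [e5]
    exact ENNReal.ofReal_le_ofReal (by linarith)
  exact (ENNReal.mul_le_mul_iff_right (by norm_num) (by norm_num)).1 (h5.trans h1)

theorem ofReal_kernel_le_of_mem_Ico {k : ℕ} {s a : ℝ} (ha : 0 ≤ a) (hs : s < node (k + 1)) :
    ENNReal.ofReal (1 / ((1 - s) + a)) ≤ 2 * ENNReal.ofReal (1 / ((1 / 2) ^ k + a)) := by
  have e2 : (2 : ℝ≥0∞) = ENNReal.ofReal 2 := by norm_num
  rw [e2, ← ENNReal.ofReal_mul (by norm_num)]
  apply ENNReal.ofReal_le_ofReal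
  have h0 : (0 : ℝ) < (1 / 2) ^ k := by positivity
  have h1 : (1 / 2 : ℝ) ^ (k + 1) ≤ 1 - s := by unfold node at hs; linarith
  rw [pow_succ] at h1
  rw [mul_one_div, div_le_div_iff₀ (by linarith) (by linarith)]
  linarith

theorem lintegral_circle_eq_integralMean_rpow {p : ℝ} (hp : 0 < p) (r : ℝ) (f : ℂ → ℂ) :
    ∫⁻ θ in Set.Ico 0 (2 * Real.pi), ‖f (circleMap 0 r θ)‖ₑ ^ p =
      ENNReal.ofReal (2 * Real.pi) * integralMean p r f ^ p := by
  unfold integralMean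
  rw [← ENNReal.rpow_mul, one_div_mul_cancel hp.ne', ENNReal.rpow_one, ← mul_assoc,
    ← ENNReal.ofReal_mul (by positivity), mul_inv_cancel₀ (by positivity), ENNReal.ofReal_one,
    one_mul]

/-- Growth of an analytic function in terms of its integral means. -/
theorem exists_growth_const {p q : ℝ} (hpq : p.HolderConjugate q) :
    ∃ C : ℝ≥0∞, C ≠ ∞ ∧ ∀ f : ℂ → ℂ, DifferentiableOn ℂ f disc → ∀ (k : ℕ) (ρ : ℝ), 0 < ρ →
      ρ < node (k + 1) →
      invTwoPow (1 / p) ^ k * ‖f ((ρ * ρ : ℝ) : ℂ)‖ₑ ≤ C * integralMean p ρ f := by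
  have hp := hpq.pos
  have hq := hpq.symm.pos
  refine ⟨2 * ((ENNReal.ofReal (2 * Real.pi)) ^ (1 / p) *
    (ENNReal.ofReal (2 * Real.pi) * hilbertConst q p) ^ (1 / q)), ?_, ?_⟩
  · refine ENNReal.mul_ne_top (by norm_num) (ENNReal.mul_ne_top ?_ ?_)
    · exact ENNReal.rpow_ne_top_of_nonneg (by positivity) ENNReal.ofReal_ne_top
    · exact ENNReal.rpow_ne_top_of_nonneg (by positivity)
        (ENNReal.mul_ne_top ENNReal.ofReal_ne_top (hilbertConst_ne_top hpq.symm))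
  intro f hf k ρ hρ0 hρk
  have hρ1 : ρ < 1 := hρk.trans (node_lt_one _)
  set g : ℝ≥0∞ := invTwoPow (1 / p) ^ k with hg
  have hg0 : g ≠ 0 := pow_ne_zero _ (invTwoPow_ne_zero _)
  have hgt : g ≠ ∞ := ENNReal.pow_ne_top (invTwoPow_ne_top _)
  have hmeas := measurable_enorm_comp_circleMap hf.continuousOn hρ0.le hρ1
  have hκ : ∫⁻ θ in Set.Ico 0 (2 * Real.pi), ENNReal.ofReal (1 / ((1 / 2) ^ k + angle θ)) ^ q ≤
      ENNReal.ofReal (2 * Real.pi) * hilbertConst q p * (g⁻¹) ^ q := by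
    -- Keeping only the term j = k, with x_k = 2^{k/p}, yields the L^q norm of a single kernel, of
    -- order 2^{k/p}.
    have h := lintegral_circle_tsum_kernel_le hpq.symm (fun j => if j = k then g⁻¹ else 0)
    have e1 : ∀ θ, ∑' j : ℕ, ENNReal.ofReal (1 / ((1 / 2) ^ j + angle θ)) *
        (invTwoPow (1 / p) ^ j * if j = k then g⁻¹ else 0) =
        ENNReal.ofReal (1 / ((1 / 2) ^ k + angle θ)) := fun θ => by
      rw [tsum_eq_single k (fun j hj => by simp [hj]), if_pos rfl, ← hg,
        ENNReal.mul_inv_cancel hg0 hgt, mul_one]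
    have e2 : ∑' j : ℕ, (if j = k then g⁻¹ else 0) ^ q = (g⁻¹) ^ q := by
      rw [tsum_eq_single k (fun j hj => by simp [hj, hq]), if_pos rfl]
    simp_rw [e1, e2] at h
    exact h
  have hmeasκ : Measurable fun θ => ENNReal.ofReal (1 / ((1 / 2) ^ k + angle θ)) := by
    have := continuous_angle.measurable
    fun_prop
  calc g * ‖f ((ρ * ρ : ℝ) : ℂ)‖ₑ
      ≤ g * ∫⁻ θ in Set.Ico 0 (2 * Real.pi), ‖f (circleMap 0 ρ θ)‖ₑ *
          ENNReal.ofReal (1 / ((1 - ρ) + angle θ)) := by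
        gcongr
        exact enorm_le_lintegral_circle hf hρ0 hρ1 hρ0.le hρ1
    _ ≤ g * ∫⁻ θ in Set.Ico 0 (2 * Real.pi), 2 * (‖f (circleMap 0 ρ θ)‖ₑ *
          ENNReal.ofReal (1 / ((1 / 2) ^ k + angle θ))) := by
        gcongr g * ?_
        refine setLIntegral_mono' measurableSet_Ico fun θ hθ => ?_
        rw [mul_left_comm]
        gcongr
        exact ofReal_kernel_le_of_mem_Ico (angle_nonneg hθ) hρk
    _ = g * (2 * ∫⁻ θ in Set.Ico 0 (2 * Real.pi), ((fun θ => ‖f (circleMap 0 ρ θ)‖ₑ) *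
          fun θ => ENNReal.ofReal (1 / ((1 / 2) ^ k + angle θ))) θ) := by
        rw [lintegral_const_mul' _ _ (by norm_num)]
        rfl
    _ ≤ g * (2 * ((∫⁻ θ in Set.Ico 0 (2 * Real.pi), ‖f (circleMap 0 ρ θ)‖ₑ ^ p) ^ (1 / p) *
          (ENNReal.ofReal (2 * Real.pi) * hilbertConst q p * (g⁻¹) ^ q) ^ (1 / q))) := by
        gcongr g * (2 * ?_)
        refine (ENNReal.lintegral_mul_le_Lp_mul_Lq _ hpq hmeas.aemeasurable
          hmeasκ.aemeasurable).trans ?_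
        gcongr
    _ = (g * g⁻¹) * (2 * (ENNReal.ofReal (2 * Real.pi) ^ (1 / p) *
          (ENNReal.ofReal (2 * Real.pi) * hilbertConst q p) ^ (1 / q)) * integralMean p ρ f) := by
        rw [lintegral_circle_eq_integralMean_rpow hp, ENNReal.mul_rpow_of_nonneg _ (g⁻¹ ^ q)
          (by positivity), ENNReal.mul_rpow_of_nonneg _ (integralMean p ρ f ^ p) (by positivity),
          ← ENNReal.rpow_mul, ← ENNReal.rpow_mul, mul_one_div_cancel hp.ne',
          mul_one_div_cancel hq.ne', ENNReal.rpow_one, ENNReal.rpow_one]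
        ring
    _ = _ := by rw [ENNReal.mul_inv_cancel hg0 hgt, one_mul]

/-- This is Hilbert's inequality: Cauchy's formula bounds |f(ρs)| by the kernel 1/((1-s)+|θ|) acting
on |f(ρe^{iθ})|. With s in the k-th dyadic interval and θ in the m-th shell, Hölder on the shell
reduces it to `tsum_dyadicKernel_le`. The constant does not depend on ρ, which allows ρ → 1 later.
-/
theorem exists_lintegral_dilation_const {p q : ℝ} (hpq : p.HolderConjugate q) :
    ∃ C : ℝ≥0∞, C ≠ ∞ ∧ ∀ f : ℂ → ℂ, DifferentiableOn ℂ f disc → ∀ ρ : ℝ, 0 < ρ → ρ < 1 →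
      ∫⁻ s in Set.Ico 0 1, ‖f ((ρ * s : ℝ) : ℂ)‖ₑ ^ p ≤
        C * ∫⁻ θ in Set.Ico 0 (2 * Real.pi), ‖f (circleMap 0 ρ θ)‖ₑ ^ p := by
  have hp := hpq.pos
  have hq := hpq.symm.pos
  set c : ℝ≥0∞ := 2 * ENNReal.ofReal (2 * Real.pi) ^ (1 / q) with hc
  refine ⟨c ^ p * hilbertConst p q, ?_, ?_⟩
  · refine ENNReal.mul_ne_top (ENNReal.rpow_ne_top_of_nonneg hp.le (ENNReal.mul_ne_top
      (by norm_num) ?_)) (hilbertConst_ne_top hpq)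
    exact ENNReal.rpow_ne_top_of_nonneg (by positivity) ENNReal.ofReal_ne_top
  intro f hf ρ hρ0 hρ1
  have hmeas := measurable_enorm_comp_circleMap hf.continuousOn hρ0.le hρ1
  set Φ : ℕ → ℝ≥0∞ := fun m => (∫⁻ θ in shell m, ‖f (circleMap 0 ρ θ)‖ₑ ^ p) ^ (1 / p) with hΦ
  have hshell : ∀ m, ∫⁻ θ in shell m, ‖f (circleMap 0 ρ θ)‖ₑ ≤
      ENNReal.ofReal (2 * Real.pi) ^ (1 / q) * (invTwoPow (1 / q) ^ m * Φ m) := fun m => by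
    have h := ENNReal.lintegral_mul_le_Lp_mul_Lq (volume.restrict (shell m)) hpq
      hmeas.aemeasurable (g := fun _ => 1) aemeasurable_const
    simp only [Pi.mul_apply, mul_one, ENNReal.one_rpow, setLIntegral_const, one_mul] at h
    refine h.trans ?_
    calc _ ≤ Φ m * (ENNReal.ofReal (2 * Real.pi) * 2⁻¹ ^ m) ^ (1 / q) := by
          gcongr
          exact volume_shell_le m
      _ = _ := by
          rw [ENNReal.mul_rpow_of_nonneg _ _ (by positivity), ← invTwoPow_pow_rpow hq m,
            ← ENNReal.rpow_mul, mul_one_div_cancel hq.ne', ENNReal.rpow_one]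
          ring
  have hpt : ∀ k, ∀ s ∈ Set.Ico (node k) (node (k + 1)), ‖f ((ρ * s : ℝ) : ℂ)‖ₑ ≤
      c * ∑' m, dyadicKernel k m * (invTwoPow (1 / q) ^ m * Φ m) := fun k s hs => by
    have hs0 := (node_nonneg k).trans hs.1
    refine (enorm_le_lintegral_circle hf hρ0 hρ1 hs0 (hs.2.trans (node_lt_one _))).trans ?_
    rw [lintegral_circle_eq_tsum, ← ENNReal.tsum_mul_left]
    refine ENNReal.tsum_le_tsum fun m => ?_
    calc _ ≤ ∫⁻ θ in shell m, 2 * dyadicKernel k m * ‖f (circleMap 0 ρ θ)‖ₑ := by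
          refine setLIntegral_mono' (measurableSet_shell m) fun θ hθ => ?_
          rw [mul_comm]
          gcongr
          refine (ofReal_kernel_le_of_mem_Ico (angle_nonneg (shell_subset m hθ)) hs.2).trans ?_
          gcongr
          rw [dyadicKernel_comm]
          exact ofReal_kernel_le_dyadicKernel hθ
      _ = 2 * dyadicKernel k m * ∫⁻ θ in shell m, ‖f (circleMap 0 ρ θ)‖ₑ := by
          rw [lintegral_const_mul _ hmeas]
      _ ≤ 2 * dyadicKernel k m * (ENNReal.ofReal (2 * Real.pi) ^ (1 / q) *
            (invTwoPow (1 / q) ^ m * Φ m)) := by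
          gcongr
          exact hshell m
      _ = _ := by rw [hc]; ring
  calc ∫⁻ s in Set.Ico 0 1, ‖f ((ρ * s : ℝ) : ℂ)‖ₑ ^ p
      ≤ ∑' k, ∫⁻ s in Set.Ico (node k) (node (k + 1)),
          (c * ∑' m, dyadicKernel k m * (invTwoPow (1 / q) ^ m * Φ m)) ^ p := by
        rw [lintegral_Ico_eq_tsum]
        refine ENNReal.tsum_le_tsum fun k => setLIntegral_mono' measurableSet_Ico fun s hs => ?_
        gcongr
        exact hpt k s hs
    _ ≤ ∑' k, c ^ p * (2⁻¹ ^ k *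
          (∑' m, dyadicKernel k m * (invTwoPow (1 / q) ^ m * Φ m)) ^ p) := by
        refine ENNReal.tsum_le_tsum fun k => ?_
        rw [setLIntegral_const, volume_Ico_node, ENNReal.mul_rpow_of_nonneg _ _ hp.le, mul_assoc,
          mul_comm (_ ^ p) (2⁻¹ ^ (k + 1))]
        exact mul_le_mul_right (mul_le_mul_left
          (pow_le_pow_right_of_le_one' (by norm_num) (Nat.le_succ k)) _) _
    _ ≤ c ^ p * (hilbertConst p q * ∑' m, Φ m ^ p) := by
        rw [ENNReal.tsum_mul_left]
        gcongr
        exact tsum_dyadicKernel_le hpq Φ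
    _ = _ := by
        rw [lintegral_circle_eq_tsum, mul_assoc]
        simp only [hΦ]
        simp_rw [← ENNReal.rpow_mul, one_div_mul_cancel hp.ne', ENNReal.rpow_one]

/-- A Fejér–Riesz inequality: restriction to the radius maps `H^p` into `L^p[0,1)`. -/
theorem exists_fejerRiesz_const {p q : ℝ} (hpq : p.HolderConjugate q) :
    ∃ C : ℝ≥0∞, C ≠ ∞ ∧ ∀ f : ℂ → ℂ, DifferentiableOn ℂ f disc →
      ∫⁻ s in Set.Ico (0 : ℝ) 1, ‖f s‖ₑ ^ p ≤ C * hardyNorm p f ^ p := by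
  have hp := hpq.pos
  obtain ⟨C, hC, h⟩ := exists_lintegral_dilation_const hpq
  refine ⟨C * ENNReal.ofReal (2 * Real.pi), ENNReal.mul_ne_top hC ENNReal.ofReal_ne_top, ?_⟩
  intro f hf
  have hρ : ∀ n : ℕ, ∫⁻ s in Set.Ico (0 : ℝ) 1, ‖f ((node (n + 1) * s : ℝ) : ℂ)‖ₑ ^ p ≤
      C * ENNReal.ofReal (2 * Real.pi) * hardyNorm p f ^ p := fun n => by
    have h0 : 0 < node (n + 1) := by
      have := node_mono (Nat.le_add_left 1 n)
      have h1 : node 1 = 1 / 2 := by unfold node; norm_num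
      linarith
    refine (h f hf _ h0 (node_lt_one _)).trans ?_
    rw [lintegral_circle_eq_integralMean_rpow hp, mul_assoc]
    gcongr
    exact le_iSup₂ (f := fun r (_ : r ∈ Set.Ioo (0 : ℝ) 1) => integralMean p r f) (node (n + 1))
      ⟨h0, node_lt_one _⟩
  have hmaps : ∀ n : ℕ, ∀ s ∈ Set.Ico (0 : ℝ) 1, ((node (n + 1) * s : ℝ) : ℂ) ∈ disc :=
    fun n s hs => ofReal_mem_disc ⟨mul_nonneg (node_nonneg _) hs.1,
      lt_of_le_of_lt (mul_le_of_le_one_left hs.1 (node_lt_one _).le) hs.2⟩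
  have hlim : Filter.Tendsto (fun n : ℕ => node (n + 1)) Filter.atTop (nhds 1) := by
    have h1 := (tendsto_pow_atTop_nhds_zero_of_lt_one (r := (1 / 2 : ℝ)) (by norm_num)
      (by norm_num)).comp (Filter.tendsto_add_atTop_nat 1)
    have h2 := h1.const_sub 1
    rw [sub_zero] at h2
    exact h2
  -- Fatou's lemma along the dilations ρ = r_{n+1} → 1; the index starts at 1 because r_0 = 0 is not
  -- an admissible ρ.
  calc ∫⁻ s in Set.Ico (0 : ℝ) 1, ‖f s‖ₑ ^ p
      = ∫⁻ s in Set.Ico (0 : ℝ) 1, Filter.liminf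
          (fun n : ℕ => ‖f ((node (n + 1) * s : ℝ) : ℂ)‖ₑ ^ p) Filter.atTop := by
        refine setLIntegral_congr_fun measurableSet_Ico fun s hs => ?_
        refine (Filter.Tendsto.liminf_eq ?_).symm
        have hc : ContinuousAt f (s : ℂ) :=
          (hf.differentiableAt (Metric.isOpen_ball.mem_nhds (ofReal_mem_disc hs))).continuousAt
        have h3 : Filter.Tendsto (fun n : ℕ => ((node (n + 1) * s : ℝ) : ℂ)) Filter.atTop
            (nhds (s : ℂ)) := by
          have := hlim.mul_const s
          rw [one_mul] at this
          exact (Complex.continuous_ofReal.tendsto s).comp this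
        exact ((ENNReal.continuous_rpow_const (y := p)).tendsto _).comp
          ((continuous_enorm.tendsto _).comp (hc.tendsto.comp h3))
    _ ≤ Filter.liminf (fun n : ℕ => ∫⁻ s in Set.Ico (0 : ℝ) 1,
          ‖f ((node (n + 1) * s : ℝ) : ℂ)‖ₑ ^ p) Filter.atTop := by
        refine lintegral_liminf_le' fun n => ?_
        have hcont : ContinuousOn (fun s : ℝ => f ((node (n + 1) * s : ℝ) : ℂ)) (Set.Ico 0 1) :=
          hf.continuousOn.comp (by fun_prop) (hmaps n)
        exact ((hcont.aemeasurable measurableSet_Ico).enorm).pow_const p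
    _ ≤ _ := by
        refine Filter.liminf_le_of_le (by isBoundedDefault) fun b hb => ?_
        obtain ⟨n, hn⟩ := hb.exists
        exact hn.trans (hρ n)

end

section


/-! ### Tails and moments of radial weights -/

/-- The moments `∫_0^1 t^n ω(t) dt`. -/
def moment (ω : ℝ → ℝ) (n : ℕ) : ℝ := ∫ t in Set.Ico 0 1, t ^ n * ω t

/-- The integral of `|f| ω` over `[1-2^{-k},1)`, divided by that of `ω`. -/
def tailAverage (ω : ℝ → ℝ) (f : ℝ → ℂ) (k : ℕ) : ℝ≥0∞ :=
  (∫⁻ t in Set.Ico (node k) 1, ‖f t‖ₑ * ENNReal.ofReal (ω t)) / ENNReal.ofReal (tail ω (node k))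

variable {ω : ℝ → ℝ}

theorem node_mem (k : ℕ) : node k ∈ Set.Ico (0 : ℝ) 1 := ⟨node_nonneg k, node_lt_one k⟩

theorem IsRadialWeight.integrableOn (hω : IsRadialWeight ω) : IntegrableOn ω (Set.Ico 0 1) :=
  hω.integrable

theorem IsRadialWeight.integrableOn_Ico (hω : IsRadialWeight ω) {r : ℝ} (hr : 0 ≤ r) :
    IntegrableOn ω (Set.Ico r 1) :=
  hω.integrableOn.mono_set (Set.Ico_subset_Ico_left hr)

theorem IsRadialWeight.ofReal_tail (hω : IsRadialWeight ω) {r : ℝ} (hr : 0 ≤ r) :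
    ENNReal.ofReal (tail ω r) = ∫⁻ t in Set.Ico r 1, ENNReal.ofReal (ω t) := by
  unfold tail
  refine ofReal_integral_eq_lintegral_ofReal (hω.integrableOn_Ico hr) ?_
  filter_upwards [ae_restrict_mem measurableSet_Ico] with t ht
  exact hω.nonneg t ⟨hr.trans ht.1, ht.2⟩

theorem IsRadialWeight.tail_anti (hω : IsRadialWeight ω) {r s : ℝ} (hr : 0 ≤ r) (hrs : r ≤ s) :
    tail ω s ≤ tail ω r := by
  unfold tail
  refine setIntegral_mono_set (hω.integrableOn_Ico hr) ?_
    (Set.Ico_subset_Ico_left hrs).eventuallyLE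
  filter_upwards [ae_restrict_mem measurableSet_Ico] with t ht
  exact hω.nonneg t ⟨hr.trans ht.1, ht.2⟩

theorem IsRadialWeight.tail_node_pos (hω : IsRadialWeight ω) (k : ℕ) : 0 < tail ω (node k) :=
  hω.tail_pos _ (node_mem k)

theorem IsRadialWeight.integrable_pow_mul (hω : IsRadialWeight ω) (n : ℕ) :
    IntegrableOn (fun t => t ^ n * ω t) (Set.Ico 0 1) := by
  refine Integrable.mono hω.integrableOn
    ((by fun_prop : AEStronglyMeasurable (fun t : ℝ => t ^ n) _).mul hω.integrableOn.1) ?_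
  filter_upwards [ae_restrict_mem measurableSet_Ico] with t ht
  rw [norm_mul, norm_pow, Real.norm_eq_abs, abs_of_nonneg ht.1]
  exact mul_le_of_le_one_left (norm_nonneg _) (pow_le_one₀ ht.1 ht.2.le)

theorem IsRadialWeight.moment_anti (hω : IsRadialWeight ω) : Antitone (moment ω) := by
  intro m n h
  unfold moment
  refine setIntegral_mono_on (hω.integrable_pow_mul n) (hω.integrable_pow_mul m)
    measurableSet_Ico fun t ht => ?_
  exact mul_le_mul_of_nonneg_right (pow_le_pow_of_le_one ht.1 ht.2.le h) (hω.nonneg t ht)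

theorem IsRadialWeight.pow_mul_tail_le_moment (hω : IsRadialWeight ω) (n : ℕ) {r : ℝ}
    (hr : 0 ≤ r) : r ^ n * tail ω r ≤ moment ω n := by
  unfold tail moment
  rw [← integral_const_mul]
  calc _ ≤ ∫ t in Set.Ico r 1, t ^ n * ω t := by
        refine setIntegral_mono_on ((hω.integrableOn_Ico hr).const_mul _)
          ((hω.integrable_pow_mul n).mono_set (Set.Ico_subset_Ico_left hr)) measurableSet_Ico
          fun t ht => ?_
        have := hω.nonneg t ⟨hr.trans ht.1, ht.2⟩
        gcongr
        exact ht.1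
    _ ≤ _ := by
        refine setIntegral_mono_set (hω.integrable_pow_mul n) ?_
          (Set.Ico_subset_Ico_left hr).eventuallyLE
        filter_upwards [ae_restrict_mem measurableSet_Ico] with t ht
        exact mul_nonneg (pow_nonneg ht.1 _) (hω.nonneg t ht)

/-- Bernoulli's inequality gives (1 - 2^{-(k+1)})^{2^k} ≥ 1/2, and M such blocks of exponents cover
n. -/
theorem half_pow_le_node_pow (k M n : ℕ) (h : n ≤ M * 2 ^ k) :
    (1 / 2 : ℝ) ^ M ≤ node (k + 1) ^ n := by
  have h1 : (1 / 2 : ℝ) ≤ node (k + 1) ^ (2 ^ k) := by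
    have h0 := one_add_mul_le_pow (a := -(1 / 2 : ℝ) ^ (k + 1)) (by
      have : (1 / 2 : ℝ) ^ (k + 1) ≤ 1 := pow_le_one₀ (by norm_num) (by norm_num)
      linarith) (2 ^ k)
    have e : (1 : ℝ) + ((2 ^ k : ℕ) : ℝ) * -(1 / 2) ^ (k + 1) = 1 / 2 := by
      push_cast
      rw [pow_succ, one_div_pow]
      field_simp
      norm_num
    rw [e] at h0
    simpa [node, sub_eq_add_neg] using h0
  calc (1 / 2 : ℝ) ^ M ≤ (node (k + 1) ^ (2 ^ k)) ^ M := by gcongr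
    _ = node (k + 1) ^ (M * 2 ^ k) := by rw [← pow_mul, mul_comm]
    _ ≤ node (k + 1) ^ n := pow_le_pow_of_le_one (node_nonneg _) (node_lt_one _).le h

theorem IsRadialWeight.moment_pos (hω : IsRadialWeight ω) (n : ℕ) : 0 < moment ω n := by
  have h1 : 0 < node 1 := by unfold node; norm_num
  exact lt_of_lt_of_le (mul_pos (pow_pos h1 n) (hω.tail_node_pos 1))
    (hω.pow_mul_tail_le_moment n h1.le)

theorem tail_le_pow_mul {C : ℝ} (hC : 1 ≤ C)
    (h : ∀ k, tail ω (node k) ≤ C * tail ω (node (k + 1))) (j l : ℕ) :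
    tail ω (node j) ≤ C ^ l * tail ω (node (j + l)) := by
  induction l with
  | zero => simp
  | succ l ih =>
    refine ih.trans ?_
    rw [pow_succ, mul_assoc]
    exact mul_le_mul_of_nonneg_left (h (j + l)) (by positivity)

/-- The midpoint of r_k and 1 is r_{k+1}, so doubling at the nodes compares consecutive tails. This
is the only form in which the doubling condition is used. -/
theorem IsUpperDoubling.exists_tail_node_le (hω : IsUpperDoubling ω) :
    ∃ C : ℝ, 1 ≤ C ∧ ∀ k, tail ω (node k) ≤ C * tail ω (node (k + 1)) := by
  obtain ⟨C, hC, h⟩ := hω.doubling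
  refine ⟨C, hC, fun k => ?_⟩
  have := h (node k) (node_mem k)
  have e : (1 + node k) / 2 = node (k + 1) := by unfold node; ring
  rwa [e] at this

/-- With 2C < 2^n, the Taylor term of order n of exp(2^l/2) already exceeds (2C)^l up to a constant.
-/
theorem exists_exp_decay (C : ℝ) (hC : 1 ≤ C) :
    ∃ K : ℝ, 1 ≤ K ∧ ∀ l : ℕ, C ^ l * Real.exp (-(2 ^ l / 2)) ≤ K * (1 / 2) ^ l := by
  obtain ⟨n, hn⟩ := pow_unbounded_of_one_lt (2 * C) (by norm_num : (1 : ℝ) < 2)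
  refine ⟨n.factorial * 2 ^ n, ?_, fun l => ?_⟩
  · have h1 : (1 : ℝ) ≤ n.factorial := by exact_mod_cast n.factorial_pos
    have h2 : (1 : ℝ) ≤ 2 ^ n := one_le_pow₀ (by norm_num)
    nlinarith
  · have h := Real.pow_div_factorial_le_exp (2 ^ l / 2 : ℝ) (by positivity) n
    have hf : (0 : ℝ) < n.factorial := by exact_mod_cast n.factorial_pos
    rw [Real.exp_neg]
    have h3 : (Real.exp (2 ^ l / 2))⁻¹ ≤ ((2 ^ l / 2 : ℝ) ^ n / n.factorial)⁻¹ :=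
      inv_anti₀ (by positivity) h
    calc C ^ l * (Real.exp (2 ^ l / 2))⁻¹ ≤ C ^ l * ((2 ^ l / 2 : ℝ) ^ n / n.factorial)⁻¹ := by
          gcongr
      _ = n.factorial * 2 ^ n * (C ^ l * ((2 ^ n) ^ l)⁻¹) := by
          rw [div_pow, ← pow_mul, ← pow_mul, mul_comm l n]
          field_simp
      _ ≤ n.factorial * 2 ^ n * (C ^ l * ((2 * C) ^ l)⁻¹) := by gcongr
      _ = _ := by
          rw [mul_pow, one_div_pow]
          field_simp

/-- From 1-x ≤ e^{-x}. The exponent N may be as small as 2^k - 1, and the missing 1 costs the factor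
e. -/
theorem node_pow_le_exp {j k N : ℕ} (hjk : j ≤ k) (hN : 2 ^ k ≤ N + 1) :
    node (j + 1) ^ N ≤ Real.exp 1 * Real.exp (-(2 ^ (k - j) / 2)) := by
  have h1 : node (j + 1) ≤ Real.exp (-(1 / 2) ^ (j + 1)) := by
    have := Real.add_one_le_exp (-(1 / 2 : ℝ) ^ (j + 1))
    unfold node
    linarith
  have h2 : (2 : ℝ) ^ k ≤ N + 1 := by exact_mod_cast hN
  calc node (j + 1) ^ N ≤ Real.exp (-(1 / 2) ^ (j + 1)) ^ N := by
        gcongr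
        exact node_nonneg _
    _ = Real.exp (N * -(1 / 2) ^ (j + 1)) := by rw [← Real.exp_nat_mul]
    _ ≤ Real.exp (1 + -(2 ^ (k - j) / 2)) := by
        apply Real.exp_le_exp.2
        obtain ⟨l, rfl⟩ := Nat.exists_eq_add_of_le hjk
        rw [Nat.add_sub_cancel_left]
        have e : (2 : ℝ) ^ l / 2 = 2 ^ (j + l) * (1 / 2) ^ (j + 1) := by
          rw [pow_add, pow_succ, one_div_pow]
          field_simp
        rw [e]
        have h3 : (1 / 2 : ℝ) ^ (j + 1) ≤ 1 := pow_le_one₀ (by norm_num) (by norm_num)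
        have h4 : (0 : ℝ) < (1 / 2 : ℝ) ^ (j + 1) := by positivity
        nlinarith
    _ = _ := Real.exp_add _ _

/-- Powers `t^N` with `N ≈ 2^k` are concentrated near `1`, relative to a doubling weight. -/
theorem IsUpperDoubling.exists_pow_le_sum (hω : IsUpperDoubling ω) :
    ∃ K : ℝ, 1 ≤ K ∧ ∀ N k : ℕ, 2 ^ k ≤ N + 1 → ∀ t ∈ Set.Ico (0 : ℝ) 1,
      t ^ N ≤ ∑ j ∈ Finset.range (k + 1), (Set.Ico (node j) 1).indicator
        (fun _ => K * tail ω (node k) * ((1 / 2) ^ (k - j) / tail ω (node j))) t := by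
  obtain ⟨C, hC, hd⟩ := hω.exists_tail_node_le
  obtain ⟨K, hK, hexp⟩ := exists_exp_decay C hC
  have hpos := hω.toIsRadialWeight.tail_node_pos
  have he : 1 ≤ Real.exp 1 := Real.one_le_exp (by norm_num)
  refine ⟨Real.exp 1 * K, by nlinarith, fun N k hN t ht => ?_⟩
  obtain ⟨i, hik, hit, h⟩ := exists_node_le ht.1 k
  have hnn : ∀ j ∈ Finset.range (k + 1), 0 ≤ (Set.Ico (node j) 1).indicator
      (fun _ => Real.exp 1 * K * tail ω (node k) * ((1 / 2) ^ (k - j) / tail ω (node j))) t := by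
    intro j _
    have h1 := hpos j
    have h2 := hpos k
    refine Set.indicator_nonneg (fun _ _ => ?_) _
    positivity
  refine le_trans ?_ (Finset.single_le_sum hnn (Finset.mem_range.2 (Nat.lt_succ_of_le hik)))
  rw [Set.indicator_of_mem (Set.mem_Ico.2 ⟨hit, ht.2⟩)]
  have h1 := hpos i
  have h2 := hpos k
  rcases h with rfl | h
  -- For t ≥ r_k no decay is available or needed: the term j = k of the sum is the constant e K ≥ 1.
  · rw [Nat.sub_self, pow_zero, mul_assoc, mul_one_div_cancel h1.ne', mul_one]
    exact (pow_le_one₀ ht.1 ht.2.le).trans (by nlinarith)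
  · have h3 := tail_le_pow_mul hC hd i (k - i)
    rw [Nat.add_sub_cancel' hik] at h3
    -- For t in [r_i, r_{i+1}) the single term j = i suffices: the exponential decay of t^N absorbs
    -- the loss C^{k-i} in passing from ω̂(r_i) to ω̂(r_k).
    calc t ^ N ≤ node (i + 1) ^ N := by
          gcongr
          exact ht.1
      _ ≤ Real.exp 1 * Real.exp (-(2 ^ (k - i) / 2)) := node_pow_le_exp hik hN
      _ = Real.exp 1 * Real.exp (-(2 ^ (k - i) / 2)) * (tail ω (node i) / tail ω (node i)) := by
          rw [div_self h1.ne', mul_one]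
      _ ≤ Real.exp 1 * Real.exp (-(2 ^ (k - i) / 2)) *
            (C ^ (k - i) * tail ω (node k) / tail ω (node i)) := by gcongr
      _ = Real.exp 1 * (C ^ (k - i) * Real.exp (-(2 ^ (k - i) / 2))) *
            (tail ω (node k) / tail ω (node i)) := by ring
      _ ≤ Real.exp 1 * (K * (1 / 2) ^ (k - i)) * (tail ω (node k) / tail ω (node i)) := by
          gcongr Real.exp 1 * ?_ * _
          exact hexp _
      _ = _ := by ring

theorem aemeasurable_enorm_mul_weight (hω : IsRadialWeight ω) {f : ℝ → ℂ}
    (hf : AEStronglyMeasurable f unitMeasure) :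
    AEMeasurable (fun t => ‖f t‖ₑ * ENNReal.ofReal (ω t)) unitMeasure :=
  hf.enorm.mul hω.integrable.1.aemeasurable.ennreal_ofReal

/-- Integration against finite sums of indicators of `[1-2^{-j},1)`. -/
theorem lintegral_mul_sum_indicator (hω : IsRadialWeight ω) {f : ℝ → ℂ}
    (hf : AEStronglyMeasurable f unitMeasure) (s : Finset ℕ) (c : ℕ → ℝ≥0∞) :
    ∫⁻ t, (‖f t‖ₑ * ENNReal.ofReal (ω t)) *
        ∑ j ∈ s, (Set.Ico (node j) 1).indicator (fun _ => c j / ENNReal.ofReal (tail ω (node j))) t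
        ∂unitMeasure = ∑ j ∈ s, c j * tailAverage ω f j := by
  have hm := aemeasurable_enorm_mul_weight hω hf
  simp_rw [Finset.mul_sum]
  rw [lintegral_finsetSum']
  · refine Finset.sum_congr rfl fun j _ => ?_
    have e : ∀ t, ‖f t‖ₑ * ENNReal.ofReal (ω t) * (Set.Ico (node j) 1).indicator
        (fun _ => c j / ENNReal.ofReal (tail ω (node j))) t =
        (Set.Ico (node j) 1).indicator (fun t => (c j / ENNReal.ofReal (tail ω (node j))) *
          (‖f t‖ₑ * ENNReal.ofReal (ω t))) t := fun t => by
      by_cases h : t ∈ Set.Ico (node j) 1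
      · simp only [Set.indicator_of_mem h]; ring
      · simp only [Set.indicator_of_notMem h, mul_zero]
    simp_rw [e]
    rw [lintegral_indicator measurableSet_Ico, unitMeasure,
      Measure.restrict_restrict measurableSet_Ico,
      Set.inter_eq_left.2 (Set.Ico_subset_Ico_left (node_nonneg j)), lintegral_const_mul'']
    · rw [tailAverage, div_eq_mul_inv, div_eq_mul_inv]; ring
    · exact hm.mono_measure (Measure.restrict_mono (Set.Ico_subset_Ico_left (node_nonneg j)) le_rfl)
  · intro j _
    exact hm.mul (measurable_const.indicator measurableSet_Ico).aemeasurable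

/-- The pointwise bound of t^N by indicators of [r_j,1), integrated against |f| ω, turns each
indicator into a tail average. -/
theorem IsUpperDoubling.exists_lintegral_pow_le (hω : IsUpperDoubling ω) :
    ∃ K : ℝ≥0∞, K ≠ ∞ ∧ ∀ f : ℝ → ℂ, AEStronglyMeasurable f unitMeasure →
      ∀ N k : ℕ, 2 ^ k ≤ N + 1 →
      ∫⁻ t, (‖f t‖ₑ * ENNReal.ofReal (ω t)) * ENNReal.ofReal (t ^ N) ∂unitMeasure ≤
        K * ENNReal.ofReal (tail ω (node k)) *
          ∑ j ∈ Finset.range (k + 1), 2⁻¹ ^ (k - j) * tailAverage ω f j := by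
  obtain ⟨K, hK, h⟩ := hω.exists_pow_le_sum
  have hpos := hω.toIsRadialWeight.tail_node_pos
  refine ⟨ENNReal.ofReal K, ENNReal.ofReal_ne_top, fun f hf N k hN => ?_⟩
  have h1 := lintegral_mul_sum_indicator hω.toIsRadialWeight hf (Finset.range (k + 1))
    (fun j => ENNReal.ofReal K * ENNReal.ofReal (tail ω (node k)) * 2⁻¹ ^ (k - j))
  rw [Finset.mul_sum]
  simp_rw [← mul_assoc (ENNReal.ofReal K * ENNReal.ofReal (tail ω (node k)))]
  rw [← h1, unitMeasure]
  refine setLIntegral_mono' measurableSet_Ico fun t ht => ?_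
  gcongr
  refine (ENNReal.ofReal_le_ofReal (h N k hN t ht)).trans ?_
  rw [ENNReal.ofReal_sum_of_nonneg]
  · refine Finset.sum_le_sum fun j _ => ?_
    by_cases hj : t ∈ Set.Ico (node j) 1
    · simp only [Set.indicator_of_mem hj]
      have := hpos k
      rw [ENNReal.ofReal_mul (by positivity), ENNReal.ofReal_mul (by positivity),
        ENNReal.ofReal_div_of_pos (hpos j), ofReal_half_pow, mul_div_assoc]
    · simp only [Set.indicator_of_notMem hj, ENNReal.ofReal_zero, le_refl]
  · intro j _
    have h1 := hpos j
    have h2 := hpos k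
    refine Set.indicator_nonneg (fun _ _ => ?_) _
    positivity

theorem IsRadialWeight.tailAverage_one (hω : IsRadialWeight ω) (k : ℕ) :
    tailAverage ω (fun _ => 1) k = 1 := by
  unfold tailAverage
  simp only [enorm_one, one_mul]
  rw [← hω.ofReal_tail (node_nonneg k)]
  exact ENNReal.div_self (by simpa using hω.tail_node_pos k) ENNReal.ofReal_ne_top

theorem IsRadialWeight.ofReal_moment (hω : IsRadialWeight ω) (N : ℕ) :
    ENNReal.ofReal (moment ω N) =
      ∫⁻ t, ENNReal.ofReal (ω t) * ENNReal.ofReal (t ^ N) ∂unitMeasure := by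
  unfold moment
  rw [ofReal_integral_eq_lintegral_ofReal (hω.integrable_pow_mul N)]
  · refine setLIntegral_congr_fun measurableSet_Ico fun t ht => ?_
    rw [← ENNReal.ofReal_mul (hω.nonneg t ht), mul_comm]
  · filter_upwards [ae_restrict_mem measurableSet_Ico] with t ht
    exact mul_nonneg (pow_nonneg ht.1 _) (hω.nonneg t ht)

/-- The case f = 1 of `IsUpperDoubling.exists_lintegral_pow_le`, where all tail averages equal 1 and
a geometric series remains. -/
theorem IsUpperDoubling.exists_moment_le (hω : IsUpperDoubling ω) :
    ∃ K : ℝ, 0 < K ∧ ∀ N k : ℕ, 2 ^ k ≤ N + 1 → moment ω N ≤ K * tail ω (node k) := by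
  obtain ⟨K, hK, h⟩ := hω.exists_lintegral_pow_le
  have hpos := hω.toIsRadialWeight.tail_node_pos
  refine ⟨(K * 2).toReal + 1, by positivity, fun N k hN => ?_⟩
  have h1 := h (fun _ => 1) aestronglyMeasurable_const N k hN
  simp only [enorm_one, one_mul, hω.toIsRadialWeight.tailAverage_one, mul_one] at h1
  rw [← hω.toIsRadialWeight.ofReal_moment] at h1
  have h2 : ∑ j ∈ Finset.range (k + 1), (2⁻¹ : ℝ≥0∞) ^ (k - j) ≤ 2 := by
    calc ∑ j ∈ Finset.range (k + 1), (2⁻¹ : ℝ≥0∞) ^ (k - j)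
        = ∑ j ∈ Finset.range (k + 1), (if j ≤ k then (2⁻¹ : ℝ≥0∞) ^ (k - j) else 0) := by
          refine Finset.sum_congr rfl fun j hj => ?_
          rw [if_pos (Nat.lt_succ_iff.1 (Finset.mem_range.1 hj))]
      _ ≤ _ := ENNReal.sum_le_tsum _
      _ ≤ _ := tsum_ite_le_pow_sub _ k
      _ = 2 := by rw [ENNReal.one_sub_inv_two, inv_inv]
  have h3 : ENNReal.ofReal (moment ω N) ≤ ENNReal.ofReal ((K * 2).toReal * tail ω (node k)) := by
    rw [ENNReal.ofReal_mul (by positivity),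
      ENNReal.ofReal_toReal (ENNReal.mul_ne_top hK (by norm_num))]
    refine h1.trans ?_
    rw [mul_right_comm]
    gcongr
  have h4 := hpos k
  rw [ENNReal.ofReal_le_ofReal_iff (by positivity)] at h3
  linarith

/-- On [r_{k+1},1) the power t^n stays above 1/16 for n ≤ 4·2^k, and one doubling step replaces
ω̂(r_{k+1}) by ω̂(r_k). -/
theorem IsUpperDoubling.exists_le_moment (hω : IsUpperDoubling ω) :
    ∃ c : ℝ, 0 < c ∧ ∀ n k : ℕ, n ≤ 2 ^ (k + 2) → c * tail ω (node k) ≤ moment ω n := by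
  obtain ⟨C, hC, hd⟩ := hω.exists_tail_node_le
  have hC0 : 0 < C := by linarith
  refine ⟨(1 / 2) ^ 4 / C, by positivity, fun n k hn => ?_⟩
  have h1 := half_pow_le_node_pow k 4 n (by rw [pow_add] at hn; omega)
  have h2 := hω.toIsRadialWeight.pow_mul_tail_le_moment n (node_nonneg (k + 1))
  have h3 := hω.toIsRadialWeight.tail_node_pos (k + 1)
  calc (1 / 2) ^ 4 / C * tail ω (node k) ≤ (1 / 2) ^ 4 / C * (C * tail ω (node (k + 1))) := by
        gcongr
        exact hd k
    _ = (1 / 2) ^ 4 * tail ω (node (k + 1)) := by field_simp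
    _ ≤ node (k + 1) ^ n * tail ω (node (k + 1)) := by gcongr
    _ ≤ _ := h2

/-- Growth of power series whose coefficients are inverse tails. -/
theorem IsUpperDoubling.exists_tsum_div_tail_le (hω : IsUpperDoubling ω) :
    ∃ K : ℝ, 0 < K ∧ ∀ (k : ℕ) (s : ℝ), 0 ≤ s → s ≤ node (k + 1) →
      Summable (fun m : ℕ => s ^ m / tail ω (node (Nat.log 2 (m + 1)))) ∧
      ∑' m : ℕ, s ^ m / tail ω (node (Nat.log 2 (m + 1))) ≤ K * 2 ^ k / tail ω (node k) := by
  obtain ⟨C, hC, hd⟩ := hω.exists_tail_node_le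
  have hpos := hω.toIsRadialWeight.tail_node_pos
  -- Since C < 2^n, inverse tails grow at most polynomially of degree n in the index: the
  -- coefficients are dominated by those at level k times 1 + ((m+1) 2^{-k})^n.
  obtain ⟨n, hn⟩ := pow_unbounded_of_one_lt C (by norm_num : (1 : ℝ) < 2)
  refine ⟨2 + n.factorial * 2 ^ (n + 1), by positivity, fun k s hs0 hs => ?_⟩
  have hs1 : s < 1 := hs.trans_lt (node_lt_one _)
  have hsn : ‖s‖ < 1 := by rwa [Real.norm_eq_abs, abs_of_nonneg hs0]
  have hτ := hpos k
  have hterm : ∀ m : ℕ, s ^ m / tail ω (node (Nat.log 2 (m + 1))) ≤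
      (1 / tail ω (node k)) * (s ^ m +
        (n.factorial * ((1 / 2) ^ k) ^ n) * (((m + n).choose n : ℕ) * s ^ m)) := fun m => by
    have hinv : 1 / tail ω (node (Nat.log 2 (m + 1))) ≤
        (1 / tail ω (node k)) * (1 + ((m + 1 : ℝ) * (1 / 2) ^ k) ^ n) := by
      set i := Nat.log 2 (m + 1) with hi
      have hti := hpos i
      rcases le_total i k with hik | hik
      · have h1 : tail ω (node k) ≤ tail ω (node i) :=
          hω.toIsRadialWeight.tail_anti (node_nonneg i) (node_mono hik)
        calc 1 / tail ω (node i) ≤ 1 / tail ω (node k) := one_div_le_one_div_of_le hτ h1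
          _ ≤ _ := by
            refine le_mul_of_one_le_right (by positivity) ?_
            have : (0 : ℝ) ≤ ((m + 1 : ℝ) * (1 / 2) ^ k) ^ n := by positivity
            linarith
      · obtain ⟨l, hl⟩ := Nat.exists_eq_add_of_le hik
        have h1 := tail_le_pow_mul hC hd k l
        rw [← hl] at h1
        have h2 : (2 : ℝ) ^ l ≤ (m + 1 : ℝ) * (1 / 2) ^ k := by
          have h3 : 2 ^ i ≤ m + 1 := Nat.pow_log_le_self 2 (by omega)
          have h4 : (2 : ℝ) ^ i ≤ m + 1 := by exact_mod_cast h3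
          rw [hl, pow_add] at h4
          rw [one_div_pow, mul_one_div, le_div_iff₀ (by positivity)]
          linarith
        have h5 : C ^ l ≤ ((m + 1 : ℝ) * (1 / 2) ^ k) ^ n := by
          calc C ^ l ≤ (2 ^ n) ^ l := by gcongr
            _ = (2 ^ l) ^ n := by rw [← pow_mul, ← pow_mul, mul_comm]
            _ ≤ _ := by gcongr
        calc 1 / tail ω (node i) ≤ C ^ l / tail ω (node k) := by
              rw [div_le_div_iff₀ hti hτ]; linarith
          _ = 1 / tail ω (node k) * C ^ l := by ring
          _ ≤ _ := by
            gcongr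
            linarith
    -- The power (m+1)^n is replaced by a rising factorial, whose generating series n!/(1-s)^{n+1}
    -- is explicit.
    have hch : ((m + 1 : ℝ)) ^ n ≤ n.factorial * ((m + n).choose n : ℕ) := by
      have h1 : (m + 1) ^ n ≤ n.factorial * (m + n).choose n := by
        rw [← Nat.descFactorial_eq_factorial_mul_choose]
        have := Nat.pow_sub_le_descFactorial (m + n) n
        have e : m + n + 1 - n = m + 1 := by omega
        rwa [e] at this
      exact_mod_cast h1
    calc s ^ m / tail ω (node (Nat.log 2 (m + 1)))
        = s ^ m * (1 / tail ω (node (Nat.log 2 (m + 1)))) := by ring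
      _ ≤ s ^ m * ((1 / tail ω (node k)) * (1 + ((m + 1 : ℝ) * (1 / 2) ^ k) ^ n)) := by gcongr
      _ = (1 / tail ω (node k)) * (s ^ m + (m + 1 : ℝ) ^ n * ((1 / 2) ^ k) ^ n * s ^ m) := by
          rw [mul_pow]; ring
      _ ≤ (1 / tail ω (node k)) * (s ^ m +
            (n.factorial * ((m + n).choose n : ℕ)) * ((1 / 2) ^ k) ^ n * s ^ m) := by gcongr
      _ = _ := by ring
  have hsum1 : Summable fun m : ℕ => s ^ m := summable_geometric_of_lt_one hs0 hs1
  have hsum2 : Summable fun m : ℕ => (((m + n).choose n : ℕ) : ℝ) * s ^ m :=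
    summable_choose_mul_geometric_of_norm_lt_one n hsn
  have hsum3 := (hsum1.add (hsum2.mul_left (n.factorial * ((1 / 2 : ℝ) ^ k) ^ n))).mul_left
    (1 / tail ω (node k))
  have hsum : Summable (fun m : ℕ => s ^ m / tail ω (node (Nat.log 2 (m + 1)))) :=
    Summable.of_nonneg_of_le (fun m => div_nonneg (pow_nonneg hs0 _) (hpos _).le) hterm hsum3
  refine ⟨hsum, (hsum.tsum_le_tsum hterm hsum3).trans ?_⟩
  have hinv : 1 / (1 - s) ≤ 2 * 2 ^ k := by
    have h1 : (1 / 2 : ℝ) ^ (k + 1) ≤ 1 - s := by unfold node at hs; linarith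
    calc 1 / (1 - s) ≤ 1 / (1 / 2 : ℝ) ^ (k + 1) := one_div_le_one_div_of_le (by positivity) h1
      _ = 2 * 2 ^ k := by rw [one_div_pow, one_div_one_div, pow_succ]; ring
  rw [tsum_mul_left, (hsum1).tsum_add (hsum2.mul_left _), tsum_mul_left,
    tsum_geometric_of_lt_one hs0 hs1, tsum_choose_mul_geometric_of_norm_lt_one n hsn]
  have hs' : 0 < 1 - s := by linarith
  calc (1 / tail ω (node k)) * ((1 - s)⁻¹ + n.factorial * ((1 / 2) ^ k) ^ n *
        (1 / (1 - s) ^ (n + 1)))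
      = (1 / tail ω (node k)) * (1 / (1 - s) + n.factorial * ((1 / 2) ^ k) ^ n *
        (1 / (1 - s)) ^ (n + 1)) := by rw [one_div_pow (1 - s), ← one_div (1 - s)]
    _ ≤ (1 / tail ω (node k)) * (2 * 2 ^ k + n.factorial * ((1 / 2) ^ k) ^ n *
        (2 * 2 ^ k) ^ (n + 1)) := by gcongr
    _ = _ := by
        have e : ((1 / 2 : ℝ) ^ k) ^ n * (2 * 2 ^ k) ^ (n + 1) = 2 ^ (n + 1) * 2 ^ k := by
          rw [mul_pow, pow_succ (2 ^ k : ℝ) n, one_div_pow, one_div_pow]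
          field_simp
        rw [mul_assoc _ _ ((2 * 2 ^ k : ℝ) ^ (n + 1)), e]
        ring

end

section


/-! ### Power series and polar coordinates -/

theorem hasFPowerSeriesOnBall_of_summable {c : ℕ → ℂ} {F : ℂ → ℂ}
    (hc : ∀ s : ℝ, 0 ≤ s → s < 1 → Summable fun n => ‖c n‖ * s ^ n)
    (hF : ∀ z ∈ disc, F z = ∑' n, c n * z ^ n) :
    HasFPowerSeriesOnBall F (FormalMultilinearSeries.ofScalars ℂ c) 0 1 where
  r_le := by
    refine ENNReal.le_of_forall_nnreal_lt fun r hr => ?_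
    refine FormalMultilinearSeries.le_radius_of_summable _ ?_
    simp only [FormalMultilinearSeries.ofScalars_norm]
    exact hc r r.2 (by exact_mod_cast hr)
  r_pos := by norm_num
  hasSum := by
    intro z hz
    have hz1 : ‖z‖ < 1 := by
      have h1 : ‖z‖ₑ < 1 := by simpa using hz
      rw [← ofReal_norm, ← ENNReal.ofReal_one] at h1
      exact (ENNReal.ofReal_lt_ofReal_iff (by norm_num)).1 h1
    rw [zero_add, hF z (by simpa [disc] using hz1)]
    simp only [FormalMultilinearSeries.ofScalars_apply_eq, smul_eq_mul]
    refine Summable.hasSum (Summable.of_norm ?_)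
    simpa using hc ‖z‖ (norm_nonneg z) hz1

theorem differentiableOn_of_eq_tsum {c : ℕ → ℂ} {F : ℂ → ℂ}
    (hc : ∀ s : ℝ, 0 ≤ s → s < 1 → Summable fun n => ‖c n‖ * s ^ n)
    (hF : ∀ z ∈ disc, F z = ∑' n, c n * z ^ n) : DifferentiableOn ℂ F disc := by
  have h := (hasFPowerSeriesOnBall_of_summable hc hF).differentiableOn
  refine h.mono fun z hz => ?_
  have hz' : ‖z‖ < 1 := by simpa [disc] using hz
  simp only [Metric.mem_eball, edist_zero_right, ← ofReal_norm]
  rw [← ENNReal.ofReal_one]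
  exact (ENNReal.ofReal_lt_ofReal_iff (by norm_num)).2 hz'

theorem taylorCoeff_of_eq_tsum {c : ℕ → ℂ} {F : ℂ → ℂ}
    (hc : ∀ s : ℝ, 0 ≤ s → s < 1 → Summable fun n => ‖c n‖ * s ^ n)
    (hF : ∀ z ∈ disc, F z = ∑' n, c n * z ^ n) (n : ℕ) : taylorCoeff F n = c n := by
  have h := (hasFPowerSeriesOnBall_of_summable hc hF).factorial_smul 1 n
  rw [← iteratedDeriv_eq_iteratedFDeriv] at h
  simp only [FormalMultilinearSeries.ofScalars_apply_eq, one_pow, smul_eq_mul, mul_one,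
    nsmul_eq_mul] at h
  unfold taylorCoeff
  rw [← h, mul_div_cancel_left₀]
  exact_mod_cast n.factorial_ne_zero

theorem apply_zero_of_eq_tsum {c : ℕ → ℂ} {F : ℂ → ℂ}
    (hF : ∀ z ∈ disc, F z = ∑' n, c n * z ^ n) : F 0 = c 0 := by
  rw [hF 0 (by simp [disc]), tsum_eq_single 0 (fun n hn => by simp [hn])]
  simp

theorem hasSum_taylorCoeff {f : ℂ → ℂ} (hf : DifferentiableOn ℂ f disc) {z : ℂ} (hz : z ∈ disc) :
    HasSum (fun n => taylorCoeff f n * z ^ n) (f z) := by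
  have h := Complex.hasSum_taylorSeries_on_ball hf hz
  refine h.congr_fun fun n => ?_
  simp only [taylorCoeff, sub_zero, smul_eq_mul]
  field_simp

theorem differentiableOn_deriv {f : ℂ → ℂ} (hf : DifferentiableOn ℂ f disc) :
    DifferentiableOn ℂ (deriv f) disc := hf.deriv Metric.isOpen_ball

theorem hasSum_deriv {f : ℂ → ℂ} (hf : DifferentiableOn ℂ f disc) {z : ℂ} (hz : z ∈ disc) :
    HasSum (fun n : ℕ => (n + 1) * taylorCoeff f (n + 1) * z ^ n) (deriv f z) := by
  refine (hasSum_taylorCoeff (differentiableOn_deriv hf) hz).congr_fun fun n => ?_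
  congr 1
  unfold taylorCoeff
  rw [← iteratedDeriv_succ', Nat.factorial_succ]
  push_cast
  have h1 : (n.factorial : ℂ) ≠ 0 := by exact_mod_cast n.factorial_ne_zero
  have h2 : (n + 1 : ℂ) ≠ 0 := by exact_mod_cast n.succ_ne_zero
  field_simp

/-- On |z| = r one has conj(z) = r²/z, so the pairing with conj(z)^n is Cauchy's coefficient
formula; periodicity moves (-π,π) to (0,2π). -/
theorem integral_circle_mul_conj_pow {f : ℂ → ℂ} (hf : DifferentiableOn ℂ f disc) {r : ℝ}
    (hr0 : 0 < r) (hr1 : r < 1) (n : ℕ) :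
    ∫ θ in Set.Ioo (-Real.pi) Real.pi, f (circleMap 0 r θ) * conj (circleMap 0 r θ ^ n) =
      2 * Real.pi * r ^ (2 * n) * taylorCoeff f n := by
  have hπ := Real.pi_pos
  have hd : DiffContOnCl ℂ f (Metric.ball 0 r) :=
    DifferentiableOn.diffContOnCl (hf.mono (by
      rw [closure_ball _ hr0.ne']; exact Metric.closedBall_subset_ball hr1))
  have h := hd.circleIntegral_one_div_sub_center_pow_smul hr0 n
  have hper : Function.Periodic (fun θ => f (circleMap 0 r θ) * conj (circleMap 0 r θ ^ n))
      (2 * Real.pi) := fun θ => by simp only [periodic_circleMap 0 r θ]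
  rw [← integral_Ioc_eq_integral_Ioo, ← intervalIntegral.integral_of_le (by linarith)]
  have e1 := hper.intervalIntegral_add_eq (-Real.pi) 0
  have e2 : -Real.pi + 2 * Real.pi = Real.pi := by ring
  rw [e2, zero_add] at e1
  rw [e1]
  have hr : (r : ℂ) ≠ 0 := by exact_mod_cast hr0.ne'
  have e3 : (∮ z in C(0, r), (1 / (z - 0) ^ (n + 1)) • f z) = Complex.I / r ^ (2 * n) *
      ∫ θ in (0 : ℝ)..2 * Real.pi, f (circleMap 0 r θ) * conj (circleMap 0 r θ ^ n) := by
    rw [circleIntegral, ← intervalIntegral.integral_const_mul]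
    refine intervalIntegral.integral_congr fun θ _ => ?_
    have hz : circleMap 0 r θ ≠ 0 := by simp [hr0.ne']
    have hzz : circleMap 0 r θ * conj (circleMap 0 r θ) = r ^ 2 := by
      rw [Complex.mul_conj, Complex.normSq_eq_norm_sq]
      simp
    simp only [deriv_circleMap, sub_zero, smul_eq_mul, map_pow]
    have hp : circleMap 0 r θ ^ n * conj (circleMap 0 r θ) ^ n = r ^ (2 * n) := by
      rw [← mul_pow, hzz, ← pow_mul]
    rw [← hp, pow_succ]
    have hz2 : conj (circleMap 0 r θ) ≠ 0 := by simpa using hz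
    field_simp
  rw [e3] at h
  have hf0 : (n.factorial : ℂ) ≠ 0 := by exact_mod_cast n.factorial_ne_zero
  unfold taylorCoeff
  rw [smul_eq_mul] at h
  field_simp at h ⊢
  linear_combination h

/-! ### Polar coordinates on the disc -/

/-- The polar rectangle of the unit disc. -/
def polarBox : Set (ℝ × ℝ) := Set.Ioo 0 1 ×ˢ Set.Ioo (-Real.pi) Real.pi

theorem measurableSet_polarBox : MeasurableSet polarBox := measurableSet_Ioo.prod measurableSet_Ioo

theorem polarCoord_symm_eq_circleMap (x : ℝ × ℝ) :
    Complex.polarCoord.symm x = circleMap 0 x.1 x.2 := by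
  rw [Complex.polarCoord_symm_apply, circleMap, Complex.exp_mul_I]
  simp

theorem polarCoord_target_inter :
    polarCoord.target ∩ {x : ℝ × ℝ | circleMap 0 x.1 x.2 ∈ disc} = polarBox := by
  ext x
  simp only [polarCoord_target, polarBox, disc, Set.mem_inter_iff, Set.mem_prod, Set.mem_Ioi,
    Set.mem_Ioo, Set.mem_ofPred_eq, mem_ball_zero_iff, norm_circleMap_zero]
  constructor
  · rintro ⟨⟨h1, h2⟩, h3⟩
    exact ⟨⟨h1, by rwa [abs_of_pos h1] at h3⟩, h2⟩
  · rintro ⟨⟨h1, h3⟩, h2⟩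
    exact ⟨⟨h1, h2⟩, by rwa [abs_of_pos h1]⟩

theorem measurableSet_disc : MeasurableSet disc := measurableSet_ball

theorem continuous_circleMap_prod : Continuous fun x : ℝ × ℝ => circleMap 0 x.1 x.2 := by
  unfold circleMap; fun_prop

theorem measurableSet_preimage_disc :
    MeasurableSet {x : ℝ × ℝ | circleMap 0 x.1 x.2 ∈ disc} :=
  continuous_circleMap_prod.measurable measurableSet_disc

theorem lintegral_areaMeasure (g : ℂ → ℝ≥0∞) :
    ∫⁻ z, g z ∂areaMeasure = ENNReal.ofReal Real.pi⁻¹ *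
      ∫⁻ x in polarBox, ENNReal.ofReal x.1 * g (circleMap 0 x.1 x.2) := by
  unfold areaMeasure
  rw [lintegral_smul_measure, smul_eq_mul, ← lintegral_indicator measurableSet_disc,
    ← Complex.lintegral_comp_polarCoord_symm, ← polarCoord_target_inter,
    Set.inter_comm, ← Measure.restrict_restrict measurableSet_preimage_disc,
    ← lintegral_indicator measurableSet_preimage_disc]
  congr 2 with x
  rw [polarCoord_symm_eq_circleMap, smul_eq_mul]
  by_cases h : circleMap 0 x.1 x.2 ∈ disc
  · rw [Set.indicator_of_mem h, Set.indicator_of_mem (by exact h)]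
  · rw [Set.indicator_of_notMem h, Set.indicator_of_notMem (by exact h), mul_zero]

theorem integral_areaMeasure (g : ℂ → ℂ) :
    ∫ z, g z ∂areaMeasure = (Real.pi⁻¹ : ℂ) *
      ∫ x in polarBox, (x.1 : ℂ) * g (circleMap 0 x.1 x.2) := by
  unfold areaMeasure
  rw [integral_smul_measure, ← integral_indicator measurableSet_disc,
    ← Complex.integral_comp_polarCoord_symm, ← polarCoord_target_inter,
    Set.inter_comm, ← Measure.restrict_restrict measurableSet_preimage_disc,
    ← integral_indicator measurableSet_preimage_disc,
    ENNReal.toReal_ofReal (by positivity), Complex.real_smul]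
  push_cast
  congr 2 with x
  rw [polarCoord_symm_eq_circleMap, Complex.real_smul]
  by_cases h : circleMap 0 x.1 x.2 ∈ disc
  · rw [Set.indicator_of_mem h, Set.indicator_of_mem (by exact h)]
  · rw [Set.indicator_of_notMem h, Set.indicator_of_notMem (by exact h), mul_zero]

theorem restrict_polarBox : (volume : Measure (ℝ × ℝ)).restrict polarBox =
    (volume.restrict (Set.Ioo 0 1)).prod (volume.restrict (Set.Ioo (-Real.pi) Real.pi)) := by
  rw [Measure.volume_eq_prod, Measure.prod_restrict]
  rfl

theorem continuousOn_comp_polar {f : ℂ → ℂ} (hf : ContinuousOn f disc) :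
    ContinuousOn (fun x : ℝ × ℝ => f (circleMap 0 x.1 x.2)) polarBox :=
  hf.comp continuous_circleMap_prod.continuousOn fun x hx =>
    circleMap_mem_disc hx.1.1.le hx.1.2 x.2

theorem aestronglyMeasurable_weight_polar {ω : ℝ → ℝ}
    (hω : AEStronglyMeasurable ω unitMeasure) :
    AEStronglyMeasurable (fun x : ℝ × ℝ => ω x.1) (volume.restrict polarBox) := by
  rw [restrict_polarBox]
  exact (hω.mono_measure (Measure.restrict_mono Set.Ioo_subset_Ico_self le_rfl)).comp_fst

/-- Polar coordinates use (-π,π), the integral means [0,2π); the piece [-π,0) is shifted by one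
period. -/
theorem lintegral_Ioo_periodic {φ : ℝ → ℝ≥0∞} (hφ : Function.Periodic φ (2 * Real.pi)) :
    ∫⁻ θ in Set.Ioo (-Real.pi) Real.pi, φ θ = ∫⁻ θ in Set.Ico 0 (2 * Real.pi), φ θ := by
  have hπ := Real.pi_pos
  have hdisj1 : Disjoint (Set.Ico (-Real.pi) 0) (Set.Ico 0 Real.pi) := by
    rw [Set.Ico_disjoint_Ico]; simp [hπ.le]
  have hdisj2 : Disjoint (Set.Ico 0 Real.pi) (Set.Ico Real.pi (2 * Real.pi)) := by
    rw [Set.Ico_disjoint_Ico]; simp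
  have h1 : ∫⁻ θ in Set.Ico (-Real.pi) 0, φ θ = ∫⁻ θ in Set.Ico Real.pi (2 * Real.pi), φ θ := by
    rw [← lintegral_indicator measurableSet_Ico, ← lintegral_indicator measurableSet_Ico,
      ← lintegral_add_right_eq_self ((Set.Ico Real.pi (2 * Real.pi)).indicator φ) (2 * Real.pi)]
    congr 1 with θ
    by_cases h : θ ∈ Set.Ico (-Real.pi) 0
    · rw [Set.indicator_of_mem h, Set.indicator_of_mem, hφ θ]
      exact ⟨by linarith [h.1], by linarith [h.2]⟩
    · rw [Set.indicator_of_notMem h, Set.indicator_of_notMem]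
      exact fun h' => h ⟨by linarith [h'.1], by linarith [h'.2]⟩
  rw [setLIntegral_congr (Ioo_ae_eq_Ico (μ := volume)),
    ← Set.Ico_union_Ico_eq_Ico (by linarith : -Real.pi ≤ 0) hπ.le,
    lintegral_union measurableSet_Ico hdisj1, h1,
    ← Set.Ico_union_Ico_eq_Ico hπ.le (by linarith : Real.pi ≤ 2 * Real.pi),
    lintegral_union measurableSet_Ico hdisj2, add_comm]

/-- The weighted Bergman norm in polar coordinates. -/
theorem bergmanNormPow_eq {ω : ℝ → ℝ} (hω : AEStronglyMeasurable ω unitMeasure) {p : ℝ}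
    (hp : 0 < p) {f : ℂ → ℂ} (hf : ContinuousOn f disc) :
    bergmanNormPow ω p f = ∫⁻ r in Set.Ioo 0 1,
      ENNReal.ofReal (2 * r) * ENNReal.ofReal (ω r) * integralMean p r f ^ p := by
  have hm : AEMeasurable (fun x : ℝ × ℝ => ENNReal.ofReal x.1 *
      (‖f (circleMap 0 x.1 x.2)‖ₑ ^ p * ENNReal.ofReal (ω x.1))) (volume.restrict polarBox) := by
    refine (by fun_prop : AEMeasurable (fun x : ℝ × ℝ => ENNReal.ofReal x.1) _).mul ?_
    refine ((((continuousOn_comp_polar hf).aemeasurable measurableSet_polarBox).enorm).pow_const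
      p).mul ?_
    exact (aestronglyMeasurable_weight_polar hω).aemeasurable.ennreal_ofReal
  unfold bergmanNormPow
  rw [lintegral_areaMeasure]
  have e : ∫⁻ x in polarBox, ENNReal.ofReal x.1 * (‖f (circleMap 0 x.1 x.2)‖ₑ ^ p *
      ENNReal.ofReal (ω ‖circleMap 0 x.1 x.2‖)) = ∫⁻ x in polarBox, ENNReal.ofReal x.1 *
      (‖f (circleMap 0 x.1 x.2)‖ₑ ^ p * ENNReal.ofReal (ω x.1)) := by
    refine setLIntegral_congr_fun measurableSet_polarBox fun x hx => ?_
    simp only [norm_circleMap_zero, abs_of_pos hx.1.1]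
  rw [e]
  rw [restrict_polarBox] at hm ⊢
  rw [lintegral_prod _ hm, ← lintegral_const_mul' _ _ ENNReal.ofReal_ne_top]
  refine setLIntegral_congr_fun measurableSet_Ioo fun r hr => ?_
  have hmθ := measurable_enorm_comp_circleMap hf hr.1.le hr.2
  have e2 : ∀ θ, ENNReal.ofReal r * (‖f (circleMap 0 r θ)‖ₑ ^ p * ENNReal.ofReal (ω r)) =
      (ENNReal.ofReal r * ENNReal.ofReal (ω r)) * ‖f (circleMap 0 r θ)‖ₑ ^ p := fun θ => by ring
  simp only [e2]
  rw [lintegral_const_mul' _ _ (by finiteness), lintegral_Ioo_periodic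
    (fun θ => by simp only [periodic_circleMap 0 r θ]),
    lintegral_circle_eq_integralMean_rpow hp]
  have e3 : ENNReal.ofReal (2 * r) = ENNReal.ofReal Real.pi⁻¹ * ENNReal.ofReal r *
      ENNReal.ofReal (2 * Real.pi) := by
    rw [← ENNReal.ofReal_mul (by positivity), ← ENNReal.ofReal_mul (by
      have := hr.1; positivity)]
    congr 1
    have := Real.pi_pos
    field_simp
  rw [e3]
  ring

end

section


/-! ### The Bergman kernel as a power series -/

variable {ω : ℝ → ℝ}

theorem ae_mem_disc : ∀ᵐ z ∂areaMeasure, z ∈ disc :=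
  Measure.ae_smul_measure (ae_restrict_mem measurableSet_disc) _

/-- A weight is only almost everywhere measurable on [0,1); null sets of radii must pull back to
null sets of the disc for ω(|z|) to be measurable there. -/
theorem quasiMeasurePreserving_norm :
    Measure.QuasiMeasurePreserving (fun z : ℂ => ‖z‖) areaMeasure unitMeasure := by
  refine ⟨measurable_norm, Measure.AbsolutelyContinuous.mk fun N hN h0 => ?_⟩
  rw [Measure.map_apply measurable_norm hN, ← lintegral_indicator_one (measurable_norm hN),
    lintegral_areaMeasure]
  have h1 : ∀ᵐ x ∂(volume.restrict polarBox), x.1 ∉ N := by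
    rw [restrict_polarBox]
    have h2 : ∀ᵐ r ∂(volume.restrict (Set.Ioo (0 : ℝ) 1)), r ∉ N := by
      refine ae_mono (Measure.restrict_mono Set.Ioo_subset_Ico_self le_rfl)
        (measure_eq_zero_iff_ae_notMem.1 h0)
    exact Measure.quasiMeasurePreserving_fst.ae h2
  rw [lintegral_congr_ae (g := fun _ => 0), lintegral_zero, mul_zero]
  filter_upwards [h1, ae_restrict_mem measurableSet_polarBox] with x hx hx2
  rw [Set.indicator_of_notMem, mul_zero]
  simpa [abs_of_pos hx2.1.1] using hx

theorem IsRadialWeight.aestronglyMeasurable_comp_norm (hω : IsRadialWeight ω) :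
    AEStronglyMeasurable (fun z : ℂ => ω ‖z‖) areaMeasure :=
  hω.integrable.1.comp_quasiMeasurePreserving quasiMeasurePreserving_norm

theorem IsRadialWeight.lintegral_comp_norm_lt_top (hω : IsRadialWeight ω) :
    ∫⁻ z, ENNReal.ofReal (ω ‖z‖) ∂areaMeasure < ∞ := by
  rw [lintegral_areaMeasure]
  refine ENNReal.mul_lt_top ENNReal.ofReal_lt_top ?_
  calc ∫⁻ x in polarBox, ENNReal.ofReal x.1 * ENNReal.ofReal (ω ‖circleMap 0 x.1 x.2‖)
      ≤ ∫⁻ x in polarBox, ENNReal.ofReal (ω x.1) := by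
        refine setLIntegral_mono' measurableSet_polarBox fun x hx => ?_
        rw [norm_circleMap_zero, abs_of_pos hx.1.1]
        refine mul_le_of_le_one_left' ?_
        rw [← ENNReal.ofReal_one]
        exact ENNReal.ofReal_le_ofReal hx.1.2.le
    _ = ∫⁻ r in Set.Ioo 0 1, ENNReal.ofReal (ω r) * ENNReal.ofReal (2 * Real.pi) := by
        have hm := (aestronglyMeasurable_weight_polar hω.integrable.1).aemeasurable.ennreal_ofReal
        rw [restrict_polarBox] at hm ⊢
        rw [lintegral_prod _ hm]
        simp only [lintegral_const, Measure.restrict_apply_univ, Real.volume_Ioo]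
        congr 3 with r
        ring_nf
    _ = (∫⁻ r in Set.Ioo 0 1, ENNReal.ofReal (ω r)) * ENNReal.ofReal (2 * Real.pi) :=
        lintegral_mul_const' _ _ ENNReal.ofReal_ne_top
    _ < ∞ := by
        refine ENNReal.mul_lt_top ?_ ENNReal.ofReal_lt_top
        refine lt_of_le_of_lt (lintegral_mono_set Set.Ioo_subset_Ico_self) ?_
        exact Integrable.lintegral_lt_top hω.integrable

theorem IsRadialWeight.memBergman_of_bounded (hω : IsRadialWeight ω) {f : ℂ → ℂ}
    (hf : DifferentiableOn ℂ f disc) {M : ℝ} (hM : ∀ z ∈ disc, ‖f z‖ ≤ M) :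
    MemBergman ω 2 f := by
  refine ⟨hf, ?_⟩
  unfold bergmanNormPow
  calc ∫⁻ z, ‖f z‖ₑ ^ (2 : ℝ) * ENNReal.ofReal (ω ‖z‖) ∂areaMeasure
      ≤ ∫⁻ z, ENNReal.ofReal M ^ (2 : ℝ) * ENNReal.ofReal (ω ‖z‖) ∂areaMeasure := by
        refine lintegral_mono_ae ?_
        filter_upwards [ae_mem_disc] with z hz
        gcongr
        rw [← ofReal_norm]
        exact ENNReal.ofReal_le_ofReal (hM z hz)
    _ = ENNReal.ofReal M ^ (2 : ℝ) * ∫⁻ z, ENNReal.ofReal (ω ‖z‖) ∂areaMeasure :=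
        lintegral_const_mul' _ _ (by finiteness)
    _ < ∞ := ENNReal.mul_lt_top (by finiteness) hω.lintegral_comp_norm_lt_top

theorem aestronglyMeasurable_of_continuousOn {f : ℂ → ℂ} (hf : ContinuousOn f disc) :
    AEStronglyMeasurable f areaMeasure :=
  (hf.aestronglyMeasurable measurableSet_disc).smul_measure _

theorem IsRadialWeight.ae_nonneg_comp_norm (hω : IsRadialWeight ω) :
    ∀ᵐ z ∂areaMeasure, 0 ≤ ω ‖z‖ := by
  filter_upwards [ae_mem_disc] with z hz
  exact hω.nonneg _ ⟨norm_nonneg z, by simpa [disc] using hz⟩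

/-- From |f| ≤ |f|² + 1 and the integrability of ω(|z|) over the disc. -/
theorem IsRadialWeight.integrable_norm_mul (hω : IsRadialWeight ω) {f : ℂ → ℂ}
    (hf : MemBergman ω 2 f) : Integrable (fun z => f z * (ω ‖z‖ : ℂ)) areaMeasure := by
  have hm := aestronglyMeasurable_of_continuousOn hf.1.continuousOn
  have hωm := hω.aestronglyMeasurable_comp_norm
  refine ⟨hm.mul (Complex.continuous_ofReal.comp_aestronglyMeasurable hωm), ?_⟩
  refine lt_of_le_of_lt ?_ (ENNReal.add_lt_top.2 ⟨hf.2, hω.lintegral_comp_norm_lt_top⟩)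
  unfold bergmanNormPow
  rw [← lintegral_add_right' _ hωm.aemeasurable.ennreal_ofReal]
  refine lintegral_mono_ae ?_
  filter_upwards [hω.ae_nonneg_comp_norm] with z hz
  have e : ‖f z * (ω ‖z‖ : ℂ)‖ₑ = ‖f z‖ₑ * ENNReal.ofReal (ω ‖z‖) := by
    rw [enorm_mul, ← ofReal_norm (ω ‖z‖ : ℂ), Complex.norm_real, Real.norm_eq_abs,
      abs_of_nonneg hz]
  rw [e]
  calc ‖f z‖ₑ * ENNReal.ofReal (ω ‖z‖) ≤ (‖f z‖ₑ ^ (2 : ℝ) + 1) * ENNReal.ofReal (ω ‖z‖) := by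
        gcongr
        rcases le_total ‖f z‖ₑ 1 with h | h
        · exact h.trans le_add_self
        · refine le_trans ?_ le_self_add
          calc ‖f z‖ₑ = ‖f z‖ₑ ^ (1 : ℝ) := (ENNReal.rpow_one _).symm
            _ ≤ _ := ENNReal.rpow_le_rpow_of_exponent_le h (by norm_num)
    _ = _ := by rw [add_mul, one_mul]

theorem IsRadialWeight.integrable_mul_conj_pow (hω : IsRadialWeight ω) {f : ℂ → ℂ}
    (hf : MemBergman ω 2 f) (n : ℕ) :
    Integrable (fun z => f z * conj (z ^ n) * (ω ‖z‖ : ℂ)) areaMeasure := by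
  have h := hω.integrable_norm_mul hf
  have e : (fun z => f z * conj (z ^ n) * (ω ‖z‖ : ℂ)) =
      fun z => conj (z ^ n) * (f z * (ω ‖z‖ : ℂ)) := by ext z; ring
  rw [e]
  refine h.bdd_mul (c := 1) (by fun_prop) ?_
  filter_upwards [ae_mem_disc] with z hz
  have hz' : ‖z‖ < 1 := by simpa [disc] using hz
  rw [RCLike.norm_conj, norm_pow]
  exact pow_le_one₀ (norm_nonneg z) hz'.le

theorem integrable_polar {g : ℂ → ℂ}
    (hm : AEStronglyMeasurable (fun x : ℝ × ℝ => g (circleMap 0 x.1 x.2))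
      (volume.restrict polarBox)) (hg : Integrable g areaMeasure) :
    Integrable (fun x : ℝ × ℝ => (x.1 : ℂ) * g (circleMap 0 x.1 x.2))
      (volume.restrict polarBox) := by
  refine ⟨(by fun_prop : AEStronglyMeasurable (fun x : ℝ × ℝ => (x.1 : ℂ)) _).mul hm, ?_⟩
  have h := hg.2
  unfold HasFiniteIntegral at h ⊢
  rw [lintegral_areaMeasure] at h
  have h2 : ∫⁻ x in polarBox, ENNReal.ofReal x.1 * ‖g (circleMap 0 x.1 x.2)‖ₑ < ∞ := by
    by_contra hcon
    rw [not_lt, top_le_iff] at hcon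
    rw [hcon, ENNReal.mul_top (by simpa using Real.pi_pos)] at h
    exact lt_irrefl _ h
  refine lt_of_le_of_lt ?_ h2
  refine setLIntegral_mono' measurableSet_polarBox fun x hx => ?_
  rw [enorm_mul, ← ofReal_norm (x.1 : ℂ), Complex.norm_real, Real.norm_eq_abs, abs_of_pos hx.1.1]

/-- Taylor coefficients as pairings with monomials. -/
theorem IsRadialWeight.integral_mul_conj_pow (hω : IsRadialWeight ω) {f : ℂ → ℂ}
    (hf : MemBergman ω 2 f) (n : ℕ) :
    ∫ z, f z * conj (z ^ n) * (ω ‖z‖ : ℂ) ∂areaMeasure =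
      2 * moment ω (2 * n + 1) * taylorCoeff f n := by
  have hint := hω.integrable_mul_conj_pow hf n
  have hmeas : AEStronglyMeasurable (fun x : ℝ × ℝ => f (circleMap 0 x.1 x.2) *
      conj (circleMap 0 x.1 x.2 ^ n) * (ω ‖circleMap 0 x.1 x.2‖ : ℂ))
      (volume.restrict polarBox) := by
    refine AEStronglyMeasurable.mul (AEStronglyMeasurable.mul ?_ ?_) ?_
    · exact (continuousOn_comp_polar hf.1.continuousOn).aestronglyMeasurable measurableSet_polarBox
    · have := continuous_circleMap_prod
      exact Continuous.aestronglyMeasurable (by fun_prop)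
    · refine Complex.continuous_ofReal.comp_aestronglyMeasurable ?_
      refine (aestronglyMeasurable_weight_polar hω.integrable.1).congr ?_
      filter_upwards [ae_restrict_mem measurableSet_polarBox] with x hx
      rw [norm_circleMap_zero, abs_of_pos hx.1.1]
  have hp := integrable_polar (g := fun z => f z * conj (z ^ n) * (ω ‖z‖ : ℂ)) hmeas hint
  rw [integral_areaMeasure]
  rw [restrict_polarBox] at hp ⊢
  rw [integral_prod _ hp]
  have e : ∀ r ∈ Set.Ioo (0 : ℝ) 1, ∫ θ in Set.Ioo (-Real.pi) Real.pi, ((r : ℝ) : ℂ) *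
      (f (circleMap 0 r θ) * conj (circleMap 0 r θ ^ n) * (ω ‖circleMap 0 r θ‖ : ℂ)) =
      (2 * Real.pi * taylorCoeff f n) * ((r ^ (2 * n + 1) * ω r : ℝ) : ℂ) := fun r hr => by
    have e1 : ∀ θ, ((r : ℝ) : ℂ) *
        (f (circleMap 0 r θ) * conj (circleMap 0 r θ ^ n) * (ω ‖circleMap 0 r θ‖ : ℂ)) =
        ((r : ℂ) * (ω r : ℂ)) * (f (circleMap 0 r θ) * conj (circleMap 0 r θ ^ n)) := fun θ => by
      rw [norm_circleMap_zero, abs_of_pos hr.1]; ring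
    simp only [e1]
    rw [integral_const_mul, integral_circle_mul_conj_pow hf.1 hr.1 hr.2]
    push_cast
    ring
  rw [setIntegral_congr_fun measurableSet_Ioo e, integral_const_mul, integral_complex_ofReal,
    ← integral_Ico_eq_integral_Ioo]
  have hπ : (Real.pi : ℂ) ≠ 0 := by exact_mod_cast Real.pi_ne_zero
  unfold moment
  field_simp

/-- The coefficients `1 / (2 ω_{2n+1})` of the Bergman kernel. -/
def kernelCoeff (ω : ℝ → ℝ) (n : ℕ) : ℝ := 1 / (2 * moment ω (2 * n + 1))

theorem IsRadialWeight.kernelCoeff_pos (hω : IsRadialWeight ω) (n : ℕ) : 0 < kernelCoeff ω n := by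
  have := hω.moment_pos (2 * n + 1)
  unfold kernelCoeff
  positivity

/-- If k = log₂(m+1), rounded down, then m+1 < 2^{k+1} and hence 2m+3 ≤ 2^{k+2}. The range of n thus
covers the moments 2m+1 of the kernel and 2m+3 of its derivative at once. -/
theorem IsUpperDoubling.exists_inv_moment_le (hω : IsUpperDoubling ω) :
    ∃ K : ℝ, 0 < K ∧ ∀ m n : ℕ, n ≤ 2 * m + 3 →
      1 / (2 * moment ω n) ≤ K * (1 / tail ω (node (Nat.log 2 (m + 1)))) := by
  obtain ⟨c, hc, h⟩ := hω.exists_le_moment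
  refine ⟨1 / (2 * c), by positivity, fun m n hn => ?_⟩
  have h1 : m + 1 < 2 ^ (Nat.log 2 (m + 1) + 1) := Nat.lt_pow_succ_log_self (by norm_num) _
  have h2 := h n (Nat.log 2 (m + 1)) (by rw [pow_succ] at h1 ⊢; rw [pow_succ]; omega)
  have h3 := hω.toIsRadialWeight.tail_node_pos (Nat.log 2 (m + 1))
  rw [one_div_mul_one_div]
  exact one_div_le_one_div_of_le (by positivity) (by linarith)

theorem IsUpperDoubling.summable_div_tail (hω : IsUpperDoubling ω) {s : ℝ} (hs0 : 0 ≤ s)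
    (hs1 : s < 1) : Summable fun m : ℕ => s ^ m / tail ω (node (Nat.log 2 (m + 1))) := by
  obtain ⟨K, -, h⟩ := hω.exists_tsum_div_tail_le
  obtain ⟨k, hk⟩ := exists_lt_node hs1
  exact (h k s hs0 (hk.le.trans (node_mono (Nat.le_succ k)))).1

theorem IsUpperDoubling.summable_kernelCoeff (hω : IsUpperDoubling ω) {s : ℝ} (hs0 : 0 ≤ s)
    (hs1 : s < 1) : Summable fun n => kernelCoeff ω n * s ^ n := by
  obtain ⟨K, hK, h⟩ := hω.exists_inv_moment_le
  refine Summable.of_nonneg_of_le (fun n => mul_nonneg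
    (hω.toIsRadialWeight.kernelCoeff_pos n).le (pow_nonneg hs0 n)) (fun n => ?_)
    ((hω.summable_div_tail hs0 hs1).mul_left K)
  have := h n (2 * n + 1) (by omega)
  calc kernelCoeff ω n * s ^ n ≤ K * (1 / tail ω (node (Nat.log 2 (n + 1)))) * s ^ n := by
        gcongr
        exact this
    _ = _ := by ring

theorem norm_lt_one_of_mem_disc {z : ℂ} (hz : z ∈ disc) : ‖z‖ < 1 := by simpa [disc] using hz

/-- For fixed a with |a| < 1 the series converges uniformly on the whole disc, so it is bounded and
lies in A²_ω. Termwise integration against f returns the Taylor series of f at a, because each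
monomial pairing is 2 ω_{2n+1} times a Taylor coefficient. -/
theorem IsUpperDoubling.isBergmanKernelAt (hω : IsUpperDoubling ω) {a : ℂ} (ha : a ∈ disc) :
    IsBergmanKernelAt ω a fun z => ∑' n, kernelCoeff ω n * conj a ^ n * z ^ n := by
  have ha1 := norm_lt_one_of_mem_disc ha
  have hω' := hω.toIsRadialWeight
  have hnorm : ∀ n, ‖(kernelCoeff ω n : ℂ) * conj a ^ n‖ = kernelCoeff ω n * ‖a‖ ^ n := fun n => by
    rw [norm_mul, norm_pow, RCLike.norm_conj, Complex.norm_real, Real.norm_eq_abs,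
      abs_of_pos (hω'.kernelCoeff_pos n)]
  have hsum := hω.summable_kernelCoeff (norm_nonneg a) ha1
  have hle : ∀ z ∈ disc, ∀ n, ‖(kernelCoeff ω n : ℂ) * conj a ^ n * z ^ n‖ ≤
      kernelCoeff ω n * ‖a‖ ^ n := fun z hz n => by
    rw [norm_mul, hnorm, norm_pow]
    refine mul_le_of_le_one_right ?_ (pow_le_one₀ (norm_nonneg z) (norm_lt_one_of_mem_disc hz).le)
    exact mul_nonneg (hω'.kernelCoeff_pos n).le (by positivity)
  refine ⟨hω'.memBergman_of_bounded (M := ∑' n, kernelCoeff ω n * ‖a‖ ^ n) ?_ ?_, ?_⟩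
  · refine differentiableOn_of_eq_tsum (c := fun n => kernelCoeff ω n * conj a ^ n) ?_
      fun z _ => rfl
    intro s hs0 hs1
    refine Summable.of_nonneg_of_le (fun n => by positivity) (fun n => ?_) hsum
    rw [hnorm]
    refine mul_le_of_le_one_right ?_ (pow_le_one₀ hs0 hs1.le)
    exact mul_nonneg (hω'.kernelCoeff_pos n).le (by positivity)
  · intro z hz
    exact tsum_of_norm_bounded hsum.hasSum (hle z hz)
  · intro f hf
    set G : ℕ → ℂ → ℂ := fun n z =>
      (kernelCoeff ω n * a ^ n : ℂ) * (f z * conj (z ^ n) * (ω ‖z‖ : ℂ)) with hG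
    have hGint : ∀ n, Integrable (G n) areaMeasure := fun n =>
      (hω'.integrable_mul_conj_pow hf n).const_mul _
    have hGI : ∀ n, ∫ z, G n z ∂areaMeasure = taylorCoeff f n * a ^ n := fun n => by
      simp only [hG]
      rw [integral_const_mul, hω'.integral_mul_conj_pow hf n]
      have : (moment ω (2 * n + 1) : ℂ) ≠ 0 := by
        exact_mod_cast (hω'.moment_pos (2 * n + 1)).ne'
      unfold kernelCoeff
      push_cast
      field_simp
    have hGsum : Summable fun n => ∫ z, ‖G n z‖ ∂areaMeasure := by
      refine Summable.of_nonneg_of_le (fun n => by positivity) (fun n => ?_)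
        (hsum.mul_right (∫ z, ‖f z * (ω ‖z‖ : ℂ)‖ ∂areaMeasure))
      rw [← integral_const_mul]
      refine integral_mono_ae (hGint n).norm ((hω'.integrable_norm_mul hf).norm.const_mul _) ?_
      filter_upwards [ae_mem_disc] with z hz
      have h1 : ‖z‖ ^ n ≤ 1 := pow_le_one₀ (norm_nonneg z) (norm_lt_one_of_mem_disc hz).le
      have h2 := (hω'.kernelCoeff_pos n).le
      simp only [hG, norm_mul, norm_pow, RCLike.norm_conj, Complex.norm_real, Real.norm_eq_abs,
        abs_of_nonneg h2]
      calc _ = kernelCoeff ω n * ‖a‖ ^ n * (‖f z‖ * |ω ‖z‖|) * ‖z‖ ^ n := by ring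
        _ ≤ _ := mul_le_of_le_one_right (by positivity) h1
    have h := hasSum_integral_of_summable_integral_norm hGint hGsum
    simp only [hGI] at h
    rw [(hasSum_taylorCoeff hf.1 ha).unique h]
    refine integral_congr_ae ?_
    filter_upwards [ae_mem_disc] with z hz
    have h3 : Summable fun n => (kernelCoeff ω n : ℂ) * conj a ^ n * z ^ n :=
      Summable.of_norm_bounded hsum (hle z hz)
    simp only [hG]
    rw [Complex.conj_tsum]
    rw [← tsum_mul_left, ← tsum_mul_right]
    refine tsum_congr fun n => ?_
    simp only [map_mul, map_pow, Complex.conj_conj, Complex.conj_ofReal]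
    ring

/-- The kernel is an unspecified choice, but its reproducing property applied to z^n determines its
n-th Taylor coefficient, hence its values on the disc. Values outside the disc stay arbitrary. -/
theorem IsUpperDoubling.bergmanKernel_eq (hω : IsUpperDoubling ω) {a z : ℂ} (ha : a ∈ disc)
    (hz : z ∈ disc) :
    bergmanKernel ω a z = ∑' n, kernelCoeff ω n * conj a ^ n * z ^ n := by
  have hω' := hω.toIsRadialWeight
  have hB : IsBergmanKernelAt ω a (bergmanKernel ω a) :=
    Classical.epsilon_spec (p := IsBergmanKernelAt ω a) ⟨_, hω.isBergmanKernelAt ha⟩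
  rw [← (hasSum_taylorCoeff hB.1.1 hz).tsum_eq]
  refine tsum_congr fun n => ?_
  congr 1
  have hmem : MemBergman ω 2 fun z => z ^ n :=
    hω'.memBergman_of_bounded (M := 1) (by fun_prop) fun w hw => by
      rw [norm_pow]
      exact pow_le_one₀ (norm_nonneg w) (norm_lt_one_of_mem_disc hw).le
  have h1 := hB.2 _ hmem
  have h2 := congrArg conj (hω'.integral_mul_conj_pow hB.1 n)
  rw [← integral_conj] at h2
  have h3 : ∀ ζ : ℂ, conj (bergmanKernel ω a ζ * conj (ζ ^ n) * (ω ‖ζ‖ : ℂ)) =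
      ζ ^ n * conj (bergmanKernel ω a ζ) * (ω ‖ζ‖ : ℂ) := fun ζ => by
    simp only [map_mul, map_pow, Complex.conj_conj, Complex.conj_ofReal]
    ring
  simp only [h3] at h2
  rw [← h1] at h2
  have h4 := congrArg conj h2
  rw [Complex.conj_conj] at h4
  have : (moment ω (2 * n + 1) : ℂ) ≠ 0 := by exact_mod_cast (hω'.moment_pos (2 * n + 1)).ne'
  rw [← map_pow, h4]
  unfold kernelCoeff
  push_cast
  field_simp

end

section


/-! ### Power series of the Hilbert-type operator -/

variable {ω : ℝ → ℝ}

/-- The moments `∫_0^1 f(t) t^n ω(t) dt`. -/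
def weightedMoment (ω : ℝ → ℝ) (f : ℝ → ℂ) (n : ℕ) : ℂ :=
  ∫ t, f t * (t : ℂ) ^ n * (ω t : ℂ) ∂unitMeasure

/-- The coefficients `1 / (2 (n+1) ω_{2n+1})`. -/
def hilbertCoeff (ω : ℝ → ℝ) (n : ℕ) : ℝ := kernelCoeff ω n / (n + 1)

theorem ae_unitMeasure_mem : ∀ᵐ t ∂unitMeasure, t ∈ Set.Ico (0 : ℝ) 1 :=
  ae_restrict_mem measurableSet_Ico

theorem IsRadialWeight.hilbertCoeff_pos (hω : IsRadialWeight ω) (n : ℕ) :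
    0 < hilbertCoeff ω n := by
  have := hω.kernelCoeff_pos n
  unfold hilbertCoeff
  positivity

theorem IsUpperDoubling.summable_hilbertCoeff (hω : IsUpperDoubling ω) {s : ℝ} (hs0 : 0 ≤ s)
    (hs1 : s < 1) : Summable fun n => hilbertCoeff ω n * s ^ n := by
  have hω' := hω.toIsRadialWeight
  refine Summable.of_nonneg_of_le (fun n => mul_nonneg (hω'.hilbertCoeff_pos n).le
    (pow_nonneg hs0 n)) (fun n => ?_) (hω.summable_kernelCoeff hs0 hs1)
  gcongr
  exact div_le_self (hω'.kernelCoeff_pos n).le (by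
    have : (0 : ℝ) ≤ n := n.cast_nonneg
    linarith)

/-- Termwise integration along the segment, where ∫_0^1 s^n ds supplies the factor 1/(n+1); the
series at |z| dominates. -/
theorem IsUpperDoubling.hilbertKernel_eq (hω : IsUpperDoubling ω) {t : ℝ}
    (ht : t ∈ Set.Ico (0 : ℝ) 1) {z : ℂ} (hz : z ∈ disc) :
    hilbertKernel ω t z = ∑' n, (hilbertCoeff ω n : ℂ) * (t * z) ^ n := by
  have hω' := hω.toIsRadialWeight
  have hz1 := norm_lt_one_of_mem_disc hz
  have hsum := hω.summable_kernelCoeff (norm_nonneg z) hz1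
  unfold hilbertKernel
  set G : ℕ → ℝ → ℂ := fun n s => ((kernelCoeff ω n : ℂ) * (t * z) ^ n) * ((s ^ n : ℝ) : ℂ) with hG
  have hGint : ∀ n, Integrable (G n) (volume.restrict (Set.Ioc (0 : ℝ) 1)) := fun n => by
    have : Continuous (G n) := by simp only [hG]; fun_prop
    exact (this.integrableOn_Icc).mono_set Set.Ioc_subset_Icc_self
  have hGle : ∀ n, ∀ s ∈ Set.Ioc (0 : ℝ) 1, ‖G n s‖ ≤ kernelCoeff ω n * ‖z‖ ^ n := fun n s hs => by
    have h1 : s ^ n ≤ 1 := pow_le_one₀ hs.1.le hs.2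
    have h2 : t ^ n ≤ 1 := pow_le_one₀ ht.1 ht.2.le
    have h3 := (hω'.kernelCoeff_pos n).le
    have h4 : 0 ≤ s ^ n := pow_nonneg hs.1.le n
    have h5 : 0 ≤ t ^ n := pow_nonneg ht.1 n
    simp only [hG, norm_mul, norm_pow, Complex.norm_real, Real.norm_eq_abs, abs_of_nonneg h3,
      abs_of_pos hs.1, abs_of_nonneg ht.1, mul_pow]
    calc kernelCoeff ω n * (t ^ n * ‖z‖ ^ n) * s ^ n
        ≤ kernelCoeff ω n * (1 * ‖z‖ ^ n) * 1 := by gcongr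
      _ = _ := by ring
  have hGsum : Summable fun n => ∫ s in Set.Ioc (0 : ℝ) 1, ‖G n s‖ := by
    refine Summable.of_nonneg_of_le (fun n => by positivity) (fun n => ?_) hsum
    calc ∫ s in Set.Ioc (0 : ℝ) 1, ‖G n s‖
        ≤ ∫ _ in Set.Ioc (0 : ℝ) 1, kernelCoeff ω n * ‖z‖ ^ n :=
          setIntegral_mono_on (hGint n).norm (integrable_const _) measurableSet_Ioc (hGle n)
      _ = _ := by simp
  have h := hasSum_integral_of_summable_integral_norm hGint hGsum
  rw [intervalIntegral.integral_of_le zero_le_one]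
  have e1 : ∫ s in Set.Ioc (0 : ℝ) 1, bergmanKernel ω t (s * z) =
      ∫ s in Set.Ioc (0 : ℝ) 1, ∑' n, G n s := by
    refine setIntegral_congr_fun measurableSet_Ioc fun s hs => ?_
    have hsz : (s : ℂ) * z ∈ disc := by
      simp only [disc, mem_ball_zero_iff, norm_mul, Complex.norm_real, Real.norm_eq_abs,
        abs_of_pos hs.1]
      exact lt_of_le_of_lt (mul_le_of_le_one_left (norm_nonneg z) hs.2) hz1
    rw [hω.bergmanKernel_eq (ofReal_mem_disc ht) hsz]
    refine tsum_congr fun n => ?_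
    simp only [hG, Complex.conj_ofReal]
    push_cast
    ring
  rw [e1, ← h.tsum_eq]
  refine tsum_congr fun n => ?_
  simp only [hG]
  rw [integral_const_mul, integral_complex_ofReal, ← intervalIntegral.integral_of_le zero_le_one,
    integral_pow, hilbertCoeff]
  push_cast
  simp
  ring

theorem norm_weightedMoment_le {f : ℝ → ℂ}
    (hf : Integrable (fun t => f t * (ω t : ℂ)) unitMeasure) (n : ℕ) :
    ‖weightedMoment ω f n‖ ≤ ∫ t, ‖f t * (ω t : ℂ)‖ ∂unitMeasure := by
  refine (norm_integral_le_integral_norm _).trans ?_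
  refine integral_mono_of_nonneg (Filter.Eventually.of_forall fun t => norm_nonneg _) hf.norm ?_
  filter_upwards [ae_unitMeasure_mem] with t ht
  have h1 : t ^ n ≤ 1 := pow_le_one₀ ht.1 ht.2.le
  simp only [norm_mul, norm_pow, Complex.norm_real, Real.norm_eq_abs, abs_of_nonneg ht.1]
  calc ‖f t‖ * t ^ n * |ω t| = ‖f t‖ * |ω t| * t ^ n := by ring
    _ ≤ _ := mul_le_of_le_one_right (by positivity) h1

/-- Superpositions of dilated power series with non-negative coefficients. -/
theorem integral_superposition {β : ℕ → ℝ} (hβ0 : ∀ n, 0 ≤ β n)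
    (hβ : ∀ s : ℝ, 0 ≤ s → s < 1 → Summable fun n => β n * s ^ n) {f : ℝ → ℂ}
    (hf : Integrable (fun t => f t * (ω t : ℂ)) unitMeasure) {z : ℂ} (hz : z ∈ disc) :
    Integrable (fun t => f t * (∑' n, (β n : ℂ) * (t * z) ^ n) * (ω t : ℂ)) unitMeasure ∧
    ∫ t, f t * (∑' n, (β n : ℂ) * (t * z) ^ n) * (ω t : ℂ) ∂unitMeasure =
      ∑' n, (β n : ℂ) * weightedMoment ω f n * z ^ n := by
  have hz1 := norm_lt_one_of_mem_disc hz
  have hsum := hβ ‖z‖ (norm_nonneg z) hz1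
  have hle : ∀ n, ∀ t ∈ Set.Ico (0 : ℝ) 1, ‖(β n : ℂ) * (t * z) ^ n‖ ≤ β n * ‖z‖ ^ n :=
    fun n t ht => by
    simp only [norm_mul, norm_pow, Complex.norm_real, Real.norm_eq_abs, abs_of_nonneg (hβ0 n),
      abs_of_nonneg ht.1, mul_pow]
    have h1 : t ^ n ≤ 1 := pow_le_one₀ ht.1 ht.2.le
    have := hβ0 n
    gcongr
    exact mul_le_of_le_one_left (by positivity) h1
  have hser : ContinuousOn (fun t : ℝ => ∑' n, (β n : ℂ) * (t * z) ^ n) (Set.Ico 0 1) :=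
    continuousOn_tsum (fun n => by fun_prop) hsum fun n t ht => hle n t ht
  have hint : Integrable (fun t => f t * (∑' n, (β n : ℂ) * (t * z) ^ n) * (ω t : ℂ))
      unitMeasure := by
    have e : (fun t => f t * (∑' n, (β n : ℂ) * (t * z) ^ n) * (ω t : ℂ)) =
        fun t : ℝ => (∑' n, (β n : ℂ) * (t * z) ^ n) * (f t * (ω t : ℂ)) := by
      ext t; ring
    rw [e]
    refine hf.bdd_mul (c := ∑' n, β n * ‖z‖ ^ n) (hser.aestronglyMeasurable measurableSet_Ico) ?_
    filter_upwards [ae_unitMeasure_mem] with t ht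
    exact tsum_of_norm_bounded hsum.hasSum fun n => hle n t ht
  refine ⟨hint, ?_⟩
  set G : ℕ → ℝ → ℂ := fun n t => ((β n : ℂ) * (t * z) ^ n) * (f t * (ω t : ℂ)) with hG
  have hGint : ∀ n, Integrable (G n) unitMeasure := fun n => by
    refine hf.bdd_mul (c := β n * ‖z‖ ^ n) (by fun_prop) ?_
    filter_upwards [ae_unitMeasure_mem] with t ht
    exact hle n t ht
  have hGsum : Summable fun n => ∫ t, ‖G n t‖ ∂unitMeasure := by
    refine Summable.of_nonneg_of_le (fun n => by positivity) (fun n => ?_)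
      (hsum.mul_right (∫ t, ‖f t * (ω t : ℂ)‖ ∂unitMeasure))
    rw [← integral_const_mul]
    refine integral_mono_ae (hGint n).norm (hf.norm.const_mul _) ?_
    filter_upwards [ae_unitMeasure_mem] with t ht
    simp only [hG]
    rw [norm_mul]
    gcongr
    exact hle n t ht
  have h := hasSum_integral_of_summable_integral_norm hGint hGsum
  have e1 : ∫ t, f t * (∑' n, (β n : ℂ) * (t * z) ^ n) * (ω t : ℂ) ∂unitMeasure =
      ∫ t, ∑' n, G n t ∂unitMeasure := by
    congr 1 with t
    simp only [hG]
    rw [tsum_mul_right]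
    ring
  rw [e1, ← h.tsum_eq]
  refine tsum_congr fun n => ?_
  simp only [hG, weightedMoment]
  rw [← integral_const_mul, ← integral_mul_const]
  congr 1 with t
  rw [mul_pow]
  ring

theorem IsUpperDoubling.hilbertIntegrand_ae_eq (hω : IsUpperDoubling ω) (f : ℝ → ℂ) {z : ℂ}
    (hz : z ∈ disc) : hilbertIntegrand ω f z =ᵐ[unitMeasure]
      fun t => f t * (∑' n, (hilbertCoeff ω n : ℂ) * (t * z) ^ n) * (ω t : ℂ) := by
  filter_upwards [ae_unitMeasure_mem] with t ht
  rw [hilbertIntegrand, hω.hilbertKernel_eq ht hz]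

theorem IsUpperDoubling.hilbertOpDefined (hω : IsUpperDoubling ω) {f : ℝ → ℂ}
    (hf : Integrable (fun t => f t * (ω t : ℂ)) unitMeasure) : HilbertOpDefined ω f := fun _ hz =>
  (integral_superposition (fun n => (hω.toIsRadialWeight.hilbertCoeff_pos n).le)
    (fun _ => hω.summable_hilbertCoeff) hf hz).1.congr (hω.hilbertIntegrand_ae_eq f hz).symm

theorem IsUpperDoubling.hilbertOp_eq (hω : IsUpperDoubling ω) {f : ℝ → ℂ}
    (hf : Integrable (fun t => f t * (ω t : ℂ)) unitMeasure) {z : ℂ} (hz : z ∈ disc) :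
    hilbertOp ω f z = ∑' n, (hilbertCoeff ω n : ℂ) * weightedMoment ω f n * z ^ n := by
  rw [hilbertOp, integral_congr_ae (hω.hilbertIntegrand_ae_eq f hz)]
  exact (integral_superposition (fun n => (hω.toIsRadialWeight.hilbertCoeff_pos n).le)
    (fun _ => hω.summable_hilbertCoeff) hf hz).2

theorem IsUpperDoubling.summable_hilbertOp (hω : IsUpperDoubling ω) {f : ℝ → ℂ}
    (hf : Integrable (fun t => f t * (ω t : ℂ)) unitMeasure) (s : ℝ) (hs0 : 0 ≤ s) (hs1 : s < 1) :
    Summable fun n => ‖(hilbertCoeff ω n : ℂ) * weightedMoment ω f n‖ * s ^ n := by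
  refine Summable.of_nonneg_of_le (fun n => by positivity) (fun n => ?_)
    ((hω.summable_hilbertCoeff hs0 hs1).mul_right (∫ t, ‖f t * (ω t : ℂ)‖ ∂unitMeasure))
  have h1 := (hω.toIsRadialWeight.hilbertCoeff_pos n).le
  rw [norm_mul, Complex.norm_real, Real.norm_eq_abs, abs_of_nonneg h1, mul_right_comm]
  gcongr
  exact norm_weightedMoment_le hf n

theorem IsUpperDoubling.differentiableOn_hilbertOp (hω : IsUpperDoubling ω) {f : ℝ → ℂ}
    (hf : Integrable (fun t => f t * (ω t : ℂ)) unitMeasure) :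
    DifferentiableOn ℂ (hilbertOp ω f) disc :=
  differentiableOn_of_eq_tsum (hω.summable_hilbertOp hf) fun _ hz => hω.hilbertOp_eq hf hz

theorem IsUpperDoubling.taylorCoeff_hilbertOp (hω : IsUpperDoubling ω) {f : ℝ → ℂ}
    (hf : Integrable (fun t => f t * (ω t : ℂ)) unitMeasure) (n : ℕ) :
    taylorCoeff (hilbertOp ω f) n = hilbertCoeff ω n * weightedMoment ω f n :=
  taylorCoeff_of_eq_tsum (hω.summable_hilbertOp hf) (fun _ hz => hω.hilbertOp_eq hf hz) n

theorem IsUpperDoubling.hilbertOp_zero (hω : IsUpperDoubling ω) {f : ℝ → ℂ}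
    (hf : Integrable (fun t => f t * (ω t : ℂ)) unitMeasure) :
    hilbertOp ω f 0 = hilbertCoeff ω 0 * weightedMoment ω f 0 :=
  apply_zero_of_eq_tsum fun _ hz => hω.hilbertOp_eq hf hz

/-! ### The derivative of H_ω(f) -/

/-- The coefficients of the derivative of the Hilbert kernel. -/
def derivCoeff (ω : ℝ → ℝ) (n : ℕ) : ℝ :=
  ((n + 1 : ℝ) / (n + 2)) * (1 / (2 * moment ω (2 * n + 3)))

theorem IsRadialWeight.derivCoeff_nonneg (hω : IsRadialWeight ω) (n : ℕ) :
    0 ≤ derivCoeff ω n := by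
  have := hω.moment_pos (2 * n + 3)
  unfold derivCoeff
  positivity

/-- Both factors increase: (n+1)/(n+2), and the inverse of a decreasing moment. This monotonicity is
what makes summation by parts effective. -/
theorem IsRadialWeight.derivCoeff_mono (hω : IsRadialWeight ω) (n : ℕ) :
    derivCoeff ω n ≤ derivCoeff ω (n + 1) := by
  have h1 := hω.moment_pos (2 * n + 3)
  have h2 := hω.moment_pos (2 * (n + 1) + 3)
  have h3 : moment ω (2 * (n + 1) + 3) ≤ moment ω (2 * n + 3) := hω.moment_anti (by omega)
  unfold derivCoeff
  push_cast
  gcongr ?_ * ?_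
  · rw [div_le_div_iff₀ (by positivity) (by positivity)]
    ring_nf
    linarith
  · exact one_div_le_one_div_of_le (by positivity) (by linarith)

theorem derivCoeff_eq (ω : ℝ → ℝ) (n : ℕ) :
    (n + 1 : ℝ) * hilbertCoeff ω (n + 1) = derivCoeff ω n := by
  unfold derivCoeff hilbertCoeff kernelCoeff
  push_cast
  have e : 2 * (n + 1) + 1 = 2 * n + 3 := by ring
  rw [e]
  have : (n : ℝ) + 1 + 1 = n + 2 := by ring
  rw [this]
  ring

theorem IsUpperDoubling.exists_tsum_derivCoeff_le (hω : IsUpperDoubling ω) :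
    ∃ K : ℝ, 0 < K ∧ ∀ (k : ℕ) (s : ℝ), 0 ≤ s → s ≤ node (k + 1) →
      Summable (fun m : ℕ => derivCoeff ω m * s ^ m) ∧
      ∑' m : ℕ, derivCoeff ω m * s ^ m ≤ K * 2 ^ k / tail ω (node k) := by
  obtain ⟨K, hK, h⟩ := hω.exists_tsum_div_tail_le
  obtain ⟨K', hK', h'⟩ := hω.exists_inv_moment_le
  refine ⟨K' * K, by positivity, fun k s hs0 hs => ?_⟩
  obtain ⟨h1, h2⟩ := h k s hs0 hs
  have hle : ∀ m : ℕ, derivCoeff ω m * s ^ m ≤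
      K' * (s ^ m / tail ω (node (Nat.log 2 (m + 1)))) := fun m => by
    have h3 : derivCoeff ω m ≤ 1 / (2 * moment ω (2 * m + 3)) := by
      unfold derivCoeff
      have := hω.toIsRadialWeight.moment_pos (2 * m + 3)
      refine mul_le_of_le_one_left (by positivity) ?_
      rw [div_le_one (by positivity)]
      linarith
    calc derivCoeff ω m * s ^ m
        ≤ (K' * (1 / tail ω (node (Nat.log 2 (m + 1))))) * s ^ m := by
          gcongr
          exact h3.trans (h' m _ le_rfl)
      _ = _ := by ring
  have hs := Summable.of_nonneg_of_le (fun m => mul_nonneg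
    (hω.toIsRadialWeight.derivCoeff_nonneg m) (pow_nonneg hs0 m)) hle (h1.mul_left K')
  refine ⟨hs, (hs.tsum_le_tsum hle (h1.mul_left K')).trans ?_⟩
  rw [tsum_mul_left, mul_assoc, mul_div_assoc]
  gcongr

/-- Summation by parts for power series with increasing coefficients. -/
theorem one_sub_mul_tsum {𝕜 : Type*} [NormedField 𝕜] [CompleteSpace 𝕜] {b : ℕ → 𝕜} {z : 𝕜}
    (h : Summable fun n => b n * z ^ n) :
    (1 - z) * ∑' n, b n * z ^ n = b 0 + ∑' n, (b (n + 1) - b n) * z ^ (n + 1) := by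
  have h1 : Summable fun n => b (n + 1) * z ^ (n + 1) :=
    (summable_nat_add_iff (f := fun n => b n * z ^ n) 1).2 h
  have h2 : Summable fun n => b n * z ^ (n + 1) := by
    refine (h.mul_left z).congr fun n => ?_
    ring
  have e1 : ∑' n, b n * z ^ n = b 0 + ∑' n, b (n + 1) * z ^ (n + 1) := by
    rw [h.tsum_eq_zero_add]
    simp
  have e2 : z * ∑' n, b n * z ^ n = ∑' n, b n * z ^ (n + 1) := by
    rw [← tsum_mul_left]
    refine tsum_congr fun n => ?_
    ring
  rw [sub_mul, one_mul, e2, e1, add_sub_assoc, ← h1.tsum_sub h2]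
  congr 2 with n
  ring

/-- After summation by parts the coefficients are b_0 and b_{n+1} - b_n, all non-negative, so the
triangle inequality bounds the series by its value at s, where summation by parts is undone. The
naive estimate would have |1-z| in place of the smaller 1-s. -/
theorem norm_one_sub_mul_tsum_le {b : ℕ → ℝ} (hb0 : 0 ≤ b 0) (hb : ∀ n, b n ≤ b (n + 1))
    {s : ℝ} (hs : Summable fun n => b n * s ^ n) {z : ℂ} (hz : ‖z‖ ≤ s) :
    ‖(1 - z) * ∑' n, (b n : ℂ) * z ^ n‖ ≤ (1 - s) * ∑' n, b n * s ^ n := by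
  have hbn : ∀ n, 0 ≤ b n := fun n => by
    induction n with
    | zero => exact hb0
    | succ n ih => exact ih.trans (hb n)
  have hzs : Summable fun n => (b n : ℂ) * z ^ n := by
    refine Summable.of_norm_bounded hs fun n => ?_
    rw [norm_mul, norm_pow, Complex.norm_real, Real.norm_eq_abs, abs_of_nonneg (hbn n)]
    have := hbn n
    gcongr
  have hd : Summable fun n => (b (n + 1) - b n) * s ^ (n + 1) := by
    have h1 : Summable fun n => b (n + 1) * s ^ (n + 1) :=
      (summable_nat_add_iff (f := fun n => b n * s ^ n) 1).2 hs
    refine (h1.sub (hs.mul_left s)).congr fun n => ?_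
    ring
  rw [one_sub_mul_tsum hzs, one_sub_mul_tsum hs]
  refine (norm_add_le _ _).trans ?_
  gcongr
  · rw [Complex.norm_real, Real.norm_eq_abs, abs_of_nonneg hb0]
  · refine tsum_of_norm_bounded hd.hasSum fun n => ?_
    rw [norm_mul, norm_pow, ← Complex.ofReal_sub, Complex.norm_real, Real.norm_eq_abs,
      abs_of_nonneg (sub_nonneg.2 (hb n))]
    have := sub_nonneg.2 (hb n)
    gcongr

/-- At s = r_{i+1} the factor 1-s = 2^{-(i+1)} cancels the growth 2^i of the series with positive
coefficients. This recovers the size 1/|1-w| of the kernel off the radius. -/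
theorem IsUpperDoubling.exists_norm_derivSeries_le (hω : IsUpperDoubling ω) :
    ∃ K : ℝ, 0 < K ∧ ∀ (i : ℕ) (w : ℂ), ‖w‖ ≤ node (i + 1) →
      ‖∑' n, (derivCoeff ω n : ℂ) * w ^ n‖ * ‖1 - w‖ ≤ K / tail ω (node i) := by
  obtain ⟨K, hK, h⟩ := hω.exists_tsum_derivCoeff_le
  have hω' := hω.toIsRadialWeight
  refine ⟨K, hK, fun i w hw => ?_⟩
  obtain ⟨h1, h2⟩ := h i (node (i + 1)) (node_nonneg _) le_rfl
  have h3 := norm_one_sub_mul_tsum_le (hω'.derivCoeff_nonneg 0) hω'.derivCoeff_mono h1 hw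
  rw [norm_mul, mul_comm, one_sub_node] at h3
  refine h3.trans ?_
  have hτ := hω'.tail_node_pos i
  calc (1 / 2) ^ (i + 1) * ∑' m : ℕ, derivCoeff ω m * node (i + 1) ^ m
      ≤ (1 / 2) ^ (i + 1) * (K * 2 ^ i / tail ω (node i)) := by gcongr
    _ = (K / 2) / tail ω (node i) := by
        rw [one_div_pow, pow_succ]
        field_simp
    _ ≤ _ := by
        gcongr
        linarith

/-- Both sides are power series: the extra factor t shifts the moments of f by one, and
differentiation turns `hilbertCoeff` into `derivCoeff`. -/
theorem IsUpperDoubling.deriv_hilbertOp_eq (hω : IsUpperDoubling ω) {f : ℝ → ℂ}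
    (hf : Integrable (fun t => f t * (ω t : ℂ)) unitMeasure) {z : ℂ} (hz : z ∈ disc) :
    deriv (hilbertOp ω f) z =
      ∫ t, (f t * t) * (∑' n, (derivCoeff ω n : ℂ) * (t * z) ^ n) * (ω t : ℂ) ∂unitMeasure := by
  have hω' := hω.toIsRadialWeight
  obtain ⟨K, -, hK⟩ := hω.exists_tsum_derivCoeff_le
  have hft : Integrable (fun t : ℝ => (f t * t) * (ω t : ℂ)) unitMeasure := by
    have e : (fun t : ℝ => (f t * t) * (ω t : ℂ)) = fun t : ℝ => (t : ℂ) * (f t * (ω t : ℂ)) := by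
      ext t; ring
    rw [e]
    refine hf.bdd_mul (c := 1) (by fun_prop) ?_
    filter_upwards [ae_unitMeasure_mem] with t ht
    rw [Complex.norm_real, Real.norm_eq_abs, abs_of_nonneg ht.1]
    exact ht.2.le
  rw [(integral_superposition hω'.derivCoeff_nonneg (fun s hs0 hs1 => by
    obtain ⟨k, hk⟩ := exists_lt_node hs1
    exact (hK k s hs0 (hk.le.trans (node_mono (Nat.le_succ k)))).1) hft hz).2,
    ← (hasSum_deriv (hω.differentiableOn_hilbertOp hf) hz).tsum_eq]
  refine tsum_congr fun n => ?_
  rw [hω.taylorCoeff_hilbertOp hf, ← derivCoeff_eq]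
  have e : weightedMoment ω (fun t => f t * t) n = weightedMoment ω f (n + 1) := by
    unfold weightedMoment
    congr 1 with t
    ring
  rw [e]
  push_cast
  ring

/-- The basic pointwise bound of the derivative of `H_ω(f)`. -/
theorem IsUpperDoubling.exists_enorm_deriv_le (hω : IsUpperDoubling ω) :
    ∃ K : ℝ≥0∞, K ≠ ∞ ∧ ∀ f : ℝ → ℂ, AEStronglyMeasurable f unitMeasure →
      Integrable (fun t => f t * (ω t : ℂ)) unitMeasure →
      ∀ (k : ℕ) (r θ : ℝ), 0 ≤ r → r < node (k + 1) → θ ∈ Set.Ico 0 (2 * Real.pi) →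
      ‖deriv (hilbertOp ω f) (circleMap 0 r θ)‖ₑ ≤ K * ∑ j ∈ Finset.range (k + 1),
        ENNReal.ofReal (1 / ((1 / 2) ^ j + angle θ)) * tailAverage ω f j := by
  obtain ⟨K, hK, h⟩ := hω.exists_norm_derivSeries_le
  have hω' := hω.toIsRadialWeight
  refine ⟨ENNReal.ofReal (10 * K), ENNReal.ofReal_ne_top, ?_⟩
  intro f hfm hf k r θ hr0 hrk hθ
  have hr1 : r < 1 := hrk.trans (node_lt_one _)
  rw [hω.deriv_hilbertOp_eq hf (circleMap_mem_disc hr0 hr1 θ), Finset.mul_sum]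
  simp_rw [← mul_assoc (ENNReal.ofReal (10 * K))]
  -- The sum of tail averages is written as an integral over t, so that it suffices to bound the
  -- integrand pointwise.
  rw [← lintegral_mul_sum_indicator hω' hfm (Finset.range (k + 1)) fun j =>
    ENNReal.ofReal (10 * K) * ENNReal.ofReal (1 / ((1 / 2) ^ j + angle θ))]
  refine (enorm_integral_le_lintegral_enorm _).trans ?_
  refine lintegral_mono_ae ?_
  filter_upwards [ae_unitMeasure_mem] with t ht
  have hωt := hω'.nonneg t ht
  -- The index is capped at k: for t ≥ r_k it is r < r_{k+1}, and otherwise t < r_{i+1}, that keeps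
  -- rt below r_{i+1}.
  obtain ⟨i, hik, hit, hi⟩ := exists_node_le ht.1 k
  have hrt0 : 0 ≤ r * t := mul_nonneg hr0 ht.1
  have hrt : r * t < node (i + 1) := by
    rcases hi with rfl | hi
    · exact lt_of_le_of_lt (mul_le_of_le_one_right hr0 ht.2.le) hrk
    · exact lt_of_le_of_lt (mul_le_of_le_one_left ht.1 hr1.le) hi
  have hw : (t : ℂ) * circleMap 0 r θ = ((r * t : ℝ) : ℂ) * Complex.exp (θ * Complex.I) := by
    simp [circleMap]; ring
  have hwn : ‖(t : ℂ) * circleMap 0 r θ‖ = r * t := by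
    rw [hw, norm_mul, Complex.norm_exp_ofReal_mul_I, mul_one, Complex.norm_real, Real.norm_eq_abs,
      abs_of_nonneg hrt0]
  have h1 := h i (t * circleMap 0 r θ) (by rw [hwn]; exact hrt.le)
  have h2 := one_sub_add_angle_le_norm_one_sub hrt0 (hrt.trans (node_lt_one _)).le hθ
  rw [← hw] at h2
  have ha := angle_nonneg hθ
  have hτ := hω'.tail_node_pos i
  set S := ‖∑' n, (derivCoeff ω n : ℂ) * (t * circleMap 0 r θ) ^ n‖ with hS
  have hhalf : (1 / 2 : ℝ) ^ i ≤ 2 * (1 - r * t) := by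
    unfold node at hrt
    rw [pow_succ] at hrt
    linarith
  have hipos : (0 : ℝ) < (1 / 2) ^ i := by positivity
  have h3 : S ≤ 10 * K * (1 / ((1 / 2) ^ i + angle θ)) / tail ω (node i) := by
    -- 10 = 2·5: a factor 2 from 2^{-i} ≤ 2(1-rt), and 5 from comparing |1-tz| with (1-rt) + |θ|.
    have h4 : (1 / 2) ^ i + angle θ ≤ 10 * ‖1 - (t : ℂ) * circleMap 0 r θ‖ := by linarith
    have h5 : S * ((1 / 2) ^ i + angle θ) ≤ 10 * (K / tail ω (node i)) := by
      calc S * ((1 / 2) ^ i + angle θ) ≤ S * (10 * ‖1 - (t : ℂ) * circleMap 0 r θ‖) := by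
            gcongr
        _ = 10 * (S * ‖1 - (t : ℂ) * circleMap 0 r θ‖) := by ring
        _ ≤ _ := by gcongr
    rw [mul_one_div, div_right_comm, le_div_iff₀ (by positivity)]
    linarith [mul_div_assoc 10 K (tail ω (node i))]
  calc ‖f t * t * (∑' n, (derivCoeff ω n : ℂ) * (t * circleMap 0 r θ) ^ n) * (ω t : ℂ)‖ₑ
      = ‖f t‖ₑ * ENNReal.ofReal (ω t) * (ENNReal.ofReal t * ENNReal.ofReal S) := by
        have e1 : ‖(t : ℂ)‖ₑ = ENNReal.ofReal t := by
          rw [← ofReal_norm, Complex.norm_real, Real.norm_eq_abs, abs_of_nonneg ht.1]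
        have e2 : ‖(ω t : ℂ)‖ₑ = ENNReal.ofReal (ω t) := by
          rw [← ofReal_norm, Complex.norm_real, Real.norm_eq_abs, abs_of_nonneg hωt]
        rw [enorm_mul, enorm_mul, enorm_mul, e1, e2, hS, ofReal_norm]
        ring
    _ ≤ ‖f t‖ₑ * ENNReal.ofReal (ω t) * (Set.Ico (node i) 1).indicator (fun _ =>
          ENNReal.ofReal (10 * K) * ENNReal.ofReal (1 / ((1 / 2) ^ i + angle θ)) /
            ENNReal.ofReal (tail ω (node i))) t := by
        gcongr
        rw [Set.indicator_of_mem (Set.mem_Ico.2 ⟨hit, ht.2⟩),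
          ← ENNReal.ofReal_mul (p := 10 * K) (by positivity), ← ENNReal.ofReal_div_of_pos hτ]
        refine le_trans (mul_le_of_le_one_left' ?_) (ENNReal.ofReal_le_ofReal h3)
        rw [← ENNReal.ofReal_one]
        exact ENNReal.ofReal_le_ofReal ht.2.le
    _ ≤ _ := by
        gcongr
        exact Finset.single_le_sum (f := fun j => (Set.Ico (node j) 1).indicator (fun _ =>
          ENNReal.ofReal (10 * K) * ENNReal.ofReal (1 / ((1 / 2) ^ j + angle θ)) /
            ENNReal.ofReal (tail ω (node j))) t) (fun _ _ => bot_le)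
          (Finset.mem_range.2 (Nat.lt_succ_of_le hik))

end

section


/-! ### Upper bounds of the norms of `H_ω(f)` -/

variable {ω : ℝ → ℝ}

/-- The dyadic energy `∑ 2^{-k} h_k^p` of the tail averages of `|f|`. -/
def dyadicEnergy (ω : ℝ → ℝ) (p : ℝ) (f : ℝ → ℂ) : ℝ≥0∞ :=
  ∑' k, 2⁻¹ ^ k * tailAverage ω f k ^ p

theorem tailAverage_zero_rpow_le (ω : ℝ → ℝ) (p : ℝ) (f : ℝ → ℂ) :
    tailAverage ω f 0 ^ p ≤ dyadicEnergy ω p f := by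
  have := ENNReal.le_tsum (f := fun k => 2⁻¹ ^ k * tailAverage ω f k ^ p) 0
  unfold dyadicEnergy
  simpa using this

theorem IsRadialWeight.enorm_weightedMoment_le (hω : IsRadialWeight ω) (f : ℝ → ℂ) (n : ℕ) :
    ‖weightedMoment ω f n‖ₑ ≤
      ∫⁻ t, (‖f t‖ₑ * ENNReal.ofReal (ω t)) * ENNReal.ofReal (t ^ n) ∂unitMeasure := by
  refine (enorm_integral_le_lintegral_enorm _).trans (lintegral_mono_ae ?_)
  filter_upwards [ae_unitMeasure_mem] with t ht
  rw [enorm_mul, enorm_mul, ← ofReal_norm (ω t : ℂ), ← ofReal_norm ((t : ℂ) ^ n), norm_pow,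
    Complex.norm_real, Complex.norm_real, Real.norm_eq_abs, Real.norm_eq_abs, abs_of_nonneg ht.1,
    abs_of_nonneg (hω.nonneg t ht)]
  exact le_of_eq (by ring)

theorem IsUpperDoubling.exists_enorm_hilbertOp_zero_le (hω : IsUpperDoubling ω) :
    ∃ K : ℝ≥0∞, K ≠ ∞ ∧ ∀ f : ℝ → ℂ, AEStronglyMeasurable f unitMeasure →
      Integrable (fun t => f t * (ω t : ℂ)) unitMeasure →
      ‖hilbertOp ω f 0‖ₑ ≤ K * tailAverage ω f 0 := by
  obtain ⟨K, hK, h⟩ := hω.exists_lintegral_pow_le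
  have hω' := hω.toIsRadialWeight
  refine ⟨ENNReal.ofReal (hilbertCoeff ω 0) * (K * ENNReal.ofReal (tail ω (node 0))),
    by finiteness, fun f hfm hf => ?_⟩
  rw [hω.hilbertOp_zero hf, enorm_mul, ← ofReal_norm (hilbertCoeff ω 0 : ℂ), Complex.norm_real,
    Real.norm_eq_abs, abs_of_pos (hω'.hilbertCoeff_pos 0), mul_assoc]
  gcongr
  refine (hω'.enorm_weightedMoment_le f 0).trans ((h f hfm 0 0 (by norm_num)).trans ?_)
  simp

theorem log_eq_iff_mem_Ico (n k : ℕ) :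
    Nat.log 2 (n + 1) = k ↔ n ∈ Finset.Ico (2 ^ k - 1) (2 ^ (k + 1) - 1) := by
  have h1 : 0 < 2 ^ k := by positivity
  rw [Nat.log_eq_iff (Or.inr ⟨by norm_num, by omega⟩), Finset.mem_Ico]
  omega

/-- The blocks are cut according to n+1 rather than n, so that n = 0 belongs to block 0 and block k
has exactly 2^k elements. -/
theorem tsum_eq_tsum_dyadic_blocks (φ : ℕ → ℝ≥0∞) :
    ∑' n, φ n = ∑' k, ∑ n ∈ Finset.Ico (2 ^ k - 1) (2 ^ (k + 1) - 1), φ n := by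
  calc ∑' n, φ n = ∑' n, ∑' k, (if Nat.log 2 (n + 1) = k then φ n else 0) := by
        refine tsum_congr fun n => ?_
        rw [tsum_eq_single (Nat.log 2 (n + 1)) (fun k hk => by rw [if_neg (Ne.symm hk)]),
          if_pos rfl]
    _ = ∑' k, ∑' n, (if Nat.log 2 (n + 1) = k then φ n else 0) := ENNReal.tsum_comm
    _ = _ := by
        refine tsum_congr fun k => ?_
        rw [tsum_eq_sum (s := Finset.Ico (2 ^ k - 1) (2 ^ (k + 1) - 1))]
        · refine Finset.sum_congr rfl fun n hn => ?_
          rw [if_pos ((log_eq_iff_mem_Ico n k).2 hn)]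
        · intro n hn
          rw [if_neg fun h => hn ((log_eq_iff_mem_Ico n k).1 h)]

theorem card_dyadic_block (k : ℕ) :
    (Finset.Ico (2 ^ k - 1) (2 ^ (k + 1) - 1)).card = 2 ^ k := by
  have h1 : 0 < 2 ^ k := by positivity
  rw [Nat.card_Ico, pow_succ]
  omega

/-- Once the factor 1/(n+1) of the coefficients is taken out, the weight leaves (n+1)^{-2} whatever
p is; on block k this is about 4^{-k}, against 2^k terms. -/
theorem natCast_add_one_rpow (p : ℝ) (n : ℕ) (x : ℝ≥0∞) (hp : 0 < p) :
    (x / ((n : ℝ≥0∞) + 1)) ^ p * ((n : ℝ≥0∞) + 1) ^ (p - 2) =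
      x ^ p * (((n : ℝ≥0∞) + 1)⁻¹ * ((n : ℝ≥0∞) + 1)⁻¹) := by
  have h0 : (n : ℝ≥0∞) + 1 ≠ 0 := by simp
  have ht : (n : ℝ≥0∞) + 1 ≠ ∞ := by finiteness
  rw [ENNReal.div_rpow_of_nonneg _ _ hp.le, div_eq_mul_inv, mul_assoc, ← ENNReal.rpow_neg,
    ← ENNReal.rpow_add _ _ h0 ht]
  congr 1
  have e : -p + (p - 2) = -1 + -1 := by ring
  rw [e, ENNReal.rpow_add _ _ h0 ht, ENNReal.rpow_neg_one]

/-- On block k the factor ω̂(r_k) in the bound of the moments of f cancels the one in the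
coefficient, so |a_n| ≲ (h_0+…+h_k)/(n+1). Summing over blocks leaves `tsum_sum_range_le`; the decay
2^{-(k-j)} of the moment bound can be discarded. -/
theorem IsUpperDoubling.exists_hardyLittlewoodNorm_le (hω : IsUpperDoubling ω) {p q : ℝ}
    (hpq : p.HolderConjugate q) :
    ∃ C : ℝ≥0∞, C ≠ ∞ ∧ ∀ f : ℝ → ℂ, AEStronglyMeasurable f unitMeasure →
      Integrable (fun t => f t * (ω t : ℂ)) unitMeasure →
      hardyLittlewoodNorm p (hilbertOp ω f) ≤ C * dyadicEnergy ω p f ^ (1 / p) := by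
  have hp := hpq.pos
  have hω' := hω.toIsRadialWeight
  obtain ⟨K, hK, h⟩ := hω.exists_lintegral_pow_le
  obtain ⟨K', hK', h'⟩ := hω.exists_inv_moment_le
  refine ⟨((ENNReal.ofReal K' * K) ^ p * hilbertConst p q) ^ (1 / p), ?_, fun f hfm hf => ?_⟩
  · have := hilbertConst_ne_top hpq
    exact ENNReal.rpow_ne_top_of_nonneg (by positivity) (ENNReal.mul_ne_top
      (ENNReal.rpow_ne_top_of_nonneg hp.le (by finiteness)) this)
  have hcoef : ∀ n, ‖taylorCoeff (hilbertOp ω f) n‖ₑ ≤ ENNReal.ofReal K' * K *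
      (∑ j ∈ Finset.range (Nat.log 2 (n + 1) + 1), tailAverage ω f j) / ((n : ℝ≥0∞) + 1) := by
    intro n
    set k := Nat.log 2 (n + 1) with hk
    have hτ := hω'.tail_node_pos k
    have h1 : hilbertCoeff ω n ≤ K' / tail ω (node k) / (n + 1) := by
      unfold hilbertCoeff kernelCoeff
      gcongr ?_ / _
      have := h' n (2 * n + 1) (by omega)
      rwa [mul_one_div] at this
    have h2 : ENNReal.ofReal (hilbertCoeff ω n) ≤
        ENNReal.ofReal K' / ENNReal.ofReal (tail ω (node k)) / ((n : ℝ≥0∞) + 1) := by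
      refine (ENNReal.ofReal_le_ofReal h1).trans ?_
      rw [ENNReal.ofReal_div_of_pos (by positivity), ENNReal.ofReal_div_of_pos hτ,
        ENNReal.ofReal_add (by positivity) (by norm_num), ENNReal.ofReal_natCast,
        ENNReal.ofReal_one]
    have h3 : ‖weightedMoment ω f n‖ₑ ≤ K * ENNReal.ofReal (tail ω (node k)) *
        ∑ j ∈ Finset.range (k + 1), tailAverage ω f j := by
      refine (hω'.enorm_weightedMoment_le f n).trans ((h f hfm n k
        (Nat.pow_log_le_self 2 (by omega))).trans ?_)
      gcongr with j
      exact mul_le_of_le_one_left' (pow_le_one₀ (by positivity) (by norm_num))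
    rw [hω.taylorCoeff_hilbertOp hf, enorm_mul, ← ofReal_norm (hilbertCoeff ω n : ℂ),
      Complex.norm_real, Real.norm_eq_abs, abs_of_pos (hω'.hilbertCoeff_pos n)]
    refine (mul_le_mul' h2 h3).trans (le_of_eq ?_)
    simp only [div_eq_mul_inv]
    have hc : (ENNReal.ofReal (tail ω (node k)))⁻¹ * ENNReal.ofReal (tail ω (node k)) = 1 :=
      ENNReal.inv_mul_cancel (by simpa using hτ) ENNReal.ofReal_ne_top
    calc _ = ENNReal.ofReal K' * K * (∑ j ∈ Finset.range (k + 1), tailAverage ω f j) *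
          ((n : ℝ≥0∞) + 1)⁻¹ * ((ENNReal.ofReal (tail ω (node k)))⁻¹ *
            ENNReal.ofReal (tail ω (node k))) := by ring
      _ = _ := by rw [hc, mul_one]
  unfold hardyLittlewoodNorm
  rw [← ENNReal.mul_rpow_of_nonneg _ _ (by positivity)]
  gcongr
  set S : ℕ → ℝ≥0∞ := fun k => ∑ j ∈ Finset.range (k + 1), tailAverage ω f j with hS
  calc ∑' n : ℕ, ‖taylorCoeff (hilbertOp ω f) n‖ₑ ^ p * ((n : ℝ≥0∞) + 1) ^ (p - 2)
      ≤ ∑' n : ℕ, (ENNReal.ofReal K' * K * S (Nat.log 2 (n + 1))) ^ p *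
          (((n : ℝ≥0∞) + 1)⁻¹ * ((n : ℝ≥0∞) + 1)⁻¹) := by
        refine ENNReal.tsum_le_tsum fun n => ?_
        rw [← natCast_add_one_rpow p n _ hp]
        gcongr
        exact hcoef n
    _ = ∑' k, ∑ n ∈ Finset.Ico (2 ^ k - 1) (2 ^ (k + 1) - 1),
          (ENNReal.ofReal K' * K * S (Nat.log 2 (n + 1))) ^ p *
          (((n : ℝ≥0∞) + 1)⁻¹ * ((n : ℝ≥0∞) + 1)⁻¹) := tsum_eq_tsum_dyadic_blocks _
    _ ≤ ∑' k, ∑ n ∈ Finset.Ico (2 ^ k - 1) (2 ^ (k + 1) - 1),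
          (ENNReal.ofReal K' * K * S k) ^ p * (2⁻¹ ^ k * 2⁻¹ ^ k) := by
        refine ENNReal.tsum_le_tsum fun k => Finset.sum_le_sum fun n hn => ?_
        have hnk := (log_eq_iff_mem_Ico n k).2 hn
        have h1 : ((n : ℝ≥0∞) + 1)⁻¹ ≤ 2⁻¹ ^ k := by
          rw [ENNReal.inv_pow.symm]
          refine ENNReal.inv_le_inv.2 ?_
          have : 2 ^ k ≤ n + 1 := by rw [← hnk]; exact Nat.pow_log_le_self 2 (by omega)
          exact_mod_cast this
        rw [hnk]
        gcongr
    _ = ∑' k, (ENNReal.ofReal K' * K) ^ p * (2⁻¹ ^ k * S k ^ p) := by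
        refine tsum_congr fun k => ?_
        rw [Finset.sum_const, card_dyadic_block, nsmul_eq_mul,
          ENNReal.mul_rpow_of_nonneg _ _ hp.le]
        have h2 : ((2 ^ k : ℕ) : ℝ≥0∞) * 2⁻¹ ^ k = 1 := by
          push_cast
          rw [← mul_pow, ENNReal.mul_inv_cancel (by norm_num) (by norm_num), one_pow]
        calc _ = (((2 ^ k : ℕ) : ℝ≥0∞) * 2⁻¹ ^ k) *
              ((ENNReal.ofReal K' * K) ^ p * (2⁻¹ ^ k * S k ^ p)) := by ring
          _ = _ := by rw [h2, one_mul]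
    _ ≤ (ENNReal.ofReal K' * K) ^ p * (hilbertConst p q * dyadicEnergy ω p f) := by
        rw [ENNReal.tsum_mul_left]
        gcongr
        exact tsum_sum_range_le hpq _
    _ = _ := by ring

theorem sum_rpow_le_rpow_sum {q : ℝ} (hq : 1 ≤ q) (s : Finset ℕ) (x : ℕ → ℝ≥0∞) :
    ∑ j ∈ s, x j ^ q ≤ (∑ j ∈ s, x j) ^ q := by
  have e : ∀ y : ℝ≥0∞, y ^ q = y * y ^ (q - 1) := fun y => by
    conv_rhs => rw [← ENNReal.rpow_one y, ← ENNReal.rpow_mul, one_mul]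
    rw [← ENNReal.rpow_add_of_nonneg _ _ (by norm_num) (by linarith)]
    congr 1
    ring
  rw [e (∑ j ∈ s, x j), Finset.sum_mul]
  refine Finset.sum_le_sum fun j hj => ?_
  rw [e]
  have : 0 ≤ q - 1 := by linarith
  gcongr
  exact Finset.single_le_sum (f := x) (fun _ _ => bot_le) hj

theorem invTwoPow_pow_rpow_eq (s p : ℝ) (k : ℕ) :
    (invTwoPow s ^ k) ^ p = ENNReal.ofReal (((1 / 2) ^ k) ^ (p * s)) := by
  have h2 : ENNReal.ofReal (((1 / 2) ^ k) ^ (p * s)) = (2⁻¹ ^ k) ^ (p * s) := by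
    rw [← ENNReal.ofReal_rpow_of_pos (by positivity), ofReal_half_pow]
  rw [h2, invTwoPow, ← ENNReal.rpow_natCast, ← ENNReal.rpow_natCast, ← ENNReal.rpow_mul,
    ← ENNReal.rpow_mul, ← ENNReal.rpow_mul, ← ENNReal.rpow_neg_one, ← ENNReal.rpow_mul]
  congr 1
  ring

/-- The kernel 1/(2^{-j}+|θ|) has L^q norm of order 2^{j/q'}, and for j ≤ k the factor 2^{-k/q'}
absorbs it. -/
theorem IsUpperDoubling.exists_integralMean_deriv_le (hω : IsUpperDoubling ω) {q q' : ℝ}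
    (hqq' : q.HolderConjugate q') :
    ∃ C : ℝ≥0∞, C ≠ ∞ ∧ ∀ f : ℝ → ℂ, AEStronglyMeasurable f unitMeasure →
      Integrable (fun t => f t * (ω t : ℂ)) unitMeasure →
      ∀ k : ℕ, ∀ r ∈ Set.Ico (node k) (node (k + 1)),
        invTwoPow (1 / q') ^ k * integralMean q r (deriv (hilbertOp ω f)) ≤
          C * ∑ j ∈ Finset.range (k + 1), tailAverage ω f j := by
  have hq := hqq'.pos
  have hq' := hqq'.symm.pos
  obtain ⟨K, hK, h⟩ := hω.exists_enorm_deriv_le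
  refine ⟨K * hilbertConst q q' ^ (1 / q), ENNReal.mul_ne_top hK
    (ENNReal.rpow_ne_top_of_nonneg (by positivity) (hilbertConst_ne_top hqq')), ?_⟩
  intro f hfm hf k r hr
  set g : ℝ≥0∞ := invTwoPow (1 / q') with hg
  have hg0 : ∀ j, g ^ j ≠ 0 := fun j => pow_ne_zero _ (invTwoPow_ne_zero _)
  have hgt : ∀ j, g ^ j ≠ ∞ := fun j => ENNReal.pow_ne_top (invTwoPow_ne_top _)
  -- This choice cancels the factor 2^{-j/q'} of the circle inequality and cuts the series off at k.
  set x : ℕ → ℝ≥0∞ := fun j => if j ∈ Finset.range (k + 1) then (g ^ j)⁻¹ * tailAverage ω f j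
    else 0 with hx
  have hpt : ∀ θ ∈ Set.Ico 0 (2 * Real.pi), ‖deriv (hilbertOp ω f) (circleMap 0 r θ)‖ₑ ≤
      K * ∑' j : ℕ, ENNReal.ofReal (1 / ((1 / 2) ^ j + angle θ)) * (g ^ j * x j) := fun θ hθ => by
    refine (h f hfm hf k r θ ((node_nonneg k).trans hr.1) hr.2 hθ).trans ?_
    gcongr
    rw [tsum_eq_sum (s := Finset.range (k + 1)) (fun j hj => by simp only [hx, if_neg hj, mul_zero])]
    refine Finset.sum_le_sum fun j hj => ?_
    simp only [hx, if_pos hj]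
    rw [← mul_assoc (g ^ j), ENNReal.mul_inv_cancel (hg0 j) (hgt j), one_mul]
  have hint : ∫⁻ θ in Set.Ico 0 (2 * Real.pi),
      ‖deriv (hilbertOp ω f) (circleMap 0 r θ)‖ₑ ^ q ≤
      K ^ q * (ENNReal.ofReal (2 * Real.pi) * hilbertConst q q' * ∑' j, x j ^ q) := by
    refine le_trans ?_ (mul_le_mul_right (lintegral_circle_tsum_kernel_le hqq' x) _)
    rw [← lintegral_const_mul' _ _ (ENNReal.rpow_ne_top_of_nonneg hq.le hK)]
    refine setLIntegral_mono' measurableSet_Ico fun θ hθ => ?_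
    rw [← ENNReal.mul_rpow_of_nonneg _ _ hq.le]
    gcongr
    exact hpt θ hθ
  rw [lintegral_circle_eq_integralMean_rpow hq] at hint
  have hpi0 : ENNReal.ofReal (2 * Real.pi) ≠ 0 := by simp [Real.pi_pos]
  have hint2 : integralMean q r (deriv (hilbertOp ω f)) ^ q ≤
      (K * hilbertConst q q' ^ (1 / q) * ∑ j ∈ Finset.range (k + 1), x j) ^ q := by
    have h1 : ENNReal.ofReal (2 * Real.pi) * integralMean q r (deriv (hilbertOp ω f)) ^ q ≤
        ENNReal.ofReal (2 * Real.pi) * (K ^ q * hilbertConst q q' * ∑' j, x j ^ q) :=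
      hint.trans (le_of_eq (by ring))
    refine ((ENNReal.mul_le_mul_iff_right hpi0 ENNReal.ofReal_ne_top).1 h1).trans ?_
    rw [ENNReal.mul_rpow_of_nonneg _ _ hq.le, ENNReal.mul_rpow_of_nonneg _ _ hq.le,
      ← ENNReal.rpow_mul, one_div_mul_cancel hq.ne', ENNReal.rpow_one]
    gcongr
    rw [tsum_eq_sum (s := Finset.range (k + 1)) (fun j hj => by
      simp only [hx, if_neg hj, ENNReal.zero_rpow_of_pos hq])]
    exact sum_rpow_le_rpow_sum hqq'.lt.le _ _
  have hint3 := (ENNReal.rpow_le_rpow_iff hq).1 hint2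
  calc g ^ k * integralMean q r (deriv (hilbertOp ω f))
      ≤ g ^ k * (K * hilbertConst q q' ^ (1 / q) * ∑ j ∈ Finset.range (k + 1), x j) := by gcongr
    _ = K * hilbertConst q q' ^ (1 / q) * ∑ j ∈ Finset.range (k + 1), g ^ k * x j := by
        rw [← Finset.mul_sum]; ring
    _ ≤ _ := by
        gcongr with j hj
        simp only [hx, if_pos hj]
        have hjk : j ≤ k := Nat.lt_succ_iff.1 (Finset.mem_range.1 hj)
        rw [← mul_assoc]
        refine mul_le_of_le_one_left' ?_
        rw [← div_eq_mul_inv]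
        refine ENNReal.div_le_of_le_mul ?_
        rw [one_mul]
        exact pow_le_pow_right_of_le_one' (invTwoPow_lt_one (by positivity)).le hjk

theorem one_sub_one_div_eq {q q' : ℝ} (h : q.HolderConjugate q') : 1 - 1 / q = 1 / q' := by
  have := h.inv_add_inv_eq_one
  simp only [one_div]
  linarith

/-- Since p(1-1/q) = p/q', the weight (1-r)^{p/q'} cancels the growth 2^{kp/q'} of M_q^p for every
q. Only the length of the k-th dyadic interval remains, which is why the result does not depend on q
and ends in the discrete Hardy inequality. -/
theorem IsUpperDoubling.exists_mixedNorm_le (hω : IsUpperDoubling ω) {p p' q q' : ℝ}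
    (hpp' : p.HolderConjugate p') (hqq' : q.HolderConjugate q') :
    ∃ C : ℝ≥0∞, C ≠ ∞ ∧ ∀ f : ℝ → ℂ, AEStronglyMeasurable f unitMeasure →
      Integrable (fun t => f t * (ω t : ℂ)) unitMeasure →
      mixedNorm p q (p * (1 - 1 / q)) (hilbertOp ω f) ≤ C * dyadicEnergy ω p f ^ (1 / p) := by
  have hp := hpp'.pos
  have hq := hqq'.pos
  have hq' := hqq'.symm.pos
  obtain ⟨K₀, hK₀, h₀⟩ := hω.exists_enorm_hilbertOp_zero_le
  obtain ⟨K, hK, h⟩ := hω.exists_integralMean_deriv_le hqq'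
  have hH := hilbertConst_ne_top hpp'
  refine ⟨(K₀ ^ p + K ^ p * hilbertConst p p') ^ (1 / p), ?_, fun f hfm hf => ?_⟩
  · refine ENNReal.rpow_ne_top_of_nonneg (by positivity) (ENNReal.add_ne_top.2 ⟨?_, ?_⟩)
    · exact ENNReal.rpow_ne_top_of_nonneg hp.le hK₀
    · exact ENNReal.mul_ne_top (ENNReal.rpow_ne_top_of_nonneg hp.le hK) hH
  unfold mixedNorm
  rw [← ENNReal.mul_rpow_of_nonneg _ _ (by positivity), add_mul, one_sub_one_div_eq hqq']
  gcongr
  · calc ‖hilbertOp ω f 0‖ₑ ^ p ≤ (K₀ * tailAverage ω f 0) ^ p := by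
          gcongr
          exact h₀ f hfm hf
      _ = K₀ ^ p * tailAverage ω f 0 ^ p := ENNReal.mul_rpow_of_nonneg _ _ hp.le
      _ ≤ _ := by
          gcongr
          exact tailAverage_zero_rpow_le ω p f
  · rw [lintegral_Ico_eq_tsum]
    calc _ ≤ ∑' k, ∫⁻ r in Set.Ico (node k) (node (k + 1)),
          (K * ∑ j ∈ Finset.range (k + 1), tailAverage ω f j) ^ p := by
          refine ENNReal.tsum_le_tsum fun k => setLIntegral_mono' measurableSet_Ico fun r hr => ?_
          have h1 : ENNReal.ofReal ((1 - r) ^ (p * (1 / q'))) ≤ (invTwoPow (1 / q') ^ k) ^ p := by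
            rw [invTwoPow_pow_rpow_eq]
            refine ENNReal.ofReal_le_ofReal (Real.rpow_le_rpow ?_ ?_ (by positivity))
            · linarith [hr.2.trans (node_lt_one (k + 1))]
            · have := hr.1
              unfold node at this
              linarith
          calc _ ≤ integralMean q r (deriv (hilbertOp ω f)) ^ p * (invTwoPow (1 / q') ^ k) ^ p := by
                gcongr
            _ = (invTwoPow (1 / q') ^ k * integralMean q r (deriv (hilbertOp ω f))) ^ p := by
                rw [ENNReal.mul_rpow_of_nonneg _ _ hp.le, mul_comm]
            _ ≤ _ := by
                gcongr ?_ ^ p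
                exact h f hfm hf k r hr
      _ ≤ ∑' k, K ^ p * (2⁻¹ ^ k * (∑ j ∈ Finset.range (k + 1), tailAverage ω f j) ^ p) := by
          refine ENNReal.tsum_le_tsum fun k => ?_
          rw [setLIntegral_const, volume_Ico_node, ENNReal.mul_rpow_of_nonneg _ _ hp.le, mul_assoc,
            mul_comm (_ ^ p) (2⁻¹ ^ (k + 1))]
          exact mul_le_mul_right (mul_le_mul_left
            (pow_le_pow_right_of_le_one' (by norm_num) (Nat.le_succ k)) _) _
      _ ≤ K ^ p * (hilbertConst p p' * dyadicEnergy ω p f) := by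
          rw [ENNReal.tsum_mul_left]
          gcongr
          exact tsum_sum_range_le hpp' _
      _ = _ := by ring

theorem measurable_standardWeight (α : ℝ) : Measurable (standardWeight α) := by
  unfold standardWeight
  fun_prop

theorem bergmanNormPow_standardWeight_le {p : ℝ} (hp : 1 < p) {g : ℂ → ℂ}
    (hg : ContinuousOn g disc) :
    bergmanNormPow (standardWeight (p - 1)) p g ≤ ENNReal.ofReal (2 * p * 2 ^ (p - 1)) *
      ∫⁻ r in Set.Ico (0 : ℝ) 1, integralMean p r g ^ p * ENNReal.ofReal ((1 - r) ^ (p - 1)) := by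
  rw [bergmanNormPow_eq (measurable_standardWeight _).aestronglyMeasurable (by linarith) hg,
    ← lintegral_const_mul' _ _ ENNReal.ofReal_ne_top]
  refine (lintegral_mono_set Set.Ioo_subset_Ico_self).trans ?_
  refine setLIntegral_mono' measurableSet_Ico fun r hr => ?_
  have h0 : 0 ≤ 1 - r := by linarith [hr.2]
  have hw : 2 * r * standardWeight (p - 1) r ≤ 2 * p * 2 ^ (p - 1) * (1 - r) ^ (p - 1) := by
    unfold standardWeight
    have e : 1 - r ^ 2 = (1 - r) * (1 + r) := by ring
    have h2 : (1 - r ^ 2) ^ (p - 1) ≤ (2 * (1 - r)) ^ (p - 1) := by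
      refine Real.rpow_le_rpow (by rw [e]; exact mul_nonneg h0 (by linarith [hr.1])) ?_
        (by linarith)
      rw [e]
      nlinarith [hr.1]
    rw [Real.mul_rpow (by norm_num) h0] at h2
    have h3 : (0 : ℝ) ≤ (2 : ℝ) ^ (p - 1) * (1 - r) ^ (p - 1) := by positivity
    have h4 : 0 ≤ (1 - r ^ 2) ^ (p - 1) := Real.rpow_nonneg
      (by rw [e]; exact mul_nonneg h0 (by linarith [hr.1])) _
    calc 2 * r * ((p - 1 + 1) * (1 - r ^ 2) ^ (p - 1))
        ≤ 2 * 1 * ((p - 1 + 1) * (2 ^ (p - 1) * (1 - r) ^ (p - 1))) :=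
          mul_le_mul (by linarith [hr.2]) (mul_le_mul_of_nonneg_left h2 (by linarith))
            (mul_nonneg (by linarith) h4) (by norm_num)
      _ = _ := by ring
  calc ENNReal.ofReal (2 * r) * ENNReal.ofReal (standardWeight (p - 1) r) * integralMean p r g ^ p
      ≤ ENNReal.ofReal (2 * p * 2 ^ (p - 1) * (1 - r) ^ (p - 1)) * integralMean p r g ^ p := by
        rw [← ENNReal.ofReal_mul (by linarith [hr.1])]
        gcongr
    _ = _ := by
        rw [ENNReal.ofReal_mul (by positivity)]
        ring

/-- In polar coordinates this is the mixed norm with q = p, for which p(1-1/p) = p-1, up to the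
bounded factor relating (1-r²)^{p-1} to (1-r)^{p-1}. -/
theorem IsUpperDoubling.exists_dirichletNorm_le (hω : IsUpperDoubling ω) {p p' : ℝ}
    (hpp' : p.HolderConjugate p') :
    ∃ C : ℝ≥0∞, C ≠ ∞ ∧ ∀ f : ℝ → ℂ, AEStronglyMeasurable f unitMeasure →
      Integrable (fun t => f t * (ω t : ℂ)) unitMeasure →
      dirichletNorm p (hilbertOp ω f) ≤ C * dyadicEnergy ω p f ^ (1 / p) := by
  have hp := hpp'.pos
  have hp1 := hpp'.lt
  obtain ⟨C, hC, h⟩ := hω.exists_mixedNorm_le hpp' hpp'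
  set c : ℝ≥0∞ := 1 + ENNReal.ofReal (2 * p * 2 ^ (p - 1)) with hc
  refine ⟨c ^ (1 / p) * C, ENNReal.mul_ne_top
    (ENNReal.rpow_ne_top_of_nonneg (by positivity) (by finiteness)) hC, fun f hfm hf => ?_⟩
  rw [mul_assoc]
  refine le_trans ?_ (mul_le_mul_right (h f hfm hf) _)
  unfold dirichletNorm mixedNorm
  rw [← ENNReal.mul_rpow_of_nonneg _ _ (by positivity), mul_add]
  have e : p * (1 - 1 / p) = p - 1 := by field_simp
  rw [e]
  gcongr
  · exact le_mul_of_one_le_left' (by rw [hc]; exact le_self_add)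
  · refine (bergmanNormPow_standardWeight_le hp1
      (differentiableOn_deriv (hω.differentiableOn_hilbertOp hf)).continuousOn).trans ?_
    gcongr
    rw [hc]
    exact le_add_self

/-! ### The Hardy norm of H_ω(f) -/

theorem angle_le_pi (θ : ℝ) : angle θ ≤ Real.pi := by
  unfold angle
  rcases le_total θ Real.pi with h' | h'
  · exact (min_le_left _ _).trans h'
  · exact (min_le_right _ _).trans (by linarith)

theorem enorm_sub_le_lintegral_radius {F : ℂ → ℂ} (hF : DifferentiableOn ℂ F disc) {ρ : ℝ}
    (h0 : 0 ≤ ρ) (h1 : ρ < 1) (θ : ℝ) :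
    ‖F (circleMap 0 ρ θ)‖ₑ ≤ ‖F 0‖ₑ +
      ∫⁻ r in Set.Ico (0 : ℝ) 1, ‖deriv F (circleMap 0 r θ)‖ₑ := by
  have hder : ∀ r ∈ Set.uIcc 0 ρ, HasDerivAt (fun r : ℝ => F (circleMap 0 r θ))
      (deriv F (circleMap 0 r θ) * Complex.exp (θ * Complex.I)) r := fun r hr => by
    rw [Set.uIcc_of_le h0] at hr
    have hmem := circleMap_mem_disc hr.1 (hr.2.trans_lt h1) θ
    have hd : HasDerivAt F (deriv F (circleMap 0 r θ)) (circleMap 0 r θ) :=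
      (hF.differentiableAt (Metric.isOpen_ball.mem_nhds hmem)).hasDerivAt
    have hc : HasDerivAt (fun r : ℝ => circleMap 0 r θ) (Complex.exp (θ * Complex.I)) r := by
      have h2 := (Complex.ofRealCLM.hasDerivAt (x := r)).mul_const (Complex.exp (θ * Complex.I))
      simpa [circleMap] using h2
    exact HasDerivAt.comp r hd hc
  have hcont : ContinuousOn (fun r : ℝ => deriv F (circleMap 0 r θ) *
      Complex.exp (θ * Complex.I)) (Set.uIcc 0 ρ) := by
    refine ContinuousOn.mul ?_ continuousOn_const
    refine (differentiableOn_deriv hF).continuousOn.comp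
      (by unfold circleMap; fun_prop) fun r hr => ?_
    rw [Set.uIcc_of_le h0] at hr
    exact circleMap_mem_disc hr.1 (hr.2.trans_lt h1) θ
  have hftc := intervalIntegral.integral_eq_sub_of_hasDerivAt hder hcont.intervalIntegrable
  have h00 : circleMap 0 0 θ = 0 := by simp [circleMap]
  rw [h00, eq_comm, sub_eq_iff_eq_add] at hftc
  rw [hftc, add_comm ‖F 0‖ₑ]
  refine (enorm_add_le _ _).trans ?_
  gcongr
  rw [intervalIntegral.integral_of_le h0]
  refine (enorm_integral_le_lintegral_enorm _).trans ?_
  have hsub : Set.Ioc 0 ρ ⊆ Set.Ico 0 1 := fun r hr => ⟨hr.1.le, hr.2.trans_lt h1⟩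
  refine (lintegral_mono_set hsub).trans (lintegral_mono fun r => ?_)
  rw [enorm_mul, ← ofReal_norm (Complex.exp _), Complex.norm_exp_ofReal_mul_I, ENNReal.ofReal_one,
    mul_one]

theorem tsum_geometric_sum_range_le (a : ℕ → ℝ≥0∞) :
    ∑' k : ℕ, 2⁻¹ ^ (k + 1) * ∑ j ∈ Finset.range (k + 1), a j ≤ ∑' j, 2⁻¹ ^ j * a j := by
  have h2 : (2⁻¹ : ℝ≥0∞) * 2 = 1 := ENNReal.inv_mul_cancel (by norm_num) (by norm_num)
  calc ∑' k : ℕ, 2⁻¹ ^ (k + 1) * ∑ j ∈ Finset.range (k + 1), a j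
      = ∑' k : ℕ, ∑' j : ℕ, (2⁻¹ ^ j * a j * 2⁻¹) * (if j ≤ k then 2⁻¹ ^ (k - j) else 0) := by
        refine tsum_congr fun k => ?_
        rw [tsum_eq_sum (s := Finset.range (k + 1)) (fun j hj => by
          rw [if_neg (by simpa [Nat.lt_succ_iff] using hj), mul_zero]), Finset.mul_sum]
        refine Finset.sum_congr rfl fun j hj => ?_
        have hjk : j ≤ k := Nat.lt_succ_iff.1 (Finset.mem_range.1 hj)
        rw [if_pos hjk]
        obtain ⟨i, rfl⟩ := Nat.exists_eq_add_of_le hjk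
        rw [Nat.add_sub_cancel_left]
        ring
    _ = ∑' j : ℕ, (2⁻¹ ^ j * a j * 2⁻¹) * ∑' k : ℕ, (if j ≤ k then 2⁻¹ ^ (k - j) else 0) := by
        rw [ENNReal.tsum_comm]
        simp_rw [ENNReal.tsum_mul_left]
    _ ≤ ∑' j : ℕ, (2⁻¹ ^ j * a j * 2⁻¹) * 2 := by
        refine ENNReal.tsum_le_tsum fun j => ?_
        gcongr
        refine (tsum_ite_le_pow_sub' _ j).trans (le_of_eq ?_)
        rw [ENNReal.one_sub_inv_two, inv_inv]
    _ = _ := by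
        refine tsum_congr fun j => ?_
        rw [mul_assoc, h2, mul_one]

/-- Integrating the bound of the derivative along a radius gives a majorant Σ_j 2^{-j}
h_j/(2^{-j}+|θ|) independent of ρ, so the radial maximal function is controlled directly. Its L^p
norm is estimated by Hilbert's inequality. -/
theorem IsUpperDoubling.exists_hardyNorm_le (hω : IsUpperDoubling ω) {p p' : ℝ}
    (hpp' : p.HolderConjugate p') :
    ∃ C : ℝ≥0∞, C ≠ ∞ ∧ ∀ f : ℝ → ℂ, AEStronglyMeasurable f unitMeasure →
      Integrable (fun t => f t * (ω t : ℂ)) unitMeasure →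
      hardyNorm p (hilbertOp ω f) ≤ C * dyadicEnergy ω p f ^ (1 / p) := by
  have hp := hpp'.pos
  obtain ⟨K₀, hK₀, h₀⟩ := hω.exists_enorm_hilbertOp_zero_le
  obtain ⟨K, hK, h⟩ := hω.exists_enorm_deriv_le
  have hH := hilbertConst_ne_top hpp'
  refine ⟨(K₀ * 5 + K) * hilbertConst p p' ^ (1 / p), ENNReal.mul_ne_top (by finiteness)
    (ENNReal.rpow_ne_top_of_nonneg (by positivity) hH), fun f hfm hf => ?_⟩
  have hF := hω.differentiableOn_hilbertOp hf
  set κ : ℕ → ℝ → ℝ≥0∞ := fun j θ => ENNReal.ofReal (1 / ((1 / 2) ^ j + angle θ)) with hκ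
  have hpt : ∀ ρ ∈ Set.Ioo (0 : ℝ) 1, ∀ θ ∈ Set.Ico 0 (2 * Real.pi),
      ‖hilbertOp ω f (circleMap 0 ρ θ)‖ₑ ≤
        (K₀ * 5 + K) * ∑' j, 2⁻¹ ^ j * (κ j θ * tailAverage ω f j) := fun ρ hρ θ hθ => by
    refine (enorm_sub_le_lintegral_radius hF hρ.1.le hρ.2 θ).trans ?_
    rw [add_mul]
    gcongr
    · refine (h₀ f hfm hf).trans ?_
      rw [mul_assoc]
      gcongr
      -- The value at 0 is absorbed by the term j = 0, since 1 + |θ| ≤ 1 + π ≤ 5.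
      have h5 : 1 ≤ 5 * κ 0 θ := by
        have e5 : (5 : ℝ≥0∞) = ENNReal.ofReal 5 := by norm_num
        simp only [hκ]
        rw [e5, ← ENNReal.ofReal_mul (by norm_num), ← ENNReal.ofReal_one]
        refine ENNReal.ofReal_le_ofReal ?_
        have h1 := angle_nonneg hθ
        have h2 := angle_le_pi θ
        have h3 := Real.pi_le_four
        rw [pow_zero, mul_one_div, le_div_iff₀ (by linarith)]
        linarith
      calc tailAverage ω f 0 ≤ 5 * κ 0 θ * tailAverage ω f 0 := le_mul_of_one_le_left' h5
        _ = 5 * (2⁻¹ ^ 0 * (κ 0 θ * tailAverage ω f 0)) := by ring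
        _ ≤ _ := by
          gcongr
          exact ENNReal.le_tsum (f := fun j => 2⁻¹ ^ j * (κ j θ * tailAverage ω f j)) 0
    · rw [lintegral_Ico_eq_tsum]
      calc _ ≤ ∑' k, ∫⁻ r in Set.Ico (node k) (node (k + 1)),
            K * ∑ j ∈ Finset.range (k + 1), κ j θ * tailAverage ω f j := by
            refine ENNReal.tsum_le_tsum fun k => setLIntegral_mono' measurableSet_Ico fun r hr => ?_
            exact h f hfm hf k r θ ((node_nonneg k).trans hr.1) hr.2 hθ
        _ = K * ∑' k, 2⁻¹ ^ (k + 1) *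
              ∑ j ∈ Finset.range (k + 1), κ j θ * tailAverage ω f j := by
            rw [← ENNReal.tsum_mul_left]
            refine tsum_congr fun k => ?_
            rw [setLIntegral_const, volume_Ico_node]
            ring
        _ ≤ _ := mul_le_mul_right (tsum_geometric_sum_range_le _) _
  unfold hardyNorm
  refine iSup₂_le fun ρ hρ => ?_
  unfold integralMean
  have hint : ∫⁻ θ in Set.Ico 0 (2 * Real.pi), ‖hilbertOp ω f (circleMap 0 ρ θ)‖ₑ ^ p ≤
      (K₀ * 5 + K) ^ p * (ENNReal.ofReal (2 * Real.pi) * hilbertConst p p' *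
        dyadicEnergy ω p f) := by
    have h1 := lintegral_circle_tsum_kernel_le hpp'
      (fun j => invTwoPow (1 / p) ^ j * tailAverage ω f j)
    have e1 : ∑' j, (invTwoPow (1 / p) ^ j * tailAverage ω f j) ^ p = dyadicEnergy ω p f := by
      unfold dyadicEnergy
      simp_rw [two_inv_pow_mul_rpow hp]
    rw [e1] at h1
    refine le_trans ?_ (mul_le_mul_right h1 _)
    rw [← lintegral_const_mul' _ _ (ENNReal.rpow_ne_top_of_nonneg hp.le (by finiteness))]
    refine setLIntegral_mono' measurableSet_Ico fun θ hθ => ?_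
    rw [← ENNReal.mul_rpow_of_nonneg _ _ hp.le]
    gcongr
    refine (hpt ρ hρ θ hθ).trans (le_of_eq ?_)
    congr 1
    refine tsum_congr fun j => ?_
    -- 2^{-j} = 2^{-j/p} 2^{-j/p'}: the second factor is the one in the circle inequality, the first
    -- makes the p-th powers sum to E(f).
    rw [← invTwoPow_mul hpp', mul_pow]
    simp only [hκ]
    ring
  calc _ ≤ (ENNReal.ofReal (2 * Real.pi)⁻¹ * ((K₀ * 5 + K) ^ p *
        (ENNReal.ofReal (2 * Real.pi) * hilbertConst p p' * dyadicEnergy ω p f))) ^ (1 / p) := by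
        gcongr
    _ = ((ENNReal.ofReal (2 * Real.pi)⁻¹ * ENNReal.ofReal (2 * Real.pi)) *
          ((K₀ * 5 + K) ^ p * (hilbertConst p p' * dyadicEnergy ω p f))) ^ (1 / p) := by
        congr 1; ring
    _ = _ := by
        rw [← ENNReal.ofReal_mul (by positivity), inv_mul_cancel₀ (by positivity),
          ENNReal.ofReal_one, one_mul, ENNReal.mul_rpow_of_nonneg _ _ (by positivity),
          ENNReal.mul_rpow_of_nonneg _ _ (by positivity), ← ENNReal.rpow_mul,
          mul_one_div_cancel hp.ne', ENNReal.rpow_one, mul_assoc]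

end

section


/-! ### Lower bounds of the norms of `H_ω(u)` for non-negative `u` -/

variable {ω : ℝ → ℝ}

/-- Non-negative functions on `[0,1)` that are integrable against the weight `ω`. -/
structure IsTestFunction (ω u : ℝ → ℝ) : Prop where
  nonneg : ∀ t ∈ Set.Ico (0 : ℝ) 1, 0 ≤ u t
  aestronglyMeasurable : AEStronglyMeasurable u unitMeasure
  integrable : Integrable (fun t => u t * ω t) unitMeasure

theorem IsTestFunction.aestronglyMeasurable_ofReal {u : ℝ → ℝ} (hu : IsTestFunction ω u) :
    AEStronglyMeasurable (fun t => (u t : ℂ)) unitMeasure :=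
  Complex.continuous_ofReal.comp_aestronglyMeasurable hu.aestronglyMeasurable

theorem IsTestFunction.integrable_ofReal {u : ℝ → ℝ} (hu : IsTestFunction ω u) :
    Integrable (fun t => (u t : ℂ) * (ω t : ℂ)) unitMeasure := by
  have := hu.integrable.ofReal (𝕜 := ℂ)
  refine this.congr (Filter.Eventually.of_forall fun t => ?_)
  push_cast
  rfl

theorem IsTestFunction.integrable_pow {u : ℝ → ℝ} (hu : IsTestFunction ω u) (n : ℕ) :
    Integrable (fun t => u t * t ^ n * ω t) unitMeasure := by
  have e : (fun t => u t * t ^ n * ω t) = fun t => t ^ n * (u t * ω t) := by ext t; ring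
  rw [e]
  refine hu.integrable.bdd_mul (c := 1) (by fun_prop) ?_
  filter_upwards [ae_unitMeasure_mem] with t ht
  rw [norm_pow, Real.norm_eq_abs, abs_of_nonneg ht.1]
  exact pow_le_one₀ ht.1 ht.2.le

theorem weightedMoment_ofReal (ω u : ℝ → ℝ) (n : ℕ) :
    weightedMoment ω (fun t => (u t : ℂ)) n =
      ((∫ t, u t * t ^ n * ω t ∂unitMeasure : ℝ) : ℂ) := by
  unfold weightedMoment
  rw [← integral_complex_ofReal]
  congr 1 with t
  push_cast
  rfl

theorem IsTestFunction.ae_nonneg {u : ℝ → ℝ} (hω : IsRadialWeight ω) (hu : IsTestFunction ω u)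
    (n : ℕ) : ∀ᵐ t ∂unitMeasure, 0 ≤ u t * t ^ n * ω t := by
  filter_upwards [ae_unitMeasure_mem] with t ht
  exact mul_nonneg (mul_nonneg (hu.nonneg t ht) (pow_nonneg ht.1 n)) (hω.nonneg t ht)

theorem IsTestFunction.enorm_weightedMoment {u : ℝ → ℝ} (hω : IsRadialWeight ω)
    (hu : IsTestFunction ω u) (n : ℕ) :
    ‖weightedMoment ω (fun t => (u t : ℂ)) n‖ₑ =
      ∫⁻ t, (‖(u t : ℂ)‖ₑ * ENNReal.ofReal (ω t)) * ENNReal.ofReal (t ^ n) ∂unitMeasure := by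
  rw [weightedMoment_ofReal, ← ofReal_norm, Complex.norm_real, Real.norm_eq_abs,
    abs_of_nonneg (integral_nonneg_of_ae (hu.ae_nonneg hω n)),
    ofReal_integral_eq_lintegral_ofReal (hu.integrable_pow n) (hu.ae_nonneg hω n)]
  refine lintegral_congr_ae ?_
  filter_upwards [ae_unitMeasure_mem] with t ht
  have h1 := hu.nonneg t ht
  rw [← ofReal_norm, Complex.norm_real, Real.norm_eq_abs, abs_of_nonneg h1,
    ← ENNReal.ofReal_mul h1, ← ENNReal.ofReal_mul (mul_nonneg h1 (hω.nonneg t ht))]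
  congr 1
  ring

/-- Block 0 is treated apart because r_0 = 0; it contains only n = 0, where 0^0 = 1. -/
theorem one_sixteenth_le_node_pow {k n : ℕ}
    (hn : n ∈ Finset.Ico (2 ^ k - 1) (2 ^ (k + 1) - 1)) : (1 / 2 : ℝ) ^ 4 ≤ node k ^ n := by
  rw [Finset.mem_Ico] at hn
  cases k with
  | zero =>
    have : n = 0 := by simpa using hn.2
    subst this
    norm_num
  | succ k =>
    refine half_pow_le_node_pow k 4 n ?_
    rw [pow_succ, pow_succ] at hn
    omega

/-- For n in block k the power t^n is at least 1/16 on [r_k,1), so the n-th moment of u controls its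
mass there, while ω_{2n+1} ≲ ω̂(r_k). Non-negativity of u excludes cancellation; all lower bounds
rest on this. -/
theorem IsUpperDoubling.exists_tailAverage_le_coeff (hω : IsUpperDoubling ω) :
    ∃ K : ℝ≥0∞, K ≠ ∞ ∧ ∀ u : ℝ → ℝ, IsTestFunction ω u → ∀ k : ℕ,
      ∀ n : ℕ, n ∈ Finset.Ico (2 ^ k - 1) (2 ^ (k + 1) - 1) →
      tailAverage ω (fun t => (u t : ℂ)) k ≤
        K * (((n : ℝ≥0∞) + 1) * ‖taylorCoeff (hilbertOp ω fun t => (u t : ℂ)) n‖ₑ) := by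
  have hω' := hω.toIsRadialWeight
  obtain ⟨K, hK, h⟩ := hω.exists_moment_le
  refine ⟨ENNReal.ofReal (2 ^ 4) * ENNReal.ofReal (2 * K),
    ENNReal.mul_ne_top ENNReal.ofReal_ne_top ENNReal.ofReal_ne_top, fun u hu k n hn => ?_⟩
  have hτ := hω'.tail_node_pos k
  have hmass : ∫⁻ t in Set.Ico (node k) 1, ‖(u t : ℂ)‖ₑ * ENNReal.ofReal (ω t) ≤
      ENNReal.ofReal (2 ^ 4) * ‖weightedMoment ω (fun t => (u t : ℂ)) n‖ₑ := by
    rw [hu.enorm_weightedMoment hω' n, ← lintegral_const_mul' _ _ ENNReal.ofReal_ne_top,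
      unitMeasure]
    refine le_trans ?_ (lintegral_mono_set (Set.Ico_subset_Ico_left (node_nonneg k)))
    refine setLIntegral_mono' measurableSet_Ico fun t ht => ?_
    rw [mul_left_comm, ← ENNReal.ofReal_mul (by norm_num)]
    refine le_mul_of_one_le_right' ?_
    rw [← ENNReal.ofReal_one]
    refine ENNReal.ofReal_le_ofReal ?_
    have h1 := one_sixteenth_le_node_pow hn
    have h2 : node k ^ n ≤ t ^ n := pow_le_pow_left₀ (node_nonneg k) ht.1 n
    norm_num at h1 ⊢
    linarith
  have hcoef : (ENNReal.ofReal (tail ω (node k)))⁻¹ ≤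
      ENNReal.ofReal (2 * K) * ENNReal.ofReal (kernelCoeff ω n) := by
    rw [← ENNReal.ofReal_inv_of_pos hτ, ← ENNReal.ofReal_mul (by positivity)]
    refine ENNReal.ofReal_le_ofReal ?_
    have h1 := hω'.moment_pos (2 * n + 1)
    have h2 := h (2 * n + 1) k (by rw [Finset.mem_Ico] at hn; omega)
    unfold kernelCoeff
    rw [mul_one_div, inv_eq_one_div, div_le_div_iff₀ hτ (by positivity)]
    linarith
  have hc : ((n : ℝ≥0∞) + 1) * ‖taylorCoeff (hilbertOp ω fun t => (u t : ℂ)) n‖ₑ =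
      ENNReal.ofReal (kernelCoeff ω n) * ‖weightedMoment ω (fun t => (u t : ℂ)) n‖ₑ := by
    rw [hω.taylorCoeff_hilbertOp hu.integrable_ofReal, enorm_mul,
      ← ofReal_norm (hilbertCoeff ω n : ℂ), Complex.norm_real, Real.norm_eq_abs,
      abs_of_pos (hω'.hilbertCoeff_pos n), ← mul_assoc]
    congr 1
    have e : (n : ℝ≥0∞) + 1 = ENNReal.ofReal (n + 1) := by
      rw [ENNReal.ofReal_add (by positivity) (by norm_num), ENNReal.ofReal_natCast,
        ENNReal.ofReal_one]
    rw [e, ← ENNReal.ofReal_mul (by positivity), hilbertCoeff, mul_div_cancel₀]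
    positivity
  rw [hc, tailAverage, div_eq_mul_inv]
  calc _ ≤ ENNReal.ofReal (2 ^ 4) * ‖weightedMoment ω (fun t => (u t : ℂ)) n‖ₑ *
        (ENNReal.ofReal (2 * K) * ENNReal.ofReal (kernelCoeff ω n)) := by gcongr
    _ = _ := by ring

/-- Functions with non-negative Taylor coefficients dominate their partial sums on the radius. -/
theorem sum_coeff_le_enorm {F : ℂ → ℂ} (hF : DifferentiableOn ℂ F disc) {a : ℕ → ℝ}
    (ha0 : ∀ n, 0 ≤ a n) (ha : ∀ n, taylorCoeff F n = a n) {s : ℝ} (hs : s ∈ Set.Ico (0 : ℝ) 1)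
    (T : Finset ℕ) : ∑ n ∈ T, ‖taylorCoeff F n‖ₑ * ENNReal.ofReal (s ^ n) ≤ ‖F s‖ₑ := by
  have h := hasSum_taylorCoeff hF (ofReal_mem_disc hs)
  have h2 : HasSum (fun n => a n * s ^ n) (F s).re := by
    refine (Complex.hasSum_re h).congr_fun fun n => ?_
    rw [ha, ← Complex.ofReal_pow, ← Complex.ofReal_mul, Complex.ofReal_re]
  have hnn : ∀ n, 0 ≤ a n * s ^ n := fun n => mul_nonneg (ha0 n) (pow_nonneg hs.1 n)
  have h3 : ∑ n ∈ T, a n * s ^ n ≤ (F s).re :=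
    sum_le_hasSum T (fun n _ => hnn n) h2
  calc ∑ n ∈ T, ‖taylorCoeff F n‖ₑ * ENNReal.ofReal (s ^ n)
      = ENNReal.ofReal (∑ n ∈ T, a n * s ^ n) := by
        rw [ENNReal.ofReal_sum_of_nonneg fun n _ => hnn n]
        refine Finset.sum_congr rfl fun n _ => ?_
        rw [ha, ← ofReal_norm, Complex.norm_real, Real.norm_eq_abs, abs_of_nonneg (ha0 n),
          ENNReal.ofReal_mul (ha0 n)]
    _ ≤ ENNReal.ofReal ‖F s‖ :=
        ENNReal.ofReal_le_ofReal (h3.trans (Complex.re_le_norm _))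
    _ = _ := ofReal_norm _

theorem IsUpperDoubling.exists_coeff_nonneg (hω : IsUpperDoubling ω) {u : ℝ → ℝ}
    (hu : IsTestFunction ω u) : ∃ a : ℕ → ℝ, (∀ n, 0 ≤ a n) ∧
      ∀ n, taylorCoeff (hilbertOp ω fun t => (u t : ℂ)) n = a n := by
  have hω' := hω.toIsRadialWeight
  refine ⟨fun n => hilbertCoeff ω n * ∫ t, u t * t ^ n * ω t ∂unitMeasure, fun n => ?_,
    fun n => ?_⟩
  · exact mul_nonneg (hω'.hilbertCoeff_pos n).le (integral_nonneg_of_ae (hu.ae_nonneg hω' n))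
  · rw [hω.taylorCoeff_hilbertOp hu.integrable_ofReal, weightedMoment_ofReal]
    push_cast
    rfl

theorem natCast_add_one_le_of_mem_block {k n : ℕ}
    (hn : n ∈ Finset.Ico (2 ^ k - 1) (2 ^ (k + 1) - 1)) :
    (n : ℝ≥0∞) + 1 ≤ 2 ^ (k + 1) := by
  rw [Finset.mem_Ico] at hn
  have : n + 1 ≤ 2 ^ (k + 1) := by omega
  exact_mod_cast this

theorem two_pow_mul_two_inv_pow (k : ℕ) : (2 : ℝ≥0∞) ^ k * 2⁻¹ ^ k = 1 := by
  rw [← mul_pow, ENNReal.mul_inv_cancel (by norm_num) (by norm_num), one_pow]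

/-- Each of the 2^k terms of block k is at least a constant times 4^{-k} h_k^p. -/
theorem IsUpperDoubling.exists_dyadicEnergy_le_hardyLittlewoodNorm (hω : IsUpperDoubling ω)
    {p : ℝ} (hp : 0 < p) :
    ∃ C : ℝ≥0∞, C ≠ ∞ ∧ ∀ u : ℝ → ℝ, IsTestFunction ω u →
      dyadicEnergy ω p (fun t => (u t : ℂ)) ≤
        C * hardyLittlewoodNorm p (hilbertOp ω fun t => (u t : ℂ)) ^ p := by
  obtain ⟨K, hK, h⟩ := hω.exists_tailAverage_le_coeff
  refine ⟨4 * K ^ p, ENNReal.mul_ne_top (by norm_num) (ENNReal.rpow_ne_top_of_nonneg hp.le hK),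
    fun u hu => ?_⟩
  unfold hardyLittlewoodNorm
  rw [← ENNReal.rpow_mul, one_div_mul_cancel hp.ne', ENNReal.rpow_one,
    tsum_eq_tsum_dyadic_blocks, ← ENNReal.tsum_mul_left]
  unfold dyadicEnergy
  refine ENNReal.tsum_le_tsum fun k => ?_
  set x := tailAverage ω (fun t => (u t : ℂ)) k with hx
  rw [Finset.mul_sum]
  have hterm : ∀ n ∈ Finset.Ico (2 ^ k - 1) (2 ^ (k + 1) - 1),
      2⁻¹ ^ k * (2⁻¹ ^ k * x ^ p) ≤ 4 * K ^ p *
        (‖taylorCoeff (hilbertOp ω fun t => (u t : ℂ)) n‖ₑ ^ p *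
          ((n : ℝ≥0∞) + 1) ^ (p - 2)) := fun n hn => by
    set y := ((n : ℝ≥0∞) + 1) * ‖taylorCoeff (hilbertOp ω fun t => (u t : ℂ)) n‖ₑ with hy
    have h0 : (n : ℝ≥0∞) + 1 ≠ 0 := by simp
    have ht : (n : ℝ≥0∞) + 1 ≠ ∞ := by finiteness
    have e1 : ‖taylorCoeff (hilbertOp ω fun t => (u t : ℂ)) n‖ₑ = y / ((n : ℝ≥0∞) + 1) := by
      rw [hy, mul_comm, ENNReal.mul_div_cancel_right h0 ht]
    rw [e1, natCast_add_one_rpow p n y hp]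
    have h1 : x ^ p ≤ K ^ p * y ^ p := by
      rw [← ENNReal.mul_rpow_of_nonneg _ _ hp.le]
      gcongr
      exact h u hu k n hn
    have h2 : (2⁻¹ : ℝ≥0∞) ^ k ≤ 2 * ((n : ℝ≥0∞) + 1)⁻¹ := by
      have h3 : ((2 : ℝ≥0∞) ^ (k + 1))⁻¹ ≤ ((n : ℝ≥0∞) + 1)⁻¹ :=
        ENNReal.inv_le_inv.2 (natCast_add_one_le_of_mem_block hn)
      calc (2⁻¹ : ℝ≥0∞) ^ k = (2 * 2⁻¹) * 2⁻¹ ^ k := by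
            rw [ENNReal.mul_inv_cancel (by norm_num) (by norm_num), one_mul]
        _ = 2 * ((2 : ℝ≥0∞) ^ (k + 1))⁻¹ := by rw [ENNReal.inv_pow]; ring
        _ ≤ _ := by gcongr
    calc 2⁻¹ ^ k * (2⁻¹ ^ k * x ^ p)
        ≤ (2 * ((n : ℝ≥0∞) + 1)⁻¹) * ((2 * ((n : ℝ≥0∞) + 1)⁻¹) * (K ^ p * y ^ p)) := by
          exact mul_le_mul' h2 (mul_le_mul' h2 h1)
      _ = _ := by ring
  calc 2⁻¹ ^ k * x ^ p = (2 ^ k * 2⁻¹ ^ k) * (2⁻¹ ^ k * x ^ p) := by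
        rw [two_pow_mul_two_inv_pow, one_mul]
    _ = ∑ n ∈ Finset.Ico (2 ^ k - 1) (2 ^ (k + 1) - 1), 2⁻¹ ^ k * (2⁻¹ ^ k * x ^ p) := by
        rw [Finset.sum_const, card_dyadic_block, nsmul_eq_mul]
        push_cast
        ring
    _ ≤ _ := Finset.sum_le_sum hterm

theorem ofReal_two_pow_four_mul_pow {k n : ℕ} {s : ℝ} (hs : node k ≤ s)
    (hn : n ∈ Finset.Ico (2 ^ k - 1) (2 ^ (k + 1) - 1)) :
    1 ≤ 16 * ENNReal.ofReal (s ^ n) := by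
  have h1 := one_sixteenth_le_node_pow hn
  have h2 : node k ^ n ≤ s ^ n := pow_le_pow_left₀ (node_nonneg k) hs n
  have e : (16 : ℝ≥0∞) = ENNReal.ofReal 16 := by norm_num
  rw [e, ← ENNReal.ofReal_mul (by norm_num), ← ENNReal.ofReal_one]
  refine ENNReal.ofReal_le_ofReal ?_
  norm_num at h1
  linarith

/-- The Taylor coefficients are non-negative, so F(s) dominates the part of its series over block k:
2^k terms of size at least 2^{-k} h_k up to a constant. -/
theorem IsUpperDoubling.exists_tailAverage_le_radius (hω : IsUpperDoubling ω) :
    ∃ K : ℝ≥0∞, K ≠ ∞ ∧ ∀ u : ℝ → ℝ, IsTestFunction ω u → ∀ k : ℕ,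
      ∀ s ∈ Set.Ico (node k) 1, tailAverage ω (fun t => (u t : ℂ)) k ≤
        K * ‖hilbertOp ω (fun t => (u t : ℂ)) s‖ₑ := by
  obtain ⟨K, hK, h⟩ := hω.exists_tailAverage_le_coeff
  refine ⟨K * 32, by finiteness, fun u hu k s hs => ?_⟩
  obtain ⟨a, ha0, ha⟩ := hω.exists_coeff_nonneg hu
  have h1 := sum_coeff_le_enorm (hω.differentiableOn_hilbertOp hu.integrable_ofReal) ha0 ha
    ⟨(node_nonneg k).trans hs.1, hs.2⟩ (Finset.Ico (2 ^ k - 1) (2 ^ (k + 1) - 1))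
  refine le_trans ?_ (mul_le_mul_right h1 _)
  set x := tailAverage ω (fun t => (u t : ℂ)) k with hx
  rw [Finset.mul_sum]
  calc x = 2 ^ k * 2⁻¹ ^ k * x := by rw [two_pow_mul_two_inv_pow, one_mul]
    _ = ∑ n ∈ Finset.Ico (2 ^ k - 1) (2 ^ (k + 1) - 1), 2⁻¹ ^ k * x := by
        rw [Finset.sum_const, card_dyadic_block, nsmul_eq_mul]
        push_cast
        ring
    _ ≤ _ := by
        refine Finset.sum_le_sum fun n hn => ?_
        set c := ‖taylorCoeff (hilbertOp ω fun t => (u t : ℂ)) n‖ₑ with hc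
        calc 2⁻¹ ^ k * x ≤ 2⁻¹ ^ k * (K * (((n : ℝ≥0∞) + 1) * c)) := by
              gcongr
              exact h u hu k n hn
          _ ≤ 2⁻¹ ^ k * (K * (2 ^ (k + 1) * c)) := by
              gcongr
              exact natCast_add_one_le_of_mem_block hn
          _ = (2 ^ k * 2⁻¹ ^ k) * (K * 2 * c) := by ring
          _ = K * 2 * c * 1 := by rw [two_pow_mul_two_inv_pow]; ring
          _ ≤ K * 2 * c * (16 * ENNReal.ofReal (s ^ n)) := by
              gcongr
              exact ofReal_two_pow_four_mul_pow hs.1 hn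
          _ = _ := by ring

/-- E(u) is dominated by ∫_0^1 |F(s)|^p ds, interval by interval, and Fejér–Riesz applies. -/
theorem IsUpperDoubling.exists_dyadicEnergy_le_hardyNorm (hω : IsUpperDoubling ω)
    {p p' : ℝ} (hpp' : p.HolderConjugate p') :
    ∃ C : ℝ≥0∞, C ≠ ∞ ∧ ∀ u : ℝ → ℝ, IsTestFunction ω u →
      dyadicEnergy ω p (fun t => (u t : ℂ)) ≤
        C * hardyNorm p (hilbertOp ω fun t => (u t : ℂ)) ^ p := by
  have hp := hpp'.pos
  obtain ⟨K, hK, h⟩ := hω.exists_tailAverage_le_radius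
  obtain ⟨C, hC, hFR⟩ := exists_fejerRiesz_const hpp'
  have hKp := ENNReal.rpow_ne_top_of_nonneg hp.le hK
  refine ⟨2 * K ^ p * C, by finiteness, fun u hu => ?_⟩
  rw [mul_assoc]
  refine le_trans ?_ (mul_le_mul_right (hFR _ (hω.differentiableOn_hilbertOp
    hu.integrable_ofReal)) _)
  rw [lintegral_Ico_eq_tsum, ← ENNReal.tsum_mul_left]
  unfold dyadicEnergy
  refine ENNReal.tsum_le_tsum fun k => ?_
  set x := tailAverage ω (fun t => (u t : ℂ)) k with hx
  rw [← lintegral_const_mul' _ _ (by finiteness)]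
  calc 2⁻¹ ^ k * x ^ p = ∫⁻ s in Set.Ico (node k) (node (k + 1)), 2 * x ^ p := by
        rw [setLIntegral_const, volume_Ico_node, pow_succ]
        calc 2⁻¹ ^ k * x ^ p = 2⁻¹ ^ k * x ^ p * (2 * 2⁻¹) := by
              rw [ENNReal.mul_inv_cancel (by norm_num) (by norm_num), mul_one]
          _ = _ := by ring
    _ ≤ _ := by
        refine setLIntegral_mono' measurableSet_Ico fun s hs => ?_
        rw [mul_assoc, ← ENNReal.mul_rpow_of_nonneg _ _ hp.le]
        gcongr 2 * ?_ ^ p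
        exact h u hu k s ⟨hs.1, hs.2.trans (node_lt_one _)⟩

/-- The argument on the radius applied to F', whose coefficients (n+1) a_{n+1} with n+1 in block k+1
are each at least of order h_{k+1}. Block 0 is lost under differentiation, hence the indices from 1
on. -/
theorem IsUpperDoubling.exists_tailAverage_le_deriv (hω : IsUpperDoubling ω) :
    ∃ K : ℝ≥0∞, K ≠ ∞ ∧ ∀ u : ℝ → ℝ, IsTestFunction ω u → ∀ k : ℕ,
      ∀ s ∈ Set.Ico (node (k + 1)) 1, 2 ^ (k + 1) * tailAverage ω (fun t => (u t : ℂ)) (k + 1) ≤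
        K * ‖deriv (hilbertOp ω (fun t => (u t : ℂ))) s‖ₑ := by
  obtain ⟨K, hK, h⟩ := hω.exists_tailAverage_le_coeff
  refine ⟨K * 32, by finiteness, fun u hu k s hs => ?_⟩
  obtain ⟨a, ha0, ha⟩ := hω.exists_coeff_nonneg hu
  have hF := hω.differentiableOn_hilbertOp hu.integrable_ofReal
  have hs0 : 0 ≤ s := (node_nonneg _).trans hs.1
  have htc : ∀ n : ℕ, taylorCoeff (deriv (hilbertOp ω fun t => (u t : ℂ))) n =
      ((n : ℂ) + 1) * taylorCoeff (hilbertOp ω fun t => (u t : ℂ)) (n + 1) := fun n => by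
    unfold taylorCoeff
    rw [← iteratedDeriv_succ', Nat.factorial_succ]
    push_cast
    have h1 : (n.factorial : ℂ) ≠ 0 := by exact_mod_cast n.factorial_ne_zero
    have h2 : (n + 1 : ℂ) ≠ 0 := by exact_mod_cast n.succ_ne_zero
    field_simp
  have h1 := sum_coeff_le_enorm (a := fun n => ((n : ℝ) + 1) * a (n + 1))
    (differentiableOn_deriv hF) (fun n => mul_nonneg (by positivity) (ha0 _))
    (fun n => by rw [htc, ha]; push_cast; rfl)
    ⟨hs0, hs.2⟩ (Finset.Ico (2 ^ (k + 1) - 2) (2 ^ (k + 1 + 1) - 2))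
  refine le_trans ?_ (mul_le_mul_right h1 _)
  set x := tailAverage ω (fun t => (u t : ℂ)) (k + 1) with hx
  rw [Finset.mul_sum]
  have hpow : 0 < 2 ^ k := by positivity
  have hcard : (Finset.Ico (2 ^ (k + 1) - 2) (2 ^ (k + 1 + 1) - 2)).card = 2 ^ (k + 1) := by
    rw [Nat.card_Ico, pow_succ, pow_succ]
    omega
  calc 2 ^ (k + 1) * x
      = ∑ n ∈ Finset.Ico (2 ^ (k + 1) - 2) (2 ^ (k + 1 + 1) - 2), x := by
        rw [Finset.sum_const, hcard, nsmul_eq_mul]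
        push_cast
        rfl
    _ ≤ _ := by
        refine Finset.sum_le_sum fun n hn => ?_
        have hn' : n + 1 ∈ Finset.Ico (2 ^ (k + 1) - 1) (2 ^ (k + 1 + 1) - 1) := by
          rw [Finset.mem_Ico] at hn ⊢
          rw [pow_succ, pow_succ] at hn ⊢
          omega
        have hen : ‖((n : ℂ) + 1)‖ₑ = (n : ℝ≥0∞) + 1 := by
          have e : ((n : ℂ) + 1) = ((n + 1 : ℝ) : ℂ) := by push_cast; rfl
          rw [e, ← ofReal_norm, Complex.norm_real, Real.norm_eq_abs, abs_of_nonneg (by positivity),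
            ENNReal.ofReal_add (by positivity) (by norm_num), ENNReal.ofReal_natCast,
            ENNReal.ofReal_one]
        rw [htc, enorm_mul, hen]
        set c := ‖taylorCoeff (hilbertOp ω fun t => (u t : ℂ)) (n + 1)‖ₑ with hc
        calc x ≤ K * (((n + 1 : ℕ) : ℝ≥0∞) + 1) * c := by
              rw [mul_assoc]
              exact h u hu (k + 1) (n + 1) hn'
          _ ≤ K * (2 * ((n : ℝ≥0∞) + 1)) * c * 1 := by
              rw [mul_one]
              gcongr
              have : n + 1 + 1 ≤ 2 * (n + 1) := by omega
              exact_mod_cast this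
          _ ≤ K * (2 * ((n : ℝ≥0∞) + 1)) * c * (16 * ENNReal.ofReal (s ^ n)) := by
              gcongr
              refine (ofReal_two_pow_four_mul_pow hs.1 hn').trans ?_
              gcongr 16 * ENNReal.ofReal ?_
              exact pow_le_pow_of_le_one hs0 hs.2.le (Nat.le_succ n)
          _ = _ := by ring

/-- The growth estimate evaluates at r², and squaring loses one node: (1-x)² ≥ 1-2x. -/
theorem node_succ_sq_ge (k : ℕ) {r : ℝ} (hr : node (k + 1) ≤ r) : node k ≤ r * r := by
  have h0 := node_nonneg (k + 1)
  have h1 : node (k + 1) * node (k + 1) ≤ r * r := mul_self_le_mul_self h0 hr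
  have h2 : node k ≤ node (k + 1) * node (k + 1) := by
    unfold node
    rw [pow_succ]
    nlinarith [sq_nonneg ((1 / 2 : ℝ) ^ k)]
  linarith

/-- The dyadic energy is controlled by the mixed norm away from the origin. -/
theorem IsUpperDoubling.exists_dyadicEnergy_le_mixed (hω : IsUpperDoubling ω)
    {p q q' : ℝ} (hp : 0 < p) (hqq' : q.HolderConjugate q') :
    ∃ C : ℝ≥0∞, C ≠ ∞ ∧ ∀ u : ℝ → ℝ, IsTestFunction ω u →
      dyadicEnergy ω p (fun t => (u t : ℂ)) ≤
        C * (‖hilbertOp ω (fun t => (u t : ℂ)) 0‖ₑ ^ p + ∫⁻ r in Set.Ico (1 / 2 : ℝ) 1,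
          integralMean q r (deriv (hilbertOp ω fun t => (u t : ℂ))) ^ p *
            ENNReal.ofReal ((1 - r) ^ (p * (1 - 1 / q)))) := by
  have hq := hqq'.pos
  have hq' := hqq'.symm.pos
  obtain ⟨K₀, hK₀, h₀⟩ := hω.exists_tailAverage_le_radius
  obtain ⟨K, hK, h⟩ := hω.exists_tailAverage_le_deriv
  obtain ⟨G, hG, hgrowth⟩ := exists_growth_const hqq'
  set g := invTwoPow (1 / q) with hg
  set g' := invTwoPow (1 / q') with hg'
  have hg0 : g ≠ 0 := invTwoPow_ne_zero _
  have hgt : g ≠ ∞ := invTwoPow_ne_top _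
  have hg0' : g' ≠ 0 := invTwoPow_ne_zero _
  have hgt' : g' ≠ ∞ := invTwoPow_ne_top _
  set K₁ : ℝ≥0∞ := K * G * (g'⁻¹) ^ 2 * g⁻¹ with hK₁
  have hK₁t : K₁ ≠ ∞ := by
    have h1 : g⁻¹ ≠ ∞ := ENNReal.inv_ne_top.2 hg0
    have h2 : g'⁻¹ ≠ ∞ := ENNReal.inv_ne_top.2 hg0'
    finiteness
  have hK₁p := ENNReal.rpow_ne_top_of_nonneg hp.le hK₁t
  have hK₀p := ENNReal.rpow_ne_top_of_nonneg hp.le hK₀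
  refine ⟨K₀ ^ p + 4 * K₁ ^ p, by finiteness, fun u hu => ?_⟩
  have hF := hω.differentiableOn_hilbertOp hu.integrable_ofReal
  set F := hilbertOp ω fun t => (u t : ℂ) with hFdef
  set x : ℕ → ℝ≥0∞ := tailAverage ω fun t => (u t : ℂ) with hx
  set φ : ℝ → ℝ≥0∞ := fun r => integralMean q r (deriv F) ^ p *
    ENNReal.ofReal ((1 - r) ^ (p * (1 - 1 / q))) with hφ
  -- Radii in [r_{k+2}, r_{k+3}) have r² ≥ r_{k+1}, where F' sees h_{k+1}; the remaining h_0 will be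
  -- controlled by F(0).
  have hpt : ∀ k, ∀ r ∈ Set.Ico (node (k + 2)) (node (k + 3)),
      x (k + 1) ^ p ≤ K₁ ^ p * φ r := fun k r hr => by
    have hr0 : 0 < r := by
      have h1 : node 1 = 1 / 2 := by unfold node; norm_num
      have h2 := node_mono (by omega : 1 ≤ k + 2)
      linarith [hr.1]
    have hr1 : r < 1 := hr.2.trans (node_lt_one _)
    have hw : (g' ^ (k + 3)) ^ p ≤ ENNReal.ofReal ((1 - r) ^ (p * (1 - 1 / q))) := by
      rw [one_sub_one_div_eq hqq', hg', invTwoPow_pow_rpow_eq]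
      refine ENNReal.ofReal_le_ofReal (Real.rpow_le_rpow (by positivity) ?_ (by positivity))
      have := hr.2
      unfold node at this
      linarith
    have hrr : ((r * r : ℝ)) ∈ Set.Ico (node (k + 1)) 1 :=
      ⟨node_succ_sq_ge (k + 1) hr.1, by nlinarith⟩
    have hd := h u hu k (r * r) hrr
    have hgr := hgrowth (deriv F) (differentiableOn_deriv hF) (k + 2) r hr0 hr.2
    have hkey : x (k + 1) ≤ K₁ * (integralMean q r (deriv F) * g' ^ (k + 3)) := by
      have e1 : (g * g') ^ (k + 1) * 2 ^ (k + 1) = 1 := by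
        rw [hg, hg', invTwoPow_mul hqq', ← mul_pow,
          ENNReal.inv_mul_cancel (by norm_num) (by norm_num), one_pow]
      have e2 : g * g⁻¹ = 1 := ENNReal.mul_inv_cancel hg0 hgt
      have e3 : g' * g'⁻¹ = 1 := ENNReal.mul_inv_cancel hg0' hgt'
      -- The gain 2^{k+1} is split as 2^{(k+1)/q} 2^{(k+1)/q'}: the growth estimate consumes the
      -- first factor, the weight (1-r)^{p/q'} the second.
      calc x (k + 1) = (g * g') ^ (k + 1) * (2 ^ (k + 1) * x (k + 1)) := by
            rw [← mul_assoc, e1, one_mul]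
        _ ≤ (g * g') ^ (k + 1) * (K * ‖deriv F ((r * r : ℝ) : ℂ)‖ₑ) := by gcongr
        _ = (g * g') ^ (k + 1) * (K * ‖deriv F ((r * r : ℝ) : ℂ)‖ₑ) * (g * g⁻¹) := by
            rw [e2, mul_one]
        _ = g' ^ (k + 1) * K * g⁻¹ * (g ^ (k + 2) * ‖deriv F ((r * r : ℝ) : ℂ)‖ₑ) := by
            ring
        _ ≤ g' ^ (k + 1) * K * g⁻¹ * (G * integralMean q r (deriv F)) := by gcongr
        _ = g' ^ (k + 1) * K * g⁻¹ * (G * integralMean q r (deriv F)) * (g' * g'⁻¹) ^ 2 := by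
            rw [e3, one_pow, mul_one]
        _ = _ := by rw [hK₁]; ring
    calc x (k + 1) ^ p ≤ (K₁ * (integralMean q r (deriv F) * g' ^ (k + 3))) ^ p := by gcongr
      _ = K₁ ^ p * (integralMean q r (deriv F) ^ p * (g' ^ (k + 3)) ^ p) := by
          rw [ENNReal.mul_rpow_of_nonneg K₁ _ hp.le,
            ENNReal.mul_rpow_of_nonneg (integralMean q r (deriv F)) _ hp.le]
      _ ≤ _ := by
          simp only [hφ]
          gcongr
  have htail : ∑' k, 2⁻¹ ^ (k + 1) * x (k + 1) ^ p ≤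
      4 * K₁ ^ p * ∫⁻ r in Set.Ico (1 / 2 : ℝ) 1, φ r := by
    have h1 : ∑' k, ∫⁻ r in Set.Ico (node (k + 2)) (node (k + 3)), φ r ≤
        ∫⁻ r in Set.Ico (1 / 2 : ℝ) 1, φ r := by
      have hdisj : Pairwise (Function.onFun Disjoint
          fun k => Set.Ico (node (k + 2)) (node (k + 3))) := by
        have hm : Monotone fun k : ℕ => node (k + 2) := fun a b hab => node_mono (by omega)
        exact hm.pairwise_disjoint_on_Ico_succ
      rw [← lintegral_iUnion (fun _ => measurableSet_Ico) hdisj]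
      refine lintegral_mono_set (Set.iUnion_subset fun k r hr => ⟨?_, hr.2.trans (node_lt_one _)⟩)
      have h1 : node 1 = 1 / 2 := by unfold node; norm_num
      rw [← h1]
      exact (node_mono (by omega)).trans hr.1
    refine le_trans ?_ (mul_le_mul_right h1 _)
    rw [← ENNReal.tsum_mul_left]
    refine ENNReal.tsum_le_tsum fun k => ?_
    rw [← lintegral_const_mul' _ _ (by finiteness)]
    calc 2⁻¹ ^ (k + 1) * x (k + 1) ^ p
        = ∫⁻ r in Set.Ico (node (k + 2)) (node (k + 3)), 4 * x (k + 1) ^ p := by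
          rw [setLIntegral_const, volume_Ico_node]
          calc 2⁻¹ ^ (k + 1) * x (k + 1) ^ p =
                2⁻¹ ^ (k + 1) * x (k + 1) ^ p * (2 * 2⁻¹) ^ 2 := by
                rw [ENNReal.mul_inv_cancel (by norm_num) (by norm_num), one_pow, mul_one]
            _ = _ := by ring
      _ ≤ _ := by
          refine setLIntegral_mono' measurableSet_Ico fun r hr => ?_
          rw [mul_assoc]
          exact mul_le_mul_right (hpt k r hr) _
  have hzero : x 0 ^ p ≤ K₀ ^ p * ‖F 0‖ₑ ^ p := by
    rw [← ENNReal.mul_rpow_of_nonneg _ _ hp.le]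
    gcongr ?_ ^ p
    have := h₀ u hu 0 0 ⟨by rw [node_zero], by norm_num⟩
    simpa using this
  have hsplit : dyadicEnergy ω p (fun t => (u t : ℂ)) =
      x 0 ^ p + ∑' k, 2⁻¹ ^ (k + 1) * x (k + 1) ^ p := by
    unfold dyadicEnergy
    rw [tsum_eq_zero_add' ENNReal.summable]
    simp [hx]
  rw [hsplit]
  calc _ ≤ K₀ ^ p * ‖F 0‖ₑ ^ p + 4 * K₁ ^ p * ∫⁻ r in Set.Ico (1 / 2 : ℝ) 1, φ r :=
        add_le_add hzero htail
    _ ≤ (K₀ ^ p + 4 * K₁ ^ p) * ‖F 0‖ₑ ^ p +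
        (K₀ ^ p + 4 * K₁ ^ p) * ∫⁻ r in Set.Ico (1 / 2 : ℝ) 1, φ r := by
        gcongr
        · exact le_self_add
        · exact le_add_self
    _ = _ := by rw [← mul_add]

theorem IsUpperDoubling.exists_dyadicEnergy_le_mixedNorm (hω : IsUpperDoubling ω)
    {p q q' : ℝ} (hp : 0 < p) (hqq' : q.HolderConjugate q') :
    ∃ C : ℝ≥0∞, C ≠ ∞ ∧ ∀ u : ℝ → ℝ, IsTestFunction ω u →
      dyadicEnergy ω p (fun t => (u t : ℂ)) ≤
        C * mixedNorm p q (p * (1 - 1 / q)) (hilbertOp ω fun t => (u t : ℂ)) ^ p := by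
  obtain ⟨C, hC, h⟩ := hω.exists_dyadicEnergy_le_mixed hp hqq'
  refine ⟨C, hC, fun u hu => (h u hu).trans ?_⟩
  unfold mixedNorm
  rw [← ENNReal.rpow_mul, one_div_mul_cancel hp.ne', ENNReal.rpow_one]
  gcongr
  norm_num

/-- In polar coordinates the weight carries a factor 2r and dominates (1-r)^{p-1} for r ≥ 1/2. The
factor vanishes at 0, and this is why the integral in `IsUpperDoubling.exists_dyadicEnergy_le_mixed`
starts at 1/2. -/
theorem IsUpperDoubling.exists_dyadicEnergy_le_dirichletNorm (hω : IsUpperDoubling ω)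
    {p p' : ℝ} (hpp' : p.HolderConjugate p') :
    ∃ C : ℝ≥0∞, C ≠ ∞ ∧ ∀ u : ℝ → ℝ, IsTestFunction ω u →
      dyadicEnergy ω p (fun t => (u t : ℂ)) ≤
        C * dirichletNorm p (hilbertOp ω fun t => (u t : ℂ)) ^ p := by
  have hp := hpp'.pos
  have hp1 := hpp'.lt
  obtain ⟨C, hC, h⟩ := hω.exists_dyadicEnergy_le_mixed hp hpp'
  refine ⟨C, hC, fun u hu => (h u hu).trans ?_⟩
  unfold dirichletNorm
  rw [← ENNReal.rpow_mul, one_div_mul_cancel hp.ne', ENNReal.rpow_one,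
    bergmanNormPow_eq (measurable_standardWeight _).aestronglyMeasurable hp
      (differentiableOn_deriv (hω.differentiableOn_hilbertOp hu.integrable_ofReal)).continuousOn]
  have e : p * (1 - 1 / p) = p - 1 := by field_simp
  rw [e]
  gcongr C * (_ + ?_)
  refine le_trans ?_ (lintegral_mono_set (s := Set.Ico (1 / 2 : ℝ) 1)
    fun r hr => ⟨by linarith [hr.1], hr.2⟩)
  refine setLIntegral_mono' measurableSet_Ico fun r hr => ?_
  rw [mul_comm]
  gcongr
  rw [← ENNReal.ofReal_mul (by linarith [hr.1])]
  refine ENNReal.ofReal_le_ofReal ?_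
  unfold standardWeight
  have h1 : (1 - r) ^ (p - 1) ≤ (1 - r ^ 2) ^ (p - 1) :=
    Real.rpow_le_rpow (by linarith [hr.2]) (by nlinarith [hr.1, hr.2]) (by linarith)
  have h2 : 0 ≤ (1 - r) ^ (p - 1) := Real.rpow_nonneg (by linarith [hr.2]) _
  have h3 : 1 ≤ 2 * r := by linarith [hr.1]
  calc (1 - r) ^ (p - 1) ≤ 1 * (1 * (1 - r ^ 2) ^ (p - 1)) := by linarith
    _ ≤ 2 * r * ((p - 1 + 1) * (1 - r ^ 2) ^ (p - 1)) := by
        have h4 : 0 ≤ (1 - r ^ 2) ^ (p - 1) := h2.trans h1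
        exact mul_le_mul h3 (mul_le_mul_of_nonneg_right (by linarith) h4) (by linarith)
          (by linarith)

end

section


/-! ### A discrete Hardy inequality with weights -/

theorem le_inv_mul_of_mul_le {c x y : ℝ≥0∞} (h0 : c ≠ 0) (ht : c ≠ ∞) (h : c * x ≤ y) :
    x ≤ c⁻¹ * y := by
  rw [mul_comm, ← div_eq_mul_inv, ENNReal.le_div_iff_mul_le (Or.inl h0) (Or.inl ht), mul_comm]
  exact h

/-- Concavity of t^a: its graph lies below the tangent at w+y. In the form of Bernoulli's
inequality, (1 - w/(w+y))^a ≤ 1 - a w/(w+y). -/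
theorem mul_rpow_sub_one_add_rpow_le {a : ℝ} (ha0 : 0 < a) (ha1 : a < 1) {w y : ℝ≥0∞}
    (h0 : w + y ≠ 0) (ht : w + y ≠ ∞) :
    ENNReal.ofReal a * (w * (w + y) ^ (a - 1)) + y ^ a ≤ (w + y) ^ a := by
  obtain ⟨hw, hy⟩ := ENNReal.add_ne_top.1 ht
  lift w to ℝ≥0 using hw
  lift y to ℝ≥0 using hy
  have hx : 0 < w + y := pos_iff_ne_zero.2 (by exact_mod_cast h0)
  have key : a * ((w : ℝ) * ((w : ℝ) + y) ^ (a - 1)) + (y : ℝ) ^ a ≤ ((w : ℝ) + y) ^ a := by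
    have hx' : (0 : ℝ) < (w : ℝ) + y := by exact_mod_cast hx
    have h := rpow_one_add_le_one_add_mul_self (s := -((w : ℝ) / (w + y))) (by
      rw [neg_le_neg_iff, div_le_one hx']
      linarith [y.2]) ha0.le ha1.le
    have e : 1 + -((w : ℝ) / (w + y)) = y / (w + y) := by field_simp; ring
    rw [e, Real.div_rpow y.coe_nonneg hx'.le, div_le_iff₀ (by positivity)] at h
    rw [Real.rpow_sub_one hx'.ne']
    refine le_trans (add_le_add_right h _) (le_of_eq ?_)
    field_simp
    ring
  have h1 : ((w : ℝ≥0∞) + y) = ((w + y : ℝ≥0) : ℝ≥0∞) := by push_cast; rfl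
  rw [h1, ← ENNReal.coe_rpow_of_ne_zero hx.ne', ← ENNReal.coe_rpow_of_nonneg _ ha0.le,
    ← ENNReal.coe_rpow_of_nonneg _ ha0.le, ENNReal.ofReal]
  norm_cast
  rw [← NNReal.coe_le_coe]
  push_cast
  rw [Real.coe_toNNReal _ ha0.le]
  exact key

/-- Telescoping the concavity inequality W_j^a - W_{j+1}^a ≥ a w_j W_j^{a-1} over j ≥ k, the
discrete form of integrating x^{a-1}. -/
theorem tsum_mul_rpow_sub_one_le {a : ℝ} (ha0 : 0 < a) (ha1 : a < 1) {w W : ℕ → ℝ≥0∞}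
    (hW : ∀ k, W k = w k + W (k + 1)) (h0 : ∀ k, W k ≠ 0) (ht : ∀ k, W k ≠ ∞) (k : ℕ) :
    ENNReal.ofReal a * ∑' j, (if k ≤ j then w j * W j ^ (a - 1) else 0) ≤ W k ^ a := by
  rw [← ENNReal.tsum_mul_left]
  have hstep : ∀ n, k ≤ n → (∑ j ∈ Finset.range n, ENNReal.ofReal a *
      (if k ≤ j then w j * W j ^ (a - 1) else 0)) + W n ^ a ≤ W k ^ a := by
    intro n hn
    induction n, hn using Nat.le_induction with
    | base =>
      rw [Finset.sum_eq_zero, zero_add]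
      intro j hj
      simp [Finset.mem_range.1 hj]
    | succ n hn ih =>
      refine le_trans ?_ ih
      rw [Finset.sum_range_succ, add_assoc, if_pos hn]
      refine add_le_add_right ?_ _
      have := mul_rpow_sub_one_add_rpow_le ha0 ha1 (w := w n) (y := W (n + 1))
        (hW n ▸ h0 n) (hW n ▸ ht n)
      rwa [← hW n] at this
  refine ENNReal.tsum_le_of_sum_range_le fun n => ?_
  calc _ ≤ ∑ j ∈ Finset.range (max k n), ENNReal.ofReal a *
        (if k ≤ j then w j * W j ^ (a - 1) else 0) :=
        Finset.sum_le_sum_of_subset (Finset.range_mono (le_max_right _ _))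
    _ ≤ _ := le_self_add.trans (hstep _ (le_max_left _ _))

theorem sum_mul_rpow_sub_one_le {a : ℝ} (ha0 : 0 < a) (ha1 : a < 1) {v V : ℕ → ℝ≥0∞}
    (hV0 : V 0 = v 0) (hV : ∀ k, V (k + 1) = v (k + 1) + V k) (h0 : ∀ k, V k ≠ 0)
    (ht : ∀ k, V k ≠ ∞) (k : ℕ) :
    ENNReal.ofReal a * ∑ i ∈ Finset.range (k + 1), v i * V i ^ (a - 1) ≤ V k ^ a := by
  induction k with
  | zero =>
    have := mul_rpow_sub_one_add_rpow_le ha0 ha1 (w := v 0) (y := 0)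
      (by simpa [hV0] using h0 0) (by simpa [hV0] using ht 0)
    rw [add_zero] at this
    simpa [hV0] using le_self_add.trans this
  | succ k ih =>
    rw [Finset.sum_range_succ, mul_add]
    have := mul_rpow_sub_one_add_rpow_le ha0 ha1 (w := v (k + 1)) (y := V k)
      (hV k ▸ h0 _) (hV k ▸ ht _)
    rw [← hV k] at this
    refine le_trans ?_ this
    rw [add_comm]
    exact add_le_add_right ih _

/-- Schur's test with the auxiliary weight W_j^{1/(pq)}. The row sums are Σ_{j≥k} w_j W_j^{1/q-1} ≤
q W_k^{1/q}. Raised to the power p/q and combined with the hypothesis they cost V_k^{1/p-1}, so the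
column sums telescope, Σ_{k≤j} v_k V_k^{1/p-1} ≤ p V_j^{1/p}, and the hypothesis bounds what
remains, V_j^{1/p} W_j^{1/q}. -/
theorem exists_weighted_hardy_const {p q : ℝ} (hpq : p.HolderConjugate q) {M : ℝ≥0∞}
    (hM : M ≠ ∞) : ∃ B : ℝ≥0∞, B ≠ ∞ ∧ ∀ v V w W : ℕ → ℝ≥0∞,
      V 0 = v 0 → (∀ k, V (k + 1) = v (k + 1) + V k) → (∀ k, W k = w k + W (k + 1)) →
      (∀ k, V k ≠ 0) → (∀ k, V k ≠ ∞) → (∀ k, W k ≠ 0) → (∀ k, W k ≠ ∞) →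
      (∀ k, V k * W k ^ (p - 1) ≤ M) → ∀ a : ℕ → ℝ≥0∞,
      ∑' k, v k * (∑' j, if k ≤ j then w j ^ (1 / q) * a j else 0) ^ p ≤ B * ∑' j, a j ^ p := by
  have hp := hpq.pos
  have hq := hpq.symm.pos
  have hp1 := hpq.lt
  have hq1 := hpq.symm.lt
  have hip : 1 / p < 1 := by rw [div_lt_one hp]; exact hp1
  have hiq : 1 / q < 1 := by rw [div_lt_one hq]; exact hq1
  have hsum : 1 / p + 1 / q = 1 := by simpa using hpq.inv_add_inv_eq_one
  have hpq' : p / q = p - 1 := by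
    field_simp at hsum
    rw [div_eq_iff hq.ne']
    linarith
  set α := (ENNReal.ofReal (1 / q))⁻¹ with hα
  set β := (ENNReal.ofReal (1 / p))⁻¹ with hβ
  have hα0 : ENNReal.ofReal (1 / q) ≠ 0 := by simpa using hq
  have hβ0 : ENNReal.ofReal (1 / p) ≠ 0 := by simpa using hp
  have hαt : α ≠ ∞ := ENNReal.inv_ne_top.2 hα0
  have hβt : β ≠ ∞ := ENNReal.inv_ne_top.2 hβ0
  refine ⟨α ^ (p - 1) * M ^ (1 / q) * (β * M ^ (1 / p)), ?_, ?_⟩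
  · have h1 : α ^ (p - 1) ≠ ∞ := ENNReal.rpow_ne_top_of_nonneg (by linarith) hαt
    have h2 : M ^ (1 / q) ≠ ∞ := ENNReal.rpow_ne_top_of_nonneg (by positivity) hM
    have h3 : M ^ (1 / p) ≠ ∞ := ENNReal.rpow_ne_top_of_nonneg (by positivity) hM
    exact ENNReal.mul_ne_top (ENNReal.mul_ne_top h1 h2) (ENNReal.mul_ne_top hβt h3)
  intro v V w W hV0 hV hW hVne hVt hWne hWt hVW a
  set K₁ : ℕ → ℕ → ℝ≥0∞ :=
    fun k j => if k ≤ j then w j ^ (1 / q) * W j ^ (-(1 / p) * (1 / q)) else 0 with hK₁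
  set K₂ : ℕ → ℕ → ℝ≥0∞ :=
    fun k j => if k ≤ j then v k ^ (1 / p) * W j ^ ((1 / p) * (1 / q)) else 0 with hK₂
  have hA : ∀ k, ∑' j, K₁ k j ^ q ≤ α * W k ^ (1 / q) := by
    intro k
    have h := tsum_mul_rpow_sub_one_le (a := 1 / q) (by positivity) hiq hW hWne hWt k
    replace h := le_inv_mul_of_mul_le hα0 ENNReal.ofReal_ne_top h
    refine le_trans (le_of_eq (tsum_congr fun j => ?_)) h
    simp only [hK₁]
    split_ifs
    · rw [ENNReal.mul_rpow_of_nonneg _ _ hq.le, ← ENNReal.rpow_mul, ← ENNReal.rpow_mul,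
        one_div_mul_cancel hq.ne', ENNReal.rpow_one, mul_assoc, one_div_mul_cancel hq.ne', mul_one]
      congr 2
      linarith
    · exact ENNReal.zero_rpow_of_pos hq
  have hWk : ∀ k, (W k ^ (1 / q)) ^ (p - 1) ≤ M ^ (1 / q) * V k ^ (1 / p - 1) := by
    intro k
    have h1 : W k ^ (p - 1) ≤ M / V k := by
      rw [ENNReal.le_div_iff_mul_le (Or.inl (hVne k)) (Or.inl (hVt k)), mul_comm]
      exact hVW k
    have e : 1 / p - 1 = -(1 / q) := by linarith
    rw [← ENNReal.rpow_mul, mul_comm, ENNReal.rpow_mul, e, ENNReal.rpow_neg, ← ENNReal.inv_rpow,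
      ← ENNReal.mul_rpow_of_nonneg _ _ (by positivity), ← div_eq_mul_inv]
    gcongr
  have hB : ∀ j, ∑' k, (α * W k ^ (1 / q)) ^ (p / q) * K₂ k j ^ p ≤
      α ^ (p - 1) * M ^ (1 / q) * (β * M ^ (1 / p)) := by
    intro j
    have hfin : ∑' k, (α * W k ^ (1 / q)) ^ (p / q) * K₂ k j ^ p =
        ∑ k ∈ Finset.range (j + 1), (α * W k ^ (1 / q)) ^ (p / q) * K₂ k j ^ p := by
      refine tsum_eq_sum fun k hk => ?_
      have : ¬ k ≤ j := by simpa [Nat.lt_succ_iff] using hk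
      simp [hK₂, this, hp]
    rw [hfin]
    have hs := sum_mul_rpow_sub_one_le (a := 1 / p) (by positivity) hip hV0 hV hVne hVt j
    replace hs := le_inv_mul_of_mul_le hβ0 ENNReal.ofReal_ne_top hs
    have hend : V j ^ (1 / p) * W j ^ (1 / q) ≤ M ^ (1 / p) := by
      have e : W j ^ (1 / q) = (W j ^ (p - 1)) ^ (1 / p) := by
        rw [← ENNReal.rpow_mul, ← hpq']
        congr 1
        field_simp
      rw [e, ← ENNReal.mul_rpow_of_nonneg _ _ (by positivity)]
      gcongr
      exact hVW j
    calc ∑ k ∈ Finset.range (j + 1), (α * W k ^ (1 / q)) ^ (p / q) * K₂ k j ^ p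
        ≤ ∑ k ∈ Finset.range (j + 1), α ^ (p - 1) * M ^ (1 / q) * W j ^ (1 / q) *
            (v k * V k ^ (1 / p - 1)) := by
          refine Finset.sum_le_sum fun k hk => ?_
          have hkj : k ≤ j := by simpa [Nat.lt_succ_iff] using hk
          simp only [hK₂, if_pos hkj]
          rw [hpq', ENNReal.mul_rpow_of_nonneg _ _ (by linarith : 0 ≤ p - 1),
            ENNReal.mul_rpow_of_nonneg _ _ hp.le, ← ENNReal.rpow_mul (v k),
            ← ENNReal.rpow_mul (W j), one_div_mul_cancel hp.ne', ENNReal.rpow_one,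
            mul_right_comm (1 / p), one_div_mul_cancel hp.ne', one_mul]
          calc _ ≤ α ^ (p - 1) * (M ^ (1 / q) * V k ^ (1 / p - 1)) * (v k * W j ^ (1 / q)) := by
                exact mul_le_mul_left (mul_le_mul_right (hWk k) _) _
            _ = _ := by ring
      _ = α ^ (p - 1) * M ^ (1 / q) * W j ^ (1 / q) *
            ∑ k ∈ Finset.range (j + 1), v k * V k ^ (1 / p - 1) := by rw [Finset.mul_sum]
      _ ≤ α ^ (p - 1) * M ^ (1 / q) * W j ^ (1 / q) * (β * V j ^ (1 / p)) := by gcongr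
      _ = α ^ (p - 1) * M ^ (1 / q) * (β * (V j ^ (1 / p) * W j ^ (1 / q))) := by ring
      _ ≤ _ := by gcongr
  refine le_trans (le_of_eq (tsum_congr fun k => ?_)) (tsum_schur hpq K₁ K₂ _ _ hA hB a)
  have e1 : v k = (v k ^ (1 / p)) ^ p := by
    rw [← ENNReal.rpow_mul, one_div_mul_cancel hp.ne', ENNReal.rpow_one]
  nth_rewrite 1 [e1]
  rw [← ENNReal.mul_rpow_of_nonneg _ _ hp.le, ← ENNReal.tsum_mul_left]
  congr 1
  refine tsum_congr fun j => ?_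
  simp only [hK₁, hK₂]
  split_ifs
  · have e2 : W j ^ (-(1 / p) * (1 / q)) * W j ^ ((1 / p) * (1 / q)) = 1 := by
      rw [← ENNReal.rpow_add _ _ (hWne j) (hWt j)]
      simp
    calc _ = v k ^ (1 / p) * (w j ^ (1 / q) * a j) *
          (W j ^ (-(1 / p) * (1 / q)) * W j ^ ((1 / p) * (1 / q))) := by rw [e2, mul_one]
      _ = _ := by ring
  · simp

end

section


/-! ### The Muckenhoupt condition on dyadic points -/

variable {ω : ℝ → ℝ}

/-- The weight `2^{-k} ω̂(1-2^{-k})^{-p}`. -/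
def dyadicWeight (ω : ℝ → ℝ) (p : ℝ) (k : ℕ) : ℝ≥0∞ :=
  2⁻¹ ^ k * (ENNReal.ofReal (tail ω (node k)))⁻¹ ^ p

/-- The partial sums of the weights `2^{-k} ω̂(1-2^{-k})^{-p}`. -/
def dyadicMass (ω : ℝ → ℝ) (p : ℝ) (k : ℕ) : ℝ≥0∞ :=
  ∑ i ∈ Finset.range (k + 1), dyadicWeight ω p i

/-- The integral of `ω^q` over `[r,1)`. -/
def tailPower (ω : ℝ → ℝ) (q r : ℝ) : ℝ≥0∞ := ∫⁻ t in Set.Ico r 1, ENNReal.ofReal (ω t) ^ q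

/-- The function `1 + ∫_0^r ω̂(t)^{-p} dt`. -/
def headMass (ω : ℝ → ℝ) (p r : ℝ) : ℝ≥0∞ :=
  1 + ∫⁻ t in Set.Ico 0 r, (ENNReal.ofReal (tail ω t))⁻¹ ^ p

theorem dyadicMass_zero (ω : ℝ → ℝ) (p : ℝ) : dyadicMass ω p 0 = dyadicWeight ω p 0 := by
  simp [dyadicMass]

theorem dyadicMass_succ (ω : ℝ → ℝ) (p : ℝ) (k : ℕ) :
    dyadicMass ω p (k + 1) = dyadicWeight ω p (k + 1) + dyadicMass ω p k := by
  rw [dyadicMass, Finset.sum_range_succ, add_comm]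
  rfl

theorem IsRadialWeight.dyadicWeight_ne_top (hω : IsRadialWeight ω) {p : ℝ} (hp : 0 ≤ p) (k : ℕ) :
    dyadicWeight ω p k ≠ ∞ := by
  have h := hω.tail_node_pos k
  exact ENNReal.mul_ne_top (by finiteness) (ENNReal.rpow_ne_top_of_nonneg hp
    (ENNReal.inv_ne_top.2 (by simpa using h)))

theorem dyadicWeight_ne_zero (ω : ℝ → ℝ) {p : ℝ} (hp : 0 ≤ p) (k : ℕ) :
    dyadicWeight ω p k ≠ 0 := by
  refine mul_ne_zero (pow_ne_zero _ (by simp)) ?_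
  rw [Ne, ENNReal.rpow_eq_zero_iff]
  simp [hp.not_gt]

theorem IsRadialWeight.dyadicMass_ne_top (hω : IsRadialWeight ω) {p : ℝ} (hp : 0 ≤ p) (k : ℕ) :
    dyadicMass ω p k ≠ ∞ :=
  ENNReal.sum_ne_top.2 fun i _ => hω.dyadicWeight_ne_top hp i

theorem dyadicMass_ne_zero (ω : ℝ → ℝ) {p : ℝ} (hp : 0 ≤ p) (k : ℕ) : dyadicMass ω p k ≠ 0 := by
  intro h
  exact dyadicWeight_ne_zero ω hp 0 (Finset.sum_eq_zero_iff.1 h 0 (by simp))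

theorem headMass_mono (ω : ℝ → ℝ) (p : ℝ) : Monotone (headMass ω p) := fun _ _ h =>
  add_le_add_right (lintegral_mono_set (Set.Ico_subset_Ico_right h)) _

theorem tailPower_anti (ω : ℝ → ℝ) (q : ℝ) : Antitone (tailPower ω q) := fun _ _ h =>
  lintegral_mono_set (Set.Ico_subset_Ico_left h)

theorem lintegral_Ico_add (φ : ℝ → ℝ≥0∞) {a b c : ℝ} (hab : a ≤ b) (hbc : b ≤ c) :
    ∫⁻ t in Set.Ico a c, φ t = (∫⁻ t in Set.Ico a b, φ t) + ∫⁻ t in Set.Ico b c, φ t := by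
  rw [← Set.Ico_union_Ico_eq_Ico hab hbc]
  exact lintegral_union measurableSet_Ico
    (Set.disjoint_left.2 fun t h1 h2 => absurd h1.2 (not_lt.2 h2.1))

theorem headMass_node_succ (ω : ℝ → ℝ) (p : ℝ) (k : ℕ) :
    headMass ω p (node (k + 1)) = headMass ω p (node k) +
      ∫⁻ t in Set.Ico (node k) (node (k + 1)), (ENNReal.ofReal (tail ω t))⁻¹ ^ p := by
  unfold headMass
  rw [lintegral_Ico_add _ (node_nonneg k) (node_mono (Nat.le_succ k)), add_assoc]

/-- On [r_k, r_{k+1}) the tail lies between its values at the endpoints, which doubling makes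
comparable. -/
theorem IsUpperDoubling.exists_dyadicWeight_bounds (hω : IsUpperDoubling ω) {p : ℝ} (hp : 0 ≤ p) :
    ∃ K : ℝ≥0∞, K ≠ ∞ ∧ ∀ k,
      dyadicWeight ω p (k + 1) ≤
        K * ∫⁻ t in Set.Ico (node k) (node (k + 1)), (ENNReal.ofReal (tail ω t))⁻¹ ^ p ∧
      ∫⁻ t in Set.Ico (node k) (node (k + 1)), (ENNReal.ofReal (tail ω t))⁻¹ ^ p ≤
        K * dyadicWeight ω p k := by
  obtain ⟨C, hC, h⟩ := hω.exists_tail_node_le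
  have hω' := hω.toIsRadialWeight
  have hC0 : 0 < C := by linarith
  have hstep : ∀ k, (ENNReal.ofReal (tail ω (node (k + 1))))⁻¹ ^ p ≤
      ENNReal.ofReal C ^ p * (ENNReal.ofReal (tail ω (node k)))⁻¹ ^ p := by
    intro k
    rw [← ENNReal.mul_rpow_of_nonneg _ _ hp]
    gcongr ?_ ^ p
    have h1 := hω'.tail_node_pos k
    have h2 := hω'.tail_node_pos (k + 1)
    rw [← ENNReal.ofReal_inv_of_pos h1, ← ENNReal.ofReal_inv_of_pos h2,
      ← ENNReal.ofReal_mul hC0.le]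
    refine ENNReal.ofReal_le_ofReal ?_
    rw [← div_eq_mul_inv, inv_eq_one_div, div_le_div_iff₀ h2 h1]
    linarith [h k]
  refine ⟨ENNReal.ofReal C ^ p, ENNReal.rpow_ne_top_of_nonneg hp ENNReal.ofReal_ne_top,
    fun k => ⟨?_, ?_⟩⟩
  · calc dyadicWeight ω p (k + 1)
        ≤ 2⁻¹ ^ (k + 1) *
          (ENNReal.ofReal C ^ p * (ENNReal.ofReal (tail ω (node k)))⁻¹ ^ p) :=
          mul_le_mul_right (hstep k) _
      _ = ENNReal.ofReal C ^ p * ∫⁻ _ in Set.Ico (node k) (node (k + 1)),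
          (ENNReal.ofReal (tail ω (node k)))⁻¹ ^ p := by
          rw [setLIntegral_const, volume_Ico_node]
          ring
      _ ≤ _ := by
          refine mul_le_mul_right (setLIntegral_mono' measurableSet_Ico fun t ht => ?_) _
          gcongr
          exact hω'.tail_anti (node_nonneg k) ht.1
  · calc ∫⁻ t in Set.Ico (node k) (node (k + 1)), (ENNReal.ofReal (tail ω t))⁻¹ ^ p
        ≤ ∫⁻ _ in Set.Ico (node k) (node (k + 1)),
          (ENNReal.ofReal (tail ω (node (k + 1))))⁻¹ ^ p := by
          refine setLIntegral_mono' measurableSet_Ico fun t ht => ?_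
          gcongr
          exact hω'.tail_anti ((node_nonneg k).trans ht.1) ht.2.le
      _ ≤ 2⁻¹ ^ k * (ENNReal.ofReal C ^ p * (ENNReal.ofReal (tail ω (node k)))⁻¹ ^ p) := by
          rw [setLIntegral_const, volume_Ico_node, mul_comm]
          refine mul_le_mul' ?_ (hstep k)
          exact pow_le_pow_right_of_le_one' (by simp) (Nat.le_succ k)
      _ = _ := by unfold dyadicWeight; ring

theorem IsUpperDoubling.exists_dyadicMass_le (hω : IsUpperDoubling ω) {p : ℝ} (hp : 0 ≤ p) :
    ∃ K : ℝ≥0∞, K ≠ ∞ ∧ ∀ k, dyadicMass ω p k ≤ K * headMass ω p (node k) := by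
  obtain ⟨K, hK, h⟩ := hω.exists_dyadicWeight_bounds hp
  refine ⟨dyadicWeight ω p 0 + K, ENNReal.add_ne_top.2
    ⟨hω.toIsRadialWeight.dyadicWeight_ne_top hp 0, hK⟩, fun k => ?_⟩
  induction k with
  | zero => simp [dyadicMass_zero, headMass, node_zero]
  | succ k ih =>
    rw [dyadicMass_succ, headMass_node_succ, mul_add, add_comm]
    exact add_le_add ih ((h k).1.trans (mul_le_mul_left le_add_self _))

theorem IsUpperDoubling.exists_headMass_le (hω : IsUpperDoubling ω) {p : ℝ} (hp : 0 ≤ p) :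
    ∃ K : ℝ≥0∞, K ≠ ∞ ∧ ∀ k, headMass ω p (node (k + 1)) ≤ K * dyadicMass ω p k := by
  obtain ⟨K, hK, h⟩ := hω.exists_dyadicWeight_bounds hp
  have h0 := dyadicWeight_ne_zero ω hp 0
  refine ⟨(dyadicWeight ω p 0)⁻¹ + K, ENNReal.add_ne_top.2
    ⟨ENNReal.inv_ne_top.2 h0, hK⟩, fun k => ?_⟩
  induction k with
  | zero =>
    rw [headMass_node_succ, dyadicMass_zero, add_mul,
      ENNReal.inv_mul_cancel h0 (hω.toIsRadialWeight.dyadicWeight_ne_top hp 0)]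
    exact add_le_add (by simp [headMass, node_zero]) (h 0).2
  | succ k ih =>
    rw [dyadicMass_succ, headMass_node_succ, mul_add, add_comm]
    exact add_le_add ((h (k + 1)).2.trans (mul_le_mul_left le_add_self _)) ih

theorem IsRadialWeight.muckenhouptCondition_iff (hω : IsRadialWeight ω) {p : ℝ} (hp : 1 < p) :
    MuckenhouptCondition ω p ↔ ∃ M : ℝ≥0∞, M ≠ ∞ ∧ ∀ r ∈ Set.Ioo (0 : ℝ) 1,
      headMass ω p r * tailPower ω p.conjExponent r ^ (p - 1) ≤ M := by
  have hp0 : 0 < p := by linarith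
  have hpq := Real.HolderConjugate.conjExponent hp
  have e : ∀ r ∈ Set.Ioo (0 : ℝ) 1,
      (1 + ∫⁻ t in Set.Ico 0 r, ENNReal.ofReal (1 / tail ω t ^ p)) ^ (1 / p) *
      (∫⁻ t in Set.Ico r 1, ENNReal.ofReal (ω t ^ p.conjExponent)) ^ (1 / p.conjExponent) =
      (headMass ω p r * tailPower ω p.conjExponent r ^ (p - 1)) ^ (1 / p) := by
    intro r hr
    rw [ENNReal.mul_rpow_of_nonneg _ _ (by positivity), ← ENNReal.rpow_mul]
    have e1 : (p - 1) * (1 / p) = 1 / p.conjExponent := by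
      rw [Real.conjExponent]
      have : p - 1 ≠ 0 := by linarith
      field_simp
    rw [e1]
    congr 2
    · unfold headMass
      congr 1
      refine setLIntegral_congr_fun measurableSet_Ico fun t ht => ?_
      have := hω.tail_pos t ⟨ht.1, ht.2.trans hr.2⟩
      rw [one_div, ← Real.inv_rpow this.le, ← ENNReal.ofReal_rpow_of_nonneg (by positivity) hp0.le,
        ENNReal.ofReal_inv_of_pos this]
    · refine setLIntegral_congr_fun measurableSet_Ico fun t ht => ?_
      exact (ENNReal.ofReal_rpow_of_nonneg (hω.nonneg t ⟨hr.1.le.trans ht.1, ht.2⟩)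
        hpq.symm.pos.le).symm
  unfold MuckenhouptCondition
  constructor
  · intro h
    refine ⟨_, ENNReal.rpow_ne_top_of_nonneg hp0.le h.ne, fun r hr => ?_⟩
    have h1 := le_iSup₂ (f := fun (r : ℝ) (_ : r ∈ Set.Ioo (0 : ℝ) 1) =>
      (1 + ∫⁻ t in Set.Ico 0 r, ENNReal.ofReal (1 / tail ω t ^ p)) ^ (1 / p) *
      (∫⁻ t in Set.Ico r 1, ENNReal.ofReal (ω t ^ p.conjExponent)) ^ (1 / p.conjExponent)) r hr
    have h2 := ENNReal.rpow_le_rpow h1 hp0.le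
    rwa [e r hr, ← ENNReal.rpow_mul, one_div_mul_cancel hp0.ne', ENNReal.rpow_one] at h2
  · rintro ⟨M, hM, h⟩
    refine lt_of_le_of_lt (iSup₂_le fun r hr => ?_)
      (ENNReal.rpow_ne_top_of_nonneg (y := 1 / p) (by positivity) hM).lt_top
    rw [e r hr]
    gcongr
    exact h r hr

/-- The supremum in the Muckenhoupt condition excludes r = 0, while the dyadic version uses r_0 = 0;
monotone convergence fills the gap. -/
theorem tailPower_zero_eq_iSup (ω : ℝ → ℝ) (q : ℝ) :
    tailPower ω q 0 = ⨆ n : ℕ, tailPower ω q ((n + 2 : ℝ))⁻¹ := by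
  have hU : ⋃ n : ℕ, Set.Ico ((n + 2 : ℝ))⁻¹ 1 = Set.Ioo 0 1 := by
    ext t
    simp only [Set.mem_iUnion, Set.mem_Ico, Set.mem_Ioo]
    refine ⟨fun ⟨n, h1, h2⟩ => ⟨lt_of_lt_of_le (by positivity) h1, h2⟩, fun ⟨h1, h2⟩ => ?_⟩
    obtain ⟨n, hn⟩ := exists_nat_gt t⁻¹
    refine ⟨n, ?_, h2⟩
    rw [inv_le_comm₀ (by positivity) h1]
    linarith
  unfold tailPower
  rw [setLIntegral_congr (Ioo_ae_eq_Ico (μ := volume)).symm, ← hU]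
  refine setLIntegral_iUnion_of_directed _ (directed_of_isDirected_le ?_)
  intro m n hmn
  refine Set.Ico_subset_Ico_left ?_
  have : (m : ℝ) ≤ n := by exact_mod_cast hmn
  gcongr

/-- For r in [r_k, r_{k+1}) monotonicity replaces the head by its value at r_{k+1} and the tail by
its value at r_k; that head is still controlled by the dyadic mass up to k, thanks to doubling. -/
theorem IsUpperDoubling.muckenhouptCondition_iff_dyadic (hω : IsUpperDoubling ω) {p : ℝ}
    (hp : 1 < p) : MuckenhouptCondition ω p ↔ ∃ M : ℝ≥0∞, M ≠ ∞ ∧ ∀ k,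
      dyadicMass ω p k * tailPower ω p.conjExponent (node k) ^ (p - 1) ≤ M := by
  have hp0 : 0 < p := by linarith
  have hp1 : 0 < p - 1 := by linarith
  rw [hω.toIsRadialWeight.muckenhouptCondition_iff hp]
  constructor
  · rintro ⟨M, hM, h⟩
    obtain ⟨K, hK, hmass⟩ := hω.exists_dyadicMass_le hp0.le
    have hzero : headMass ω p (node 0) * tailPower ω p.conjExponent (node 0) ^ (p - 1) ≤ M := by
      have h1 : tailPower ω p.conjExponent 0 ≤ M ^ (1 / (p - 1)) := by
        rw [tailPower_zero_eq_iSup]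
        refine iSup_le fun n => ?_
        rw [one_div, ENNReal.le_rpow_inv_iff hp1]
        refine le_trans ?_ (h ((n + 2 : ℝ))⁻¹ ⟨by positivity, inv_lt_one_of_one_lt₀ (by
          have : (0 : ℝ) ≤ n := by positivity
          linarith)⟩)
        exact le_mul_of_one_le_left' le_self_add
      rw [one_div, ENNReal.le_rpow_inv_iff hp1] at h1
      simpa [headMass, node_zero] using h1
    refine ⟨K * M, ENNReal.mul_ne_top hK hM, fun k => ?_⟩
    calc _ ≤ K * headMass ω p (node k) * tailPower ω p.conjExponent (node k) ^ (p - 1) :=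
          mul_le_mul_left (hmass k) _
      _ ≤ K * M := by
          rw [mul_assoc]
          refine mul_le_mul_right ?_ _
          cases k with
          | zero => exact hzero
          | succ k =>
            refine h _ ⟨?_, node_lt_one _⟩
            have := node_succ_sub k
            have h1 := node_nonneg k
            have h2 : (0 : ℝ) < (1 / 2) ^ (k + 1) := by positivity
            linarith
  · rintro ⟨M, hM, h⟩
    obtain ⟨K, hK, hmass⟩ := hω.exists_headMass_le hp0.le
    refine ⟨K * M, ENNReal.mul_ne_top hK hM, fun r hr => ?_⟩
    have hr' : r ∈ ⋃ k, Set.Ico (node k) (node (k + 1)) := by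
      rw [iUnion_Ico_node]
      exact ⟨hr.1.le, hr.2⟩
    obtain ⟨k, hk⟩ := Set.mem_iUnion.1 hr'
    calc _ ≤ headMass ω p (node (k + 1)) * tailPower ω p.conjExponent (node k) ^ (p - 1) :=
          mul_le_mul' (headMass_mono ω p hk.2.le)
            (ENNReal.rpow_le_rpow (tailPower_anti ω _ hk.1) hp1.le)
      _ ≤ K * dyadicMass ω p k * tailPower ω p.conjExponent (node k) ^ (p - 1) :=
          mul_le_mul_left (hmass k) _
      _ ≤ K * M := by
          rw [mul_assoc]
          exact mul_le_mul_right (h k) _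

end

section


/-! ### Boundedness on `L^p[0,1)` and the Muckenhoupt condition -/

variable {ω : ℝ → ℝ}

theorem IsRadialWeight.aemeasurable_ofReal (hω : IsRadialWeight ω) {s : Set ℝ}
    (hs : s ⊆ Set.Ico 0 1) : AEMeasurable (fun t => ENNReal.ofReal (ω t)) (volume.restrict s) :=
  (hω.integrable.1.aemeasurable.mono_measure (Measure.restrict_mono_set _ hs)).ennreal_ofReal

theorem aemeasurable_enorm_of_subset {f : ℝ → ℂ} (hf : AEStronglyMeasurable f unitMeasure)
    {s : Set ℝ} (hs : s ⊆ Set.Ico 0 1) : AEMeasurable (fun t => ‖f t‖ₑ) (volume.restrict s) :=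
  (hf.mono_measure (Measure.restrict_mono_set _ hs)).enorm

theorem Ico_node_subset (k : ℕ) : Set.Ico (node k) 1 ⊆ Set.Ico 0 1 :=
  Set.Ico_subset_Ico_left (node_nonneg k)

theorem Ico_node_succ_subset (k : ℕ) : Set.Ico (node k) (node (k + 1)) ⊆ Set.Ico 0 1 :=
  Set.Ico_subset_Ico (node_nonneg k) (node_lt_one _).le

theorem IsRadialWeight.lintegral_enorm_mul_le (hω : IsRadialWeight ω) {p q : ℝ}
    (hpq : p.HolderConjugate q) {f : ℝ → ℂ} (hf : AEStronglyMeasurable f unitMeasure) {s : Set ℝ}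
    (hs : s ⊆ Set.Ico 0 1) :
    ∫⁻ t in s, ‖f t‖ₑ * ENNReal.ofReal (ω t) ≤
      (∫⁻ t in s, ‖f t‖ₑ ^ p) ^ (1 / p) * (∫⁻ t in s, ENNReal.ofReal (ω t) ^ q) ^ (1 / q) :=
  ENNReal.lintegral_mul_le_Lp_mul_Lq _ hpq (aemeasurable_enorm_of_subset hf hs)
    (hω.aemeasurable_ofReal hs)

/-- If it vanished, Hölder's inequality with f = 1 would force ω̂(r_k) = 0. -/
theorem IsRadialWeight.tailPower_node_ne_zero (hω : IsRadialWeight ω) {p q : ℝ}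
    (hpq : p.HolderConjugate q) (k : ℕ) : tailPower ω q (node k) ≠ 0 := by
  intro h
  have h1 := hω.lintegral_enorm_mul_le hpq (f := fun _ => 1) aestronglyMeasurable_const
    (Ico_node_subset k)
  unfold tailPower at h
  rw [h, ENNReal.zero_rpow_of_pos (one_div_pos.2 hpq.symm.pos), mul_zero] at h1
  simp only [enorm_one, one_mul] at h1
  rw [← hω.ofReal_tail (node_nonneg k)] at h1
  have := hω.tail_node_pos k
  simp at h1
  linarith

theorem tailPower_node_eq (ω : ℝ → ℝ) (q : ℝ) (k : ℕ) :
    tailPower ω q (node k) = (∫⁻ t in Set.Ico (node k) (node (k + 1)), ENNReal.ofReal (ω t) ^ q) +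
      tailPower ω q (node (k + 1)) :=
  lintegral_Ico_add _ (node_mono (Nat.le_succ k)) (node_lt_one _).le

/-- The dyadic mass is positive, so an infinite tail would make the Muckenhoupt product infinite.
This finiteness at r_0 = 0 also makes H_ω well defined on L^p. -/
theorem IsUpperDoubling.tailPower_node_ne_top (hω : IsUpperDoubling ω) {p : ℝ} (hp : 1 < p)
    (h : MuckenhouptCondition ω p) (k : ℕ) : tailPower ω p.conjExponent (node k) ≠ ∞ := by
  obtain ⟨M, hM, hmuck⟩ := (hω.muckenhouptCondition_iff_dyadic hp).1 h
  intro ht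
  have h1 := hmuck k
  rw [ht, ENNReal.top_rpow_of_pos (by linarith),
    ENNReal.mul_top (dyadicMass_ne_zero ω (by linarith) k)] at h1
  exact hM (top_le_iff.1 h1)

theorem lintegral_Ico_node_le_tsum (φ : ℝ → ℝ≥0∞) (k : ℕ) :
    ∫⁻ t in Set.Ico (node k) 1, φ t ≤
      ∑' j, if k ≤ j then ∫⁻ t in Set.Ico (node j) (node (j + 1)), φ t else 0 := by
  have hsub : Set.Ico (node k) 1 ⊆
      ⋃ j, if k ≤ j then Set.Ico (node j) (node (j + 1)) else ∅ := by
    intro t ht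
    have h := Ico_node_subset k ht
    rw [← iUnion_Ico_node] at h
    obtain ⟨j, hj⟩ := Set.mem_iUnion.1 h
    refine Set.mem_iUnion.2 ⟨j, ?_⟩
    rw [if_pos]
    · exact hj
    · by_contra hkj
      exact absurd (hj.2.trans_le (node_mono (by omega : j + 1 ≤ k))) (not_lt.2 ht.1)
  refine (lintegral_mono_set hsub).trans ((lintegral_iUnion_le _ _).trans (le_of_eq ?_))
  refine tsum_congr fun j => ?_
  split_ifs <;> simp

theorem two_inv_pow_mul_tailAverage_rpow (ω : ℝ → ℝ) {p : ℝ} (hp : 0 ≤ p) (f : ℝ → ℂ) (k : ℕ) :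
    2⁻¹ ^ k * tailAverage ω f k ^ p = dyadicWeight ω p k *
      (∫⁻ t in Set.Ico (node k) 1, ‖f t‖ₑ * ENNReal.ofReal (ω t)) ^ p := by
  rw [tailAverage, div_eq_mul_inv, ENNReal.mul_rpow_of_nonneg _ _ hp, dyadicWeight]
  ring

/-- Hölder on each dyadic interval passes to the sequence of the local L^p norms of f, whose ℓ^p
norm is ‖f‖_p; the weighted discrete Hardy inequality does the rest. -/
theorem IsUpperDoubling.exists_dyadicEnergy_le_lintegral (hω : IsUpperDoubling ω) {p : ℝ}
    (hp : 1 < p) (h : MuckenhouptCondition ω p) :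
    ∃ B : ℝ≥0∞, B ≠ ∞ ∧ ∀ f : ℝ → ℂ, AEStronglyMeasurable f unitMeasure →
      dyadicEnergy ω p f ≤ B * ∫⁻ t, ‖f t‖ₑ ^ p ∂unitMeasure := by
  have hω' := hω.toIsRadialWeight
  have hp0 : 0 < p := by linarith
  have hpq := Real.HolderConjugate.conjExponent hp
  set q := p.conjExponent
  obtain ⟨M, hM, hmuck⟩ := (hω.muckenhouptCondition_iff_dyadic hp).1 h
  obtain ⟨B, hB, hardy⟩ := exists_weighted_hardy_const hpq hM
  refine ⟨B, hB, fun f hf => ?_⟩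
  have h1 := hardy (dyadicWeight ω p) (dyadicMass ω p)
    (fun j => ∫⁻ t in Set.Ico (node j) (node (j + 1)), ENNReal.ofReal (ω t) ^ q)
    (fun k => tailPower ω q (node k)) (dyadicMass_zero ω p) (dyadicMass_succ ω p)
    (tailPower_node_eq ω q) (dyadicMass_ne_zero ω hp0.le) (hω'.dyadicMass_ne_top hp0.le)
    (hω'.tailPower_node_ne_zero hpq) (hω.tailPower_node_ne_top hp h) hmuck
    (fun j => (∫⁻ t in Set.Ico (node j) (node (j + 1)), ‖f t‖ₑ ^ p) ^ (1 / p))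
  have e : ∑' j, ((∫⁻ t in Set.Ico (node j) (node (j + 1)), ‖f t‖ₑ ^ p) ^ (1 / p)) ^ p =
      ∫⁻ t, ‖f t‖ₑ ^ p ∂unitMeasure := by
    rw [unitMeasure, lintegral_Ico_eq_tsum]
    refine tsum_congr fun j => ?_
    rw [← ENNReal.rpow_mul, one_div_mul_cancel hp0.ne', ENNReal.rpow_one]
  rw [e] at h1
  refine le_trans (ENNReal.tsum_le_tsum fun k => ?_) h1
  rw [two_inv_pow_mul_tailAverage_rpow ω hp0.le]
  refine mul_le_mul_right (ENNReal.rpow_le_rpow ?_ hp0.le) _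
  refine (lintegral_Ico_node_le_tsum _ k).trans (ENNReal.tsum_le_tsum fun j => ?_)
  split_ifs
  · rw [mul_comm]
    exact hω'.lintegral_enorm_mul_le hpq hf (Ico_node_succ_subset j)
  · exact le_rfl

theorem eLpNorm_unitMeasure {p : ℝ} (hp : 0 < p) (f : ℝ → ℂ) :
    eLpNorm f (ENNReal.ofReal p) unitMeasure = (∫⁻ t, ‖f t‖ₑ ^ p ∂unitMeasure) ^ (1 / p) := by
  rw [eLpNorm_eq_lintegral_rpow_enorm_toReal (by simpa using hp) ENNReal.ofReal_ne_top,
    ENNReal.toReal_ofReal hp.le]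

theorem IsUpperDoubling.integrable_mul_weight (hω : IsUpperDoubling ω) {p : ℝ} (hp : 1 < p)
    (h : MuckenhouptCondition ω p) {f : ℝ → ℂ} (hf : MemLp f (ENNReal.ofReal p) unitMeasure) :
    Integrable (fun t => f t * (ω t : ℂ)) unitMeasure := by
  have hω' := hω.toIsRadialWeight
  have hp0 : 0 < p := by linarith
  have hpq := Real.HolderConjugate.conjExponent hp
  refine ⟨hf.1.mul (Complex.continuous_ofReal.comp_aestronglyMeasurable hω'.integrable.1), ?_⟩
  have h1 := hω'.lintegral_enorm_mul_le hpq hf.1 (subset_refl (Set.Ico (0 : ℝ) 1))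
  have h2 := hω.tailPower_node_ne_top hp h 0
  have h3 := hf.2
  rw [eLpNorm_unitMeasure hp0] at h3
  rw [node_zero] at h2
  rw [hasFiniteIntegral_iff_enorm]
  refine lt_of_le_of_lt (le_trans (le_of_eq ?_) h1) (ENNReal.mul_lt_top h3
    (ENNReal.rpow_lt_top_of_nonneg (one_div_pos.2 hpq.symm.pos).le h2))
  refine setLIntegral_congr_fun measurableSet_Ico fun t ht => ?_
  rw [enorm_mul, ← ofReal_norm (ω t : ℂ), Complex.norm_real, Real.norm_eq_abs,
    abs_of_nonneg (hω'.nonneg t ht)]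

/-- Sufficiency for all norms at once: a norm enters only through its bound by the dyadic energy. -/
theorem IsUpperDoubling.boundedFromLp (hω : IsUpperDoubling ω) {p : ℝ} (hp : 1 < p)
    (h : MuckenhouptCondition ω p) {N : (ℂ → ℂ) → ℝ≥0∞}
    (hN : ∃ C : ℝ≥0∞, C ≠ ∞ ∧ ∀ f : ℝ → ℂ, AEStronglyMeasurable f unitMeasure →
      Integrable (fun t => f t * (ω t : ℂ)) unitMeasure →
      N (hilbertOp ω f) ≤ C * dyadicEnergy ω p f ^ (1 / p)) :
    BoundedFromLp ω p N := by
  have hp0 : 0 < p := by linarith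
  obtain ⟨C, hC, hN⟩ := hN
  obtain ⟨B, hB, henergy⟩ := hω.exists_dyadicEnergy_le_lintegral hp h
  have hD : C * B ^ (1 / p) ≠ ∞ :=
    ENNReal.mul_ne_top hC (ENNReal.rpow_ne_top_of_nonneg (by positivity) hB)
  refine ⟨(C * B ^ (1 / p)).toNNReal, fun f hf => ?_⟩
  have hint := hω.integrable_mul_weight hp h hf
  have hle : N (hilbertOp ω f) ≤
      C * B ^ (1 / p) * eLpNorm f (ENNReal.ofReal p) unitMeasure := by
    refine (hN f hf.1 hint).trans ?_
    rw [eLpNorm_unitMeasure hp0, mul_assoc, ← ENNReal.mul_rpow_of_nonneg _ _ (by positivity)]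
    exact mul_le_mul_right (ENNReal.rpow_le_rpow (henergy f hf.1) (by positivity)) _
  rw [ENNReal.coe_toNNReal hD]
  exact ⟨hω.hilbertOpDefined hint, ⟨hω.differentiableOn_hilbertOp hint,
    hle.trans_lt (ENNReal.mul_lt_top hD.lt_top hf.2)⟩, hle⟩

/-! ### Necessity: truncated extremal functions -/

/-- The truncated power `min(ω,n)^{q-1}` on `[1-2^{-k},1)`. -/
def truncatedPower (ω : ℝ → ℝ) (q : ℝ) (k n : ℕ) : ℝ → ℝ :=
  (Set.Ico (node k) 1).indicator fun t => min (ω t) n ^ (q - 1)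

/-- The integral of `min(ω,n)^q` over `[1-2^{-k},1)`. -/
def truncatedTailPower (ω : ℝ → ℝ) (q : ℝ) (k n : ℕ) : ℝ≥0∞ :=
  ∫⁻ t in Set.Ico (node k) 1, ENNReal.ofReal (min (ω t) n) ^ q

theorem IsRadialWeight.truncatedPower_nonneg (hω : IsRadialWeight ω) (q : ℝ) (k n : ℕ) (t : ℝ) :
    0 ≤ truncatedPower ω q k n t := by
  refine Set.indicator_nonneg (fun t ht => ?_) t
  exact Real.rpow_nonneg (le_min (hω.nonneg t (Ico_node_subset k ht)) n.cast_nonneg) _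

theorem IsRadialWeight.truncatedPower_le (hω : IsRadialWeight ω) {q : ℝ} (hq : 1 < q) (k n : ℕ)
    (t : ℝ) : truncatedPower ω q k n t ≤ (n : ℝ) ^ (q - 1) := by
  refine Set.indicator_apply_le' (fun ht => ?_) fun _ => by positivity
  exact Real.rpow_le_rpow (le_min (hω.nonneg t (Ico_node_subset k ht)) n.cast_nonneg)
    (min_le_right _ _) (by linarith)

theorem IsRadialWeight.aestronglyMeasurable_truncatedPower (hω : IsRadialWeight ω) (q : ℝ)
    (k n : ℕ) : AEStronglyMeasurable (truncatedPower ω q k n) unitMeasure :=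
  (((hω.integrable.1.aemeasurable.min aemeasurable_const).pow_const _).indicator
    measurableSet_Ico).aestronglyMeasurable

theorem IsRadialWeight.isTestFunction_truncatedPower (hω : IsRadialWeight ω) {q : ℝ} (hq : 1 < q)
    (k n : ℕ) : IsTestFunction ω (truncatedPower ω q k n) where
  nonneg t _ := hω.truncatedPower_nonneg q k n t
  aestronglyMeasurable := hω.aestronglyMeasurable_truncatedPower q k n
  integrable := by
    refine hω.integrable.bdd_mul (c := (n : ℝ) ^ (q - 1))
      (hω.aestronglyMeasurable_truncatedPower q k n) (Filter.Eventually.of_forall fun t => ?_)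
    rw [Real.norm_eq_abs, abs_of_nonneg (hω.truncatedPower_nonneg q k n t)]
    exact hω.truncatedPower_le hq k n t

theorem IsRadialWeight.memLp_truncatedPower (hω : IsRadialWeight ω) {q : ℝ} (hq : 1 < q)
    (k n : ℕ) (r : ℝ≥0∞) : MemLp (fun t => (truncatedPower ω q k n t : ℂ)) r unitMeasure := by
  have : IsFiniteMeasure unitMeasure := by unfold unitMeasure; infer_instance
  refine MemLp.of_bound
    (hω.isTestFunction_truncatedPower hq k n).aestronglyMeasurable_ofReal ((n : ℝ) ^ (q - 1))
    (Filter.Eventually.of_forall fun t => ?_)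
  rw [Complex.norm_real, Real.norm_eq_abs, abs_of_nonneg (hω.truncatedPower_nonneg q k n t)]
  exact hω.truncatedPower_le hq k n t

theorem IsRadialWeight.enorm_truncatedPower (hω : IsRadialWeight ω) {q : ℝ} (hq : 1 < q)
    (k n : ℕ) {t : ℝ} (ht : t ∈ Set.Ico (node k) 1) :
    ‖(truncatedPower ω q k n t : ℂ)‖ₑ = ENNReal.ofReal (min (ω t) n) ^ (q - 1) := by
  rw [← ofReal_norm, Complex.norm_real, Real.norm_eq_abs,
    abs_of_nonneg (hω.truncatedPower_nonneg q k n t), truncatedPower, Set.indicator_of_mem ht,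
    ENNReal.ofReal_rpow_of_nonneg _ (by linarith)]
  exact le_min (hω.nonneg t (Ico_node_subset k ht)) n.cast_nonneg

/-- The exponent q-1 is chosen so that (q-1)p = q, the equality case of Hölder's inequality. -/
theorem IsRadialWeight.lintegral_truncatedPower_rpow_le (hω : IsRadialWeight ω) {p q : ℝ}
    (hpq : p.HolderConjugate q) (k n : ℕ) :
    ∫⁻ t, ‖(truncatedPower ω q k n t : ℂ)‖ₑ ^ p ∂unitMeasure ≤ truncatedTailPower ω q k n := by
  have hexp : (q - 1) * p = q := by
    have h1 := hpq.mul_eq_add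
    linarith
  calc ∫⁻ t, ‖(truncatedPower ω q k n t : ℂ)‖ₑ ^ p ∂unitMeasure
      ≤ ∫⁻ t, (Set.Ico (node k) 1).indicator
          (fun t => ENNReal.ofReal (min (ω t) n) ^ q) t ∂unitMeasure := by
        refine lintegral_mono fun t => ?_
        by_cases ht : t ∈ Set.Ico (node k) 1
        · rw [hω.enorm_truncatedPower hpq.symm.lt k n ht, Set.indicator_of_mem ht,
            ← ENNReal.rpow_mul, hexp]
        · rw [truncatedPower, Set.indicator_of_notMem ht, Set.indicator_of_notMem ht]
          simp [hpq.pos]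
    _ ≤ ∫⁻ t in Set.Ico (node k) 1, ENNReal.ofReal (min (ω t) n) ^ q ∂unitMeasure :=
        lintegral_indicator_le _ _
    _ ≤ _ := lintegral_mono' (Measure.restrict_mono_measure Measure.restrict_le_self _) le_rfl

theorem truncatedTailPower_ne_top (ω : ℝ → ℝ) {q : ℝ} (hq : 0 ≤ q) (k n : ℕ) :
    truncatedTailPower ω q k n ≠ ∞ := by
  refine ne_top_of_le_ne_top ?_ (lintegral_mono fun t => ENNReal.rpow_le_rpow
    (ENNReal.ofReal_le_ofReal (min_le_right (ω t) n)) hq)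
  rw [setLIntegral_const]
  exact ENNReal.mul_ne_top (ENNReal.rpow_ne_top_of_nonneg hq ENNReal.ofReal_ne_top)
    measure_Ico_lt_top.ne

/-- For every i ≤ k the interval [r_i,1) contains the support of the test function, so each such
term of the energy has the same lower bound, and the weights add up to the dyadic mass. -/
theorem IsRadialWeight.dyadicMass_mul_le_dyadicEnergy (hω : IsRadialWeight ω) {p q : ℝ}
    (hpq : p.HolderConjugate q) (k n : ℕ) :
    dyadicMass ω p k * truncatedTailPower ω q k n ^ p ≤
      dyadicEnergy ω p fun t => (truncatedPower ω q k n t : ℂ) := by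
  have hp := hpq.pos
  have hq1 := hpq.symm.lt
  have hmass : truncatedTailPower ω q k n ≤ ∫⁻ t in Set.Ico (node k) 1,
      ‖(truncatedPower ω q k n t : ℂ)‖ₑ * ENNReal.ofReal (ω t) := by
    refine setLIntegral_mono' measurableSet_Ico fun t ht => ?_
    rw [hω.enorm_truncatedPower hq1 k n ht]
    calc ENNReal.ofReal (min (ω t) n) ^ q
        = ENNReal.ofReal (min (ω t) n) ^ (q - 1) * ENNReal.ofReal (min (ω t) n) := by
          nth_rewrite 3 [← ENNReal.rpow_one (ENNReal.ofReal (min (ω t) n))]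
          rw [← ENNReal.rpow_add_of_nonneg _ _ (by linarith) (by norm_num), sub_add_cancel]
      _ ≤ _ := by
          gcongr
          exact min_le_left _ _
  refine le_trans ?_ (ENNReal.sum_le_tsum (Finset.range (k + 1)))
  rw [dyadicMass, Finset.sum_mul]
  refine Finset.sum_le_sum fun i hi => ?_
  have hik : i ≤ k := by simpa [Nat.lt_succ_iff] using hi
  rw [two_inv_pow_mul_tailAverage_rpow ω hp.le]
  refine mul_le_mul_right (ENNReal.rpow_le_rpow (hmass.trans ?_) hp.le) _
  exact lintegral_mono_set (Set.Ico_subset_Ico_left (node_mono hik))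

theorem IsRadialWeight.tailPower_node_le_iSup (hω : IsRadialWeight ω) {q : ℝ} (hq : 0 ≤ q)
    (k : ℕ) : tailPower ω q (node k) ≤ ⨆ n, truncatedTailPower ω q k n := by
  unfold tailPower truncatedTailPower
  rw [← lintegral_iSup']
  · refine lintegral_mono fun t => ?_
    obtain ⟨n, hn⟩ := exists_nat_ge (ω t)
    refine le_trans (le_of_eq ?_)
      (le_iSup (fun n : ℕ => ENNReal.ofReal (min (ω t) n) ^ q) n)
    rw [min_eq_left hn]
  · intro n
    refine AEMeasurable.pow_const (AEMeasurable.ennreal_ofReal (AEMeasurable.min ?_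
      aemeasurable_const)) _
    exact hω.integrable.1.aemeasurable.mono_measure
      (Measure.restrict_mono_set _ (Ico_node_subset k))
  · refine Filter.Eventually.of_forall fun t m n hmn => ?_
    have : (m : ℝ) ≤ n := by exact_mod_cast hmn
    dsimp only
    gcongr

/-- Testing on the truncated power gives V_k X^p ≤ R X, with V_k the dyadic mass and X the truncated
tail. Truncation makes X finite, so one factor cancels and V_k X^{p-1} ≤ R uniformly in the
truncation level, which then tends to infinity. -/
theorem IsUpperDoubling.muckenhouptCondition_of_boundedFromLp (hω : IsUpperDoubling ω) {p : ℝ}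
    (hp : 1 < p) {N : (ℂ → ℂ) → ℝ≥0∞}
    (hN : ∃ C : ℝ≥0∞, C ≠ ∞ ∧ ∀ u : ℝ → ℝ, IsTestFunction ω u →
      dyadicEnergy ω p (fun t => (u t : ℂ)) ≤ C * N (hilbertOp ω fun t => (u t : ℂ)) ^ p)
    (h : BoundedFromLp ω p N) : MuckenhouptCondition ω p := by
  have hω' := hω.toIsRadialWeight
  have hp0 : 0 < p := by linarith
  have hp1 : 0 < p - 1 := by linarith
  have hpq := Real.HolderConjugate.conjExponent hp
  rw [hω.muckenhouptCondition_iff_dyadic hp]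
  set q := p.conjExponent
  obtain ⟨C, hC, hN⟩ := hN
  obtain ⟨D, hD⟩ := h
  have hR : C * (D : ℝ≥0∞) ^ p ≠ ∞ :=
    ENNReal.mul_ne_top hC (ENNReal.rpow_ne_top_of_nonneg hp0.le ENNReal.coe_ne_top)
  refine ⟨C * (D : ℝ≥0∞) ^ p, hR, fun k => ?_⟩
  set R := C * (D : ℝ≥0∞) ^ p
  have hV0 := dyadicMass_ne_zero ω hp0.le k
  have hVt := hω'.dyadicMass_ne_top hp0.le k
  have htrunc : ∀ n, truncatedTailPower ω q k n ≤ (R / dyadicMass ω p k) ^ (p - 1)⁻¹ := by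
    intro n
    set X := truncatedTailPower ω q k n with hX
    rw [ENNReal.le_rpow_inv_iff hp1, ENNReal.le_div_iff_mul_le (Or.inl hV0) (Or.inl hVt), mul_comm]
    -- Cancelling X requires X ≠ 0, and nothing in the definition prevents X = 0, as for n = 0.
    rcases eq_or_ne X 0 with hX0 | hX0
    · rw [hX0, ENNReal.zero_rpow_of_pos hp1, mul_zero]
      exact zero_le
    have hXt : X ≠ ∞ := truncatedTailPower_ne_top ω hpq.symm.pos.le k n
    have h1 := (hD _ (hω'.memLp_truncatedPower hpq.symm.lt k n _)).2.2
    have h2 := hN _ (hω'.isTestFunction_truncatedPower hpq.symm.lt k n)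
    have h3 : dyadicMass ω p k * X ^ p ≤ R * X := by
      refine (hω'.dyadicMass_mul_le_dyadicEnergy hpq k n).trans (h2.trans ?_)
      calc _ ≤ C * (D * eLpNorm (fun t => (truncatedPower ω q k n t : ℂ))
            (ENNReal.ofReal p) unitMeasure) ^ p :=
            mul_le_mul_right (ENNReal.rpow_le_rpow h1 hp0.le) _
        _ = R * ∫⁻ t, ‖(truncatedPower ω q k n t : ℂ)‖ₑ ^ p ∂unitMeasure := by
            rw [ENNReal.mul_rpow_of_nonneg _ _ hp0.le, eLpNorm_unitMeasure hp0,
              ← ENNReal.rpow_mul, one_div_mul_cancel hp0.ne', ENNReal.rpow_one, ← mul_assoc]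
        _ ≤ _ := mul_le_mul_right (hω'.lintegral_truncatedPower_rpow_le hpq k n) _
    have e : X ^ p = X ^ (p - 1) * X := by
      nth_rewrite 3 [← ENNReal.rpow_one X]
      rw [← ENNReal.rpow_add _ _ hX0 hXt, sub_add_cancel]
    rw [e, ← mul_assoc] at h3
    exact (ENNReal.mul_le_mul_iff_left hX0 hXt).1 h3
  have htail : tailPower ω q (node k) ≤ (R / dyadicMass ω p k) ^ (p - 1)⁻¹ :=
    (hω'.tailPower_node_le_iSup hpq.symm.pos.le k).trans (iSup_le htrunc)
  rwa [ENNReal.le_rpow_inv_iff hp1, ENNReal.le_div_iff_mul_le (Or.inl hV0) (Or.inl hVt),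
    mul_comm] at htail

/-- Boundedness on the Hardy space follows from boundedness on `L^p[0,1)` by restriction of
`f ∈ H^p` to the radius. -/
theorem BoundedFromLp.boundedOnHardy {p : ℝ} (hp : 1 < p)
    (h : BoundedFromLp ω p (hardyNorm p)) : BoundedOnHardy ω p := by
  have hp0 : 0 < p := by linarith
  obtain ⟨D, hD⟩ := h
  obtain ⟨K, hK, hFR⟩ := exists_fejerRiesz_const (Real.HolderConjugate.conjExponent hp)
  have hKt : K ^ (1 / p) ≠ ∞ := ENNReal.rpow_ne_top_of_nonneg (by positivity) hK
  refine ⟨D * (K ^ (1 / p)).toNNReal, fun f hf => ?_⟩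
  have hle : eLpNorm (fun t : ℝ => f t) (ENNReal.ofReal p) unitMeasure ≤
      K ^ (1 / p) * hardyNorm p f := by
    have h1 := ENNReal.rpow_le_rpow (hFR f hf.1) (one_div_pos.2 hp0).le
    rw [ENNReal.mul_rpow_of_nonneg _ _ (by positivity), ← ENNReal.rpow_mul,
      mul_one_div_cancel hp0.ne', ENNReal.rpow_one] at h1
    rw [eLpNorm_unitMeasure hp0]
    exact h1
  have hmem : MemLp (fun t : ℝ => f t) (ENNReal.ofReal p) unitMeasure := by
    refine ⟨ContinuousOn.aestronglyMeasurable ?_ measurableSet_Ico,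
      hle.trans_lt (ENNReal.mul_lt_top hKt.lt_top hf.2)⟩
    exact hf.1.continuousOn.comp Complex.continuous_ofReal.continuousOn
      fun t ht => ofReal_mem_disc ht
  obtain ⟨h1, h2, h3⟩ := hD _ hmem
  refine ⟨h1, h2, h3.trans ?_⟩
  rw [ENNReal.coe_mul, ENNReal.coe_toNNReal hKt, mul_assoc]
  exact mul_le_mul_right hle _

end

end RadialHilbert

end

theorem theorem3 (ω : ℝ → ℝ) (hω : RadialHilbert.IsUpperDoubling ω) (p : ℝ) (hp : 1 < p) :
    [ RadialHilbert.BoundedFromLp ω p (RadialHilbert.hardyNorm p),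
      RadialHilbert.BoundedFromLp ω p (RadialHilbert.dirichletNorm p),
      ∀ q : ℝ, 1 < q →
        RadialHilbert.BoundedFromLp ω p (RadialHilbert.mixedNorm p q (p * (1 - 1 / q))),
      ∃ q : ℝ, 1 < q ∧
        RadialHilbert.BoundedFromLp ω p (RadialHilbert.mixedNorm p q (p * (1 - 1 / q))),
      RadialHilbert.BoundedFromLp ω p (RadialHilbert.hardyLittlewoodNorm p),
      RadialHilbert.MuckenhouptCondition ω p ].TFAE ∧
    (RadialHilbert.MuckenhouptCondition ω p → RadialHilbert.BoundedOnHardy ω p) := by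
  have hp0 : 0 < p := by linarith
  have hpp' := Real.HolderConjugate.conjExponent hp
  refine ⟨?_, fun h => (hω.boundedFromLp hp h (hω.exists_hardyNorm_le hpp')).boundedOnHardy hp⟩
  tfae_have 6 → 1 := fun h => hω.boundedFromLp hp h (hω.exists_hardyNorm_le hpp')
  tfae_have 6 → 2 := fun h => hω.boundedFromLp hp h (hω.exists_dirichletNorm_le hpp')
  tfae_have 6 → 3 := fun h q hq => hω.boundedFromLp hp h
    (hω.exists_mixedNorm_le hpp' (Real.HolderConjugate.conjExponent hq))
  tfae_have 6 → 5 := fun h => hω.boundedFromLp hp h (hω.exists_hardyLittlewoodNorm_le hpp')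
  tfae_have 3 → 4 := fun h => ⟨2, by norm_num, h 2 (by norm_num)⟩
  tfae_have 1 → 6 := hω.muckenhouptCondition_of_boundedFromLp hp
    (hω.exists_dyadicEnergy_le_hardyNorm hpp')
  tfae_have 2 → 6 := hω.muckenhouptCondition_of_boundedFromLp hp
    (hω.exists_dyadicEnergy_le_dirichletNorm hpp')
  tfae_have 4 → 6 := fun ⟨_, hq, h⟩ => hω.muckenhouptCondition_of_boundedFromLp hp
    (hω.exists_dyadicEnergy_le_mixedNorm hp0 (Real.HolderConjugate.conjExponent hq)) h
  tfae_have 5 → 6 := hω.muckenhouptCondition_of_boundedFromLp hp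
    (hω.exists_dyadicEnergy_le_hardyLittlewoodNorm hp0)
  tfae_finish
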